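/- Let $F$ be a real function on the space of real symmetric $2\times 2$ matrices that is rotationally invariant ($F(Q^tMQ)=F(M)$ for every symmetric $M$ and every orthogonal $Q$) and does not vanish identically on any non-empty open set of symmetric matrices. Let $\Omega\subset\mathbb{R}^2$ be open, let $\Omega_0\supset\overline\Omega$ be open, and let $u$ be a real analytic function on $\Omega_0$ with $F(D^2u)=0$ in $\Omega$. Put $\mathcal{U}_0=\{p\in\Omega_0 : D^2u(p)=\lambda\,\mathrm{Id}\text{ for some }\lambda=\lambda(p)\in\mathbb{R}\}$. At each point of $\Omega_0\setminus\mathcal{U}_0$ the matrix $D^2u$ has exactly two eigenlines. Suppose that the origin lies in $\overline\Omega\cap\mathcal{U}_0$, and that the first non-zero homogeneous term of degree $\ge 3$ in the Taylor series of $u$ at the origin equals $a\,x^{n+2}$ after a rotation of the $(x,y)$-coordinates, for some $n\ge 1$ and $a\neq 0$; that is, it equals $a\,(x\cos\theta+y\sin\theta)^{n+2}$ for some $\theta\in\mathbb{R}$. Then there exists $\varepsilon>0$ such that the disk $\mathbb{D}(\varepsilon)=\{\xi\in\mathbb{R}^2:|\xi|<\varepsilon\}$ is contained in $\Omega_0$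 and the following hold. 1. $\Gamma:=\mathbb{D}(\varepsilon)\cap\mathcal{U}_0$ is a regular, real analytic (embedded) curve passing through the origin: it is the homeomorphic image of an open interval under a real analytic map with nowhere vanishing derivative. 2. The eigenlines of $D^2u$ extend analytically across $\Gamma$: there are two real analytic line fields $L_1,L_2$ on $\mathbb{D}(\varepsilon)$ such that, at every $p\in\mathbb{D}(\varepsilon)\setminus\Gamma$, the eigenlines of $D^2u(p)$ are exactly $L_1(p)$ and $L_2(p)$. (A line field is real analytic if it is locally spanned by a non-vanishing real analytic vector field.) 3. One of the lines $L_1(0),L_2(0)$ is tangent to $\Gamma$ at the origin. -/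

import Mathlib

open Set Filter Topology Matrix

namespace HessianPlane

/-- The Euclidean plane, with coordinates `x = p 0` and `y = p 1`. -/
abbrev Plane := EuclideanSpace ℝ (Fin 2)

/-- The partial derivative of `f` in the `i`-th coordinate direction. -/
noncomputable def partialDeriv (i : Fin 2) (f : Plane → ℝ) (p : Plane) : ℝ :=
  fderiv ℝ f p (EuclideanSpace.single i 1)

/-- The Hessian matrix `D²u(p)` of second partial derivatives. -/
noncomputable def hess (u : Plane → ℝ) (p : Plane) : Matrix (Fin 2) (Fin 2) ℝ :=
  Matrix.of fun i j => partialDeriv i (partialDeriv j u) p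

/-- `F` is rotationally invariant on the space of symmetric matrices. Only the values of `F` on
symmetric matrices matter, here and below. -/
def RotationallyInvariant (F : Matrix (Fin 2) (Fin 2) ℝ → ℝ) : Prop :=
  ∀ M : Matrix (Fin 2) (Fin 2) ℝ, M.IsSymm →
    ∀ Q ∈ Matrix.orthogonalGroup (Fin 2) ℝ, F (Qᵀ * M * Q) = F M

/-- `F` does not vanish identically on any nonempty (relatively) open subset of the space of
symmetric matrices. -/
def NeverLocallyZero (F : Matrix (Fin 2) (Fin 2) ℝ → ℝ) : Prop :=
  ∀ V : Set (Matrix (Fin 2) (Fin 2) ℝ), IsOpen V → (∃ M ∈ V, M.IsSymm) →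
    ∃ M ∈ V, M.IsSymm ∧ F M ≠ 0

/-- The points of `S` at which `D²u` is a multiple of the identity. -/
def umbilicSet (u : Plane → ℝ) (S : Set Plane) : Set Plane :=
  {p | p ∈ S ∧ ∃ c : ℝ, hess u p = c • (1 : Matrix (Fin 2) (Fin 2) ℝ)}

/-- The homogeneous term of degree `k` in the Taylor series of `u` at the origin. -/
noncomputable def taylorTerm (u : Plane → ℝ) (k : ℕ) (p : Plane) : ℝ :=
  ((k.factorial : ℝ))⁻¹ * iteratedFDeriv ℝ k u 0 (fun _ => p)

/-- `w` is the first nonzero homogeneous term of degree at least `3` in the Taylor series of `u`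
at the origin, and `k` is its degree. -/
def IsLeadingTerm (u : Plane → ℝ) (k : ℕ) (w : Plane → ℝ) : Prop :=
  3 ≤ k ∧ (∀ j, 3 ≤ j → j < k → ∀ p, taylorTerm u j p = 0) ∧
    (∀ p, taylorTerm u k p = w p) ∧ ∃ p, w p ≠ 0

/-- The leading term of degree at least `3` of `u` at the origin is, after a rotation of the
coordinates, of the form `a x ^ (n + 2)` with `a ≠ 0`. -/
def IsParabolicAtOrigin (u : Plane → ℝ) : Prop :=
  ∃ (n : ℕ) (a θ : ℝ), 1 ≤ n ∧ a ≠ 0 ∧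
    IsLeadingTerm u (n + 2) (fun p => a * (Real.cos θ * p 0 + Real.sin θ * p 1) ^ (n + 2))

/-- `ℓ` is a line through the origin spanned by an eigenvector of `M`. -/
def IsEigenline (M : Matrix (Fin 2) (Fin 2) ℝ) (ℓ : Submodule ℝ Plane) : Prop :=
  ∃ (v : Plane) (c : ℝ), v ≠ 0 ∧ M *ᵥ v.ofLp = c • v.ofLp ∧ ℓ = Submodule.span ℝ {v}

/-- `L` is a real analytic line field on `U`: near each point of `U` it is spanned by a
nonvanishing real analytic vector field. -/
def IsAnalyticLineField (L : Plane → Submodule ℝ Plane) (U : Set Plane) : Prop :=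
  ∀ p ∈ U, ∃ X : Plane → Plane, AnalyticAt ℝ X p ∧ X p ≠ 0 ∧
    ∀ᶠ q in 𝓝 p, L q = Submodule.span ℝ {X q}

/-- `γ`, restricted to `(α, β)`, is a regular real analytic parametrization of `Γ` that is a
homeomorphism onto `Γ`. -/
def ParametrizesRegularAnalyticCurve (γ : ℝ → Plane) (α β : ℝ) (Γ : Set Plane) : Prop :=
  AnalyticOnNhd ℝ γ (Ioo α β) ∧ (∀ t ∈ Ioo α β, deriv γ t ≠ 0) ∧
    IsEmbedding ((Ioo α β).domRestrict γ) ∧ γ '' Ioo α β = Γ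

end HessianPlane

/-! After the rotation let `v` be `u` in coordinates `(x, y)`, with leading term `a x ^ (m + 2)`,
and put `A = v_xx - v_yy`, `B = 2 v_xy`, and `H` the Laplacian of `v` minus its value at the origin.
Umbilics are the common zeros of `A` and `B`, so everything follows from a factorization `A = (x -
σ(y)) ^ m a`, `B = (x - σ(y)) ^ m b` with `σ(0) = σ'(0) = 0`, `a(0) ≠ 0`, `b(0) = 0`
(`exists_umbilic_factorization`). The umbilic set is then the graph of `σ`, and off it the
eigenlines are those of the traceless matrix given by `(a, b)`, which is analytic and non-zero
across the graph; at the origin they are the coordinate axes, and the graph is tangent to the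
`y`-axis.

Two relations are available. Symmetry of third derivatives gives `A_x + B_y = H_x` and `B_x = A_y +
H_y`; for `Q = A - iB`, `R = A + iB` this reads `(∂x + i∂y) Q = (∂x - i∂y) H` and `(∂x - i∂y) R =
(∂x + i∂y) H`. Moreover `H` and `QR = A² + B²` have vanishing Jacobian: otherwise trace and
discriminant of the Hessian would fill an open set, and `F`, which depends on these two invariants
only, would vanish on an open set of matrices. This holds on `Ω` and extends to a neighbourhood of
the origin by analyticity.

The core is formal (`dvd_of_codazzi`): `H` divides `Q`, and by symmetry `R`, in the factorial ring
of complex power series in `x`, `y`. Let `f` be a prime factor of `H`. Its initial form is a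
multiple of a power of `x`, so `f` does not divide `(∂x + s∂y) f`, and the first-order equations
force equal multiplicities of `f` in `H` and in any of `Q`, `R` that it divides. If `f` did not
divide `Q`, it would divide `R`, since `QR` is constant along `f = 0` and vanishes at the origin.
Cancelling the powers of `f` in `H` and `R`, a further quotient is constant along `f = 0`
(`exists_eq_const_mul`), and comparing lowest-order terms makes this constant zero and hence `f ∣
Q`, a contradiction.

With `Q = qH` and `q(0) = 1`, the equation for `Q` becomes a transport equation `H_y = αH_x + βH`.
On the curve `x = σ(y)` where `∂x ^ (m - 1) H = 0`, given by the implicit function theorem, it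
forces all lower `x`-derivatives of `H` to vanish. So `H`, and with it `Q` and `R`, vanishes to
order `m` along that curve. -/

namespace HessianPlane

/-! ### Substitution of `x = a(y)` into formal series. -/

section Evaluation

open PowerSeries

variable {S : Type*} [CommRing S]

/-- The sum of the coefficients `F i * a ^ i`, for `a` without constant term. -/
noncomputable def evalAtAux (a : S⟦X⟧) (F : S⟦X⟧⟦X⟧) : S⟦X⟧ :=
  PowerSeries.mk fun k => coeff k ((trunc (k + 1) F).eval a)

/-- `X` divides `a`, so a polynomial divisible by `X ^ N` takes at `a` a value divisible by `X ^ N`.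
Each coefficient of a substitution therefore depends on a truncation only. -/
lemma coeff_eval_eq_zero {a : S⟦X⟧} (ha : constantCoeff a = 0) {P : Polynomial S⟦X⟧} {N k : ℕ}
    (hk : k < N) (hP : ∀ i < N, P.coeff i = 0) : coeff k (P.eval a) = 0 := by
  obtain ⟨R, rfl⟩ := (Polynomial.X_pow_dvd_iff).2 hP
  obtain ⟨b, rfl⟩ := (PowerSeries.X_dvd_iff).2 ha
  simp only [Polynomial.eval_mul, Polynomial.eval_pow, Polynomial.eval_X, mul_pow, mul_assoc]
  exact (PowerSeries.X_pow_dvd_iff).1 (dvd_mul_right _ _) k hk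

lemma coeff_evalAtAux {a : S⟦X⟧} (ha : constantCoeff a = 0) (F : S⟦X⟧⟦X⟧) {k N : ℕ} (hk : k < N) :
    coeff k (evalAtAux a F) = coeff k ((trunc N F).eval a) := by
  rw [evalAtAux, coeff_mk, ← sub_eq_zero, ← map_sub, ← Polynomial.eval_sub]
  refine coeff_eval_eq_zero ha k.lt_succ_self fun i hi => ?_
  rw [Polynomial.coeff_sub, coeff_trunc, coeff_trunc, if_pos hi, if_pos (by omega), sub_self]

/-- Evaluation of a power series with coefficients in `S⟦X⟧` at a series `a` without constant
term. -/
noncomputable def evalAt (a : S⟦X⟧) (ha : constantCoeff a = 0) : S⟦X⟧⟦X⟧ →+* S⟦X⟧ where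
  toFun := evalAtAux a
  map_zero' := by ext; simp [evalAtAux]
  map_one' := by ext; simp [evalAtAux, trunc_one]
  map_add' F G := by ext; simp [evalAtAux]
  map_mul' F G := by
    ext k
    have hc : ∀ i ≤ k, ∀ K, coeff i (evalAtAux a K) = coeff i ((trunc (k + 1) K).eval a) :=
      fun i hi K => coeff_evalAtAux ha K (by omega)
    have : coeff k (evalAtAux a F * evalAtAux a G) =
        coeff k ((trunc (k + 1) F * trunc (k + 1) G).eval a) := by
      rw [Polynomial.eval_mul, coeff_mul, coeff_mul]
      refine Finset.sum_congr rfl fun p hp => ?_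
      have := Finset.HasAntidiagonal.mem_antidiagonal.1 hp
      rw [hc _ (by omega), hc _ (by omega)]
    rw [this, hc k le_rfl, ← sub_eq_zero, ← map_sub, ← Polynomial.eval_sub]
    refine coeff_eval_eq_zero ha k.lt_succ_self fun i hi => ?_
    rw [Polynomial.coeff_sub, coeff_trunc, if_pos hi,
      coeff_mul_eq_coeff_trunc_mul_trunc F G hi, ← Polynomial.coe_mul, Polynomial.coeff_coe,
      sub_self]

lemma coeff_evalAt {a : S⟦X⟧} (ha : constantCoeff a = 0) (F : S⟦X⟧⟦X⟧) {k N : ℕ} (hk : k < N) :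
    coeff k (evalAt a ha F) = ∑ i ∈ Finset.range N, coeff k (coeff i F * a ^ i) := by
  change coeff k (evalAtAux a F) = _
  rw [coeff_evalAtAux ha F hk, ← Polynomial.eval₂_id, eval₂_trunc_eq_sum_range, map_sum]
  rfl

@[simp] lemma evalAt_C {a : S⟦X⟧} (ha : constantCoeff a = 0) (b : S⟦X⟧) :
    evalAt a ha (C b) = b := by
  ext k
  rw [coeff_evalAt ha _ (Nat.lt_succ_self k), Finset.sum_eq_single 0]
  · simp
  · intro i _ hi; simp [coeff_C, hi]
  · simp

end Evaluation

/-! ### Series in two variables and their initial forms. -/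

section Bivariate

open PowerSeries

/-- Formal power series in `x` and `y`, as series in `x` over series in `y`. -/
abbrev Formal := ℂ⟦X⟧⟦X⟧

/-- The coefficient of `x ^ i * y ^ j`. -/
noncomputable def cf (i j : ℕ) : Formal →ₗ[ℂ] ℂ := (coeff j).comp ((coeff i).restrictScalars ℂ)

lemma cf_apply (i j : ℕ) (F : Formal) : cf i j F = coeff j (coeff i F) := rfl

lemma formal_ext {F G : Formal} (h : ∀ i j, cf i j F = cf i j G) : F = G := by
  ext i j; exact h i j

/-- The formal derivative `∂/∂x`. -/
noncomputable def dx : Derivation ℂ Formal Formal :=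
  Derivation.mk'
    { toFun := fun F => derivative ℂ⟦X⟧ F
      map_add' := fun F G => map_add _ F G
      map_smul' := fun c F => by
        ext i j
        simp [coeff_derivative] }
    (fun F G => by simp)

/-- The formal derivative `∂/∂y`. -/
noncomputable def dy : Derivation ℂ Formal Formal :=
  Derivation.mk'
    { toFun := fun F => PowerSeries.mk fun i => derivative ℂ (coeff i F)
      map_add' := fun F G => by ext; simp
      map_smul' := fun c F => by ext; simp }
    (fun F G => by
      ext1 i
      simp only [LinearMap.coe_mk, AddHom.coe_mk, coeff_mk, smul_eq_mul, map_add, coeff_mul,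
        map_sum, Derivation.leibniz, Finset.sum_add_distrib]
      congr 1
      rw [← Finset.Nat.sum_antidiagonal_swap]
      simp)

lemma coeff_dy (i : ℕ) (F : Formal) : coeff i (dy F) = derivative ℂ (coeff i F) := by
  simp [dy]

lemma cf_dx (i j : ℕ) (F : Formal) : cf i j (dx F) = (i + 1) * cf (i + 1) j F := by
  change coeff j (coeff i (derivative ℂ⟦X⟧ F)) = _
  rw [coeff_derivative, mul_comm, ← Nat.cast_succ, ← nsmul_eq_mul, map_nsmul, cf_apply]
  simp

lemma cf_dy (i j : ℕ) (F : Formal) : cf i j (dy F) = (j + 1) * cf i (j + 1) F := by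
  rw [cf_apply, coeff_dy, coeff_derivative, cf_apply, mul_comm]

lemma dx_C (g : ℂ⟦X⟧) : dx (C g) = 0 := derivative_C (R := ℂ⟦X⟧)

lemma dy_C (g : ℂ⟦X⟧) : dy (C g) = C (derivative ℂ g) := by
  ext1 i
  rw [coeff_dy, coeff_C, coeff_C]
  split_ifs <;> simp

lemma cf_C_C_mul (i j : ℕ) (c : ℂ) (F : Formal) : cf i j (C (C c) * F) = c * cf i j F := by
  simp [cf_apply]

/-- The constant term. -/
lemma cf_zero_zero (F : Formal) : cf 0 0 F = constantCoeff (constantCoeff F) := by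
  simp [cf_apply]

lemma isUnit_iff_cf (F : Formal) : IsUnit F ↔ cf 0 0 F ≠ 0 := by
  rw [PowerSeries.isUnit_iff_constantCoeff, PowerSeries.isUnit_iff_constantCoeff, cf_zero_zero,
    isUnit_iff_ne_zero]

/-- The substitution `(x, y) ↦ (x, t x)`, whose coefficients are the homogeneous terms. -/
noncomputable def blowUp : Formal →+* (Polynomial ℂ)⟦X⟧ :=
  (evalAt X (by simp)).comp
    (PowerSeries.map ((rescale (Polynomial.X : Polynomial ℂ)).comp (PowerSeries.map Polynomial.C)))

lemma coeff_blowUp (k : ℕ) (F : Formal) : coeff k (blowUp F) =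
    ∑ i ∈ Finset.range (k + 1), Polynomial.monomial (k - i) (cf i (k - i) F) := by
  rw [blowUp, RingHom.comp_apply, coeff_evalAt _ _ (Nat.lt_succ_self k)]
  refine Finset.sum_congr rfl fun i hi => ?_
  have := Finset.mem_range.1 hi
  rw [coeff_mul_X_pow', if_pos (by omega)]
  rw [PowerSeries.coeff_map]
  rw [RingHom.comp_apply, coeff_rescale, PowerSeries.coeff_map, cf_apply, mul_comm,
    Polynomial.C_mul_X_pow_eq_monomial]

lemma coeff_coeff_blowUp {k j : ℕ} (h : j ≤ k) (F : Formal) :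
    (coeff k (blowUp F)).coeff j = cf (k - j) j F := by
  rw [coeff_blowUp, Polynomial.finsetSum_coeff, Finset.sum_eq_single (k - j)]
  · rw [Nat.sub_sub_self h, Polynomial.coeff_monomial, if_pos rfl]
  · intro i hi hij
    have := Finset.mem_range.1 hi
    rw [Polynomial.coeff_monomial, if_neg (by omega)]
  · intro h'; exact absurd (Finset.mem_range.2 (by omega)) h'

lemma coeff_coeff_blowUp_of_lt {k j : ℕ} (h : k < j) (F : Formal) :
    (coeff k (blowUp F)).coeff j = 0 := by
  rw [coeff_blowUp, Polynomial.finsetSum_coeff]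
  refine Finset.sum_eq_zero fun i hi => ?_
  rw [Polynomial.coeff_monomial, if_neg (by omega)]

/-- All terms of `F` have total degree at least `m`. -/
def OrdGe (m : ℕ) (F : Formal) : Prop := ∀ i j, i + j < m → cf i j F = 0

lemma ordGe_iff {m : ℕ} {F : Formal} : OrdGe m F ↔ X ^ m ∣ blowUp F := by
  rw [X_pow_dvd_iff]
  constructor
  · intro h k hk
    ext j
    rcases le_or_gt j k with hj | hj
    · rw [coeff_coeff_blowUp hj, h _ _ (by omega), Polynomial.coeff_zero]
    · rw [coeff_coeff_blowUp_of_lt hj, Polynomial.coeff_zero]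
  · intro h i j hij
    have := congrArg (fun p => p.coeff j) (h _ hij)
    simpa [coeff_coeff_blowUp (Nat.le_add_left j i)] using this

lemma OrdGe.mul {m k : ℕ} {F G : Formal} (hF : OrdGe m F) (hG : OrdGe k G) :
    OrdGe (m + k) (F * G) := by
  rw [ordGe_iff] at *
  rw [map_mul, pow_add]
  exact mul_dvd_mul hF hG

/-- The lowest homogeneous term of `F` is `c * x ^ m`. -/
def IsXLeading (m : ℕ) (c : ℂ) (F : Formal) : Prop :=
  OrdGe m F ∧ cf m 0 F = c ∧ ∀ i j, i + j = m → j ≠ 0 → cf i j F = 0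

lemma isXLeading_iff {m : ℕ} {c : ℂ} {F : Formal} :
    IsXLeading m c F ↔ X ^ m ∣ blowUp F ∧ coeff m (blowUp F) = Polynomial.C c := by
  rw [IsXLeading, ordGe_iff]
  refine and_congr_right fun _ => ⟨fun h => ?_, fun h => ⟨?_, fun i j hij hj => ?_⟩⟩
  · ext j
    rcases le_or_gt j m with hj | hj
    · rw [coeff_coeff_blowUp hj, Polynomial.coeff_C]
      split_ifs with h0
      · rw [h0, Nat.sub_zero, h.1]
      · exact h.2 _ _ (by omega) h0
    · rw [coeff_coeff_blowUp_of_lt hj, Polynomial.coeff_C, if_neg (by omega)]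
  · have := congrArg (fun p => p.coeff 0) h
    simpa [coeff_coeff_blowUp] using this
  · have := congrArg (fun p => p.coeff j) h
    subst hij
    simpa [coeff_coeff_blowUp (Nat.le_add_left j i), Polynomial.coeff_C, hj] using this

/-- Since `ℂ[t]` is a domain, lowest coefficients multiply under `blowUp`. That of the product is a
non-zero constant, hence so is that of each factor. -/
lemma IsXLeading.of_mul {n : ℕ} {c : ℂ} (hc : c ≠ 0) {F G : Formal} (h : IsXLeading n c (F * G)) :
    ∃ m d, d ≠ 0 ∧ IsXLeading m d F := by
  rw [isXLeading_iff, map_mul] at h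
  set f := blowUp F with hf
  set g := blowUp G with hg
  have h0 : f * g ≠ 0 := by
    intro h0
    rw [h0, map_zero] at h
    exact hc (Polynomial.C_eq_zero.1 h.2.symm)
  obtain ⟨hf0, hg0⟩ := mul_ne_zero_iff.1 h0
  have hnotdvd : ¬ X ^ (n + 1) ∣ f * g := by
    rw [X_pow_dvd_iff]
    intro h'
    have := h' n n.lt_succ_self
    rw [h.2] at this
    exact hc (Polynomial.C_eq_zero.1 this)
  obtain ⟨f', hf'⟩ := X_pow_order_dvd (φ := f)
  obtain ⟨g', hg'⟩ := X_pow_order_dvd (φ := g)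
  set a := f.order.toNat
  set b := g.order.toNat
  have hord : ((a + b : ℕ) : ℕ∞) = n := by
    have h1 : (f * g).order = n := by
      refine order_eq_nat.2 ⟨?_, (X_pow_dvd_iff).1 h.1⟩
      rw [h.2]; simpa using hc
    rw [order_mul] at h1
    rw [← h1, Nat.cast_add, coe_toNat_order hf0, coe_toNat_order hg0]
  have hab : a + b = n := by exact_mod_cast hord
  have hfg : coeff a f * coeff b g = Polynomial.C c := by
    rw [← h.2, ← hab]
    conv_rhs => rw [hf', hg', mul_mul_mul_comm, ← pow_add]
    conv_lhs => rw [hf', hg']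
    simp [coeff_X_pow_mul']
  have hu : IsUnit (coeff a f) := by
    refine isUnit_of_mul_isUnit_left (y := coeff b g) ?_
    rw [hfg]; exact Polynomial.isUnit_C.2 (isUnit_iff_ne_zero.2 hc)
  obtain ⟨d, hd, hd'⟩ := Polynomial.isUnit_iff.1 hu
  exact ⟨a, d, hd.ne_zero, isXLeading_iff.2 ⟨⟨f', hf'⟩, hd'.symm⟩⟩

end Bivariate

end HessianPlane

namespace HessianPlane

/-! ### Quotients that are constant along a branch `f = 0`. -/

section Constants

open PowerSeries

lemma isAdicComplete_maximalIdeal :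
    IsAdicComplete (IsLocalRing.maximalIdeal ℂ⟦X⟧) ℂ⟦X⟧ := by
  rw [maximalIdeal_eq_span_X]; infer_instance

/-- The term `c * x ^ m` survives setting `y = 0`. This is the hypothesis of Weierstrass preparation
in `x`. -/
lemma IsXLeading.residue_ne_zero {m : ℕ} {c : ℂ} (hc : c ≠ 0) {f : Formal}
    (h : IsXLeading m c f) : f.map (IsLocalRing.residue ℂ⟦X⟧) ≠ 0 := by
  intro h0
  have := congrArg (coeff m) h0
  rw [coeff_map, map_zero, IsLocalRing.residue_eq_zero_iff, IsLocalRing.mem_maximalIdeal,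
    mem_nonunits_iff, PowerSeries.isUnit_iff_constantCoeff, isUnit_iff_ne_zero, not_not] at this
  apply hc
  rw [← h.2.1, cf_apply, coeff_zero_eq_constantCoeff_apply, this]

/-- Up to a unit `g` is a power of `y`, so `f` would divide `y`, say `y = f * r`. Modulo `y` the
factor `f` is non-zero, so `y ∣ r`, and cancelling `y` makes `f` a unit. -/
lemma not_dvd_C {m : ℕ} {c : ℂ} (hc : c ≠ 0) {f : Formal} (hf : Prime f)
    (h : IsXLeading m c f) {g : ℂ⟦X⟧} (hg : g ≠ 0) : ¬ f ∣ C g := by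
  have hu := X_pow_order_mul_divXPowOrder (f := g)
  obtain ⟨u, hu'⟩ := isUnit_divided_by_X_pow_order hg
  intro hd
  have h1 : f ∣ C (X : ℂ⟦X⟧) := by
    refine hf.dvd_of_dvd_pow (n := g.order.toNat) ?_
    have : C (X : ℂ⟦X⟧) ^ g.order.toNat = C g * C ((u⁻¹ : (ℂ⟦X⟧)ˣ) : ℂ⟦X⟧) := by
      rw [← map_pow, ← map_mul]
      conv_rhs => rw [← hu, ← hu', mul_assoc, Units.mul_inv, mul_one]
    rw [this]
    exact hd.mul_right _
  obtain ⟨r, hr⟩ := h1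
  have h2 := congrArg (PowerSeries.map (IsLocalRing.residue ℂ⟦X⟧)) hr
  have hX : IsLocalRing.residue ℂ⟦X⟧ X = 0 := by
    rw [IsLocalRing.residue_eq_zero_iff, maximalIdeal_eq_span_X]
    exact Ideal.mem_span_singleton_self _
  rw [map_C, hX, map_zero, map_mul, eq_comm, mul_eq_zero,
    or_iff_right (h.residue_ne_zero hc)] at h2
  have h3 : C (X : ℂ⟦X⟧) ∣ r := by
    have : ∀ i, (X : ℂ⟦X⟧) ∣ coeff i r := fun i => by
      have := congrArg (coeff i) h2
      rw [coeff_map, map_zero, IsLocalRing.residue_eq_zero_iff, maximalIdeal_eq_span_X,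
        Ideal.mem_span_singleton] at this
      exact this
    choose s hs using this
    refine ⟨PowerSeries.mk s, ?_⟩
    ext1 i
    rw [coeff_C_mul, coeff_mk, hs]
  obtain ⟨s, rfl⟩ := h3
  have h4 : C (X : ℂ⟦X⟧) ≠ (0 : Formal) := by
    rw [Ne, map_eq_zero_iff _ C_injective]; exact X_ne_zero
  have h5 : f * s = 1 := mul_left_cancel₀ h4 (by rw [mul_one]; nth_rw 2 [hr]; ring)
  exact hf.not_isUnit (IsUnit.of_mul_eq_one _ h5)

/-- In the valuation ring `ℂ⟦X⟧` one of the two series divides the other, and the quotient has zero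
derivative. -/
lemma eq_C_mul_of_wronskian {c d : ℂ⟦X⟧} (hd : d ≠ 0)
    (h : d * derivative ℂ c = derivative ℂ d * c) : ∃ κ : ℂ, c = C κ * d := by
  have key : ∀ e : ℂ⟦X⟧, derivative ℂ e = 0 → e = C (constantCoeff e) := fun e he =>
    derivative.ext (by rw [he, derivative_C]) (by simp)
  rcases ValuationRing.dvd_total c d with ⟨e, rfl⟩ | ⟨e, rfl⟩
  · have hc : c ≠ 0 := left_ne_zero_of_mul hd
    have he : derivative ℂ e = 0 := by
      rw [Derivation.leibniz, smul_eq_mul, smul_eq_mul] at h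
      have : c ^ 2 * derivative ℂ e = 0 := by linear_combination -h
      exact (mul_eq_zero.1 this).resolve_left (pow_ne_zero _ hc)
    have h0 : constantCoeff e ≠ 0 := by
      intro h0
      rw [key e he, h0, map_zero, mul_zero] at hd
      exact hd rfl
    refine ⟨(constantCoeff e)⁻¹, ?_⟩
    have h1 := key e he
    generalize constantCoeff e = a at *
    rw [h1, mul_left_comm, ← map_mul, inv_mul_cancel₀ h0, map_one, mul_one]
  · have he : derivative ℂ e = 0 := by
      rw [Derivation.leibniz, smul_eq_mul, smul_eq_mul] at h
      have : d ^ 2 * derivative ℂ e = 0 := by linear_combination h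
      exact (mul_eq_zero.1 this).resolve_left (pow_ne_zero _ hd)
    exact ⟨constantCoeff e, by rw [mul_comm, ← key e he]⟩

/-- The Hamiltonian derivation of `f`. -/
noncomputable def ham (f : Formal) : Derivation ℂ Formal Formal := dx f • dy - dy f • dx

lemma ham_apply (f g : Formal) : ham f g = dx f * dy g - dy f * dx g := rfl

lemma ham_C (f : Formal) (g : ℂ⟦X⟧) : ham f (C g) = dx f * C (derivative ℂ g) := by
  rw [ham_apply, dx_C, dy_C, mul_zero, sub_zero]

/-- As `ham f f = 0`, the derivation `ham f` descends to the quotient by `f`, where it is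
differentiation along the branch `f = 0`. -/
lemma dvd_ham {f g : Formal} (h : f ∣ g) : f ∣ ham f g := by
  obtain ⟨r, rfl⟩ := h
  refine ⟨ham f r, ?_⟩
  simp only [ham_apply, Derivation.leibniz, smul_eq_mul]
  ring

/-- Modulo the numerator of `D (N / M)`, every monomial of the same degree in `N`, `M` is multiplied
by one common factor. -/
lemma derivation_pow_mul_pow (D : Derivation ℂ Formal Formal) (N M : Formal) (i k : ℕ) :
    M * D (N ^ i * M ^ k) = ((i + k : ℕ) : Formal) * (N ^ i * M ^ k) * D M
      + i * N ^ (i - 1) * M ^ k * (M * D N - N * D M) := by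
  simp only [Derivation.leibniz, Derivation.leibniz_pow, smul_eq_mul, nsmul_eq_mul]
  rcases i with _ | i <;> rcases k with _ | k <;> push_cast <;>
    simp only [pow_succ, pow_zero] <;> ring

/-- A homogeneous form in `N` and `M` with coefficients in `ℂ⟦y⟧`. -/
noncomputable def hform (N M : Formal) (d : ℕ) (c : ℕ → ℂ⟦X⟧) : Formal :=
  ∑ i ∈ Finset.range (d + 1), C (c i) * (N ^ i * M ^ (d - i))

lemma hform_succ (N M : Formal) (d : ℕ) (c : ℕ → ℂ⟦X⟧) (h : c (d + 1) = 0) :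
    hform N M (d + 1) c = M * hform N M d c := by
  rw [hform, Finset.sum_range_succ, h, map_zero, zero_mul, add_zero, hform, Finset.mul_sum]
  refine Finset.sum_congr rfl fun i hi => ?_
  have := Finset.mem_range.1 hi
  rw [show d + 1 - i = d - i + 1 by omega, pow_succ]
  ring

/-- By Weierstrass preparation the quotient by `f` is finite over `A`; if `d` is its rank, any `d +
1` elements are linearly dependent. -/
lemma exists_dvd_sum_C_mul {A : Type*} [CommRing A] [IsLocalRing A]
    [IsAdicComplete (IsLocalRing.maximalIdeal A) A] {f : A⟦X⟧}
    (hf : f.map (IsLocalRing.residue A) ≠ 0) :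
    ∃ d : ℕ, ∀ w : Fin (d + 1) → A⟦X⟧, ∃ g : Fin (d + 1) → A,
      (∃ i, g i ≠ 0) ∧ f ∣ ∑ i, C (g i) * w i := by
  obtain ⟨p, u, hp⟩ := exists_isWeierstrassFactorization hf
  have hfin : Module.Finite A (Polynomial A ⧸ Ideal.span {p}) :=
    hp.isDistinguishedAt.monic.finite_quotient
  let e := hp.algEquivQuotient
  refine ⟨Module.finrank A (Polynomial A ⧸ Ideal.span {p}), fun w => ?_⟩
  let v := fun i => e.symm (Ideal.Quotient.mk _ (w i))
  have hv : ¬ LinearIndependent A v := fun hv => by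
    have := hv.fintype_card_le_finrank
    rw [Fintype.card_fin] at this
    omega
  rw [Fintype.not_linearIndependent_iff] at hv
  obtain ⟨g, hg, hi⟩ := hv
  refine ⟨g, hi, ?_⟩
  have hg' := congrArg e hg
  rw [map_zero, map_sum] at hg'
  rw [← Ideal.mem_span_singleton, ← Ideal.Quotient.eq_zero_iff_mem, ← hg', map_sum]
  refine Finset.sum_congr rfl fun k _ => ?_
  have h1 : e (g k • v k) = g k • e (v k) := map_smul e _ _
  have h2 : e (v k) = Ideal.Quotient.mk _ (w k) := e.apply_symm_apply _
  rw [h1, h2, ← smul_eq_C_mul]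
  rfl

/-- This says that `N / M` is algebraic over `ℂ⟦y⟧` along the branch, in homogeneous form so that
nothing is divided by `M`. -/
lemma exists_relation {m : ℕ} {c : ℂ} (hc : c ≠ 0) {f : Formal} (h : IsXLeading m c f)
    (N M : Formal) : ∃ d c, (∃ i ≤ d, c i ≠ 0) ∧ f ∣ hform N M d c := by
  have := isAdicComplete_maximalIdeal
  obtain ⟨d, hd⟩ := exists_dvd_sum_C_mul (h.residue_ne_zero hc)
  obtain ⟨g, ⟨i, hi⟩, hg⟩ := hd fun i => N ^ (i : ℕ) * M ^ (d - i)
  refine ⟨d, fun k => if hk : k < d + 1 then g ⟨k, hk⟩ else 0, ⟨i, by omega, ?_⟩, ?_⟩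
  · change dite _ _ _ ≠ 0
    rwa [dif_pos i.2]
  · rw [hform, Finset.sum_range]
    convert hg using 3 with k
    rw [dif_pos k.2]

/-- Differentiate the relation along the branch. As `N / M` is constant there, only the coefficients
are differentiated; the extra factors `dx f` and `M` are prime to `f`. -/
lemma dvd_hform_derivative {f N M : Formal} (hf : Prime f) (hfx : ¬ f ∣ dx f) (hM : ¬ f ∣ M)
    (h : f ∣ M * ham f N - N * ham f M) {d : ℕ} {c : ℕ → ℂ⟦X⟧} (hd : f ∣ hform N M d c) :
    f ∣ hform N M d (fun i => derivative ℂ (c i)) := by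
  have key : M * ham f (hform N M d c) =
      dx f * M * hform N M d (fun i => derivative ℂ (c i)) + d * ham f M * hform N M d c +
      (∑ i ∈ Finset.range (d + 1), C (c i) * (i * N ^ (i - 1) * M ^ (d - i))) *
        (M * ham f N - N * ham f M) := by
    simp only [hform, map_sum, Finset.mul_sum, Finset.sum_mul, ← Finset.sum_add_distrib]
    refine Finset.sum_congr rfl fun i hi => ?_
    have hi' := Finset.mem_range.1 hi
    have := derivation_pow_mul_pow (ham f) N M i (d - i)
    rw [show i + (d - i) = d by omega] at this
    rw [Derivation.leibniz, smul_eq_mul, smul_eq_mul, ham_C, mul_add, mul_left_comm, this]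
    ring
  have h1 : f ∣ dx f * M * hform N M d (fun i => derivative ℂ (c i)) := by
    have := (dvd_ham hd).mul_left M
    rw [key, add_assoc] at this
    exact (dvd_add_left ((hd.mul_left _).add (h.mul_left _))).1 this
  rcases hf.dvd_or_dvd h1 with h1 | h1
  · rcases hf.dvd_or_dvd h1 with h1 | h1
    · exact absurd h1 hfx
    · exact absurd h1 hM
  · exact h1

/-- In the fraction field of the quotient by `f`, the element `N / M` is a root of a non-zero
complex polynomial. This polynomial splits over `ℂ`, so the root is a complex number. -/
lemma exists_root_of_hform {f N M : Formal} (hf : Prime f) (hM : ¬ f ∣ M) {d : ℕ} {κ : ℕ → ℂ}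
    (hκ : κ d ≠ 0) (hd : f ∣ hform N M d (fun i => C (κ i))) :
    ∃ r : ℂ, f ∣ N - C (C r) * M := by
  have : (Ideal.span {f}).IsPrime := (Ideal.span_singleton_prime hf.ne_zero).2 hf
  let L := FractionRing (Formal ⧸ Ideal.span {f})
  let ι : Formal →+* L := (algebraMap _ L).comp (Ideal.Quotient.mk (Ideal.span {f}))
  have hι : ∀ g, ι g = 0 ↔ f ∣ g := fun g => by
    rw [RingHom.comp_apply, map_eq_zero_iff _ (IsFractionRing.injective _ L),
      Ideal.Quotient.eq_zero_iff_mem, Ideal.mem_span_singleton]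
  let j : ℂ →+* L := ι.comp ((C (R := ℂ⟦X⟧)).comp (C (R := ℂ)))
  have hM' : ι M ≠ 0 := fun h => hM ((hι _).1 h)
  let P : Polynomial ℂ := ∑ i ∈ Finset.range (d + 1), Polynomial.monomial i (κ i)
  have hP : P ≠ 0 := fun h => hκ (by
    have := congrArg (fun p => p.coeff d) h
    simpa [P, Polynomial.finsetSum_coeff, Polynomial.coeff_monomial] using this)
  have hev : Polynomial.eval₂RingHom j (ι N / ι M) P = 0 := by
    have h1 : Polynomial.eval₂RingHom j (ι N / ι M) P * ι M ^ d =
        ι (hform N M d (fun i => C (κ i))) := by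
      simp only [P, hform, map_sum, Finset.sum_mul]
      refine Finset.sum_congr rfl fun i hi => ?_
      have hi' := Finset.mem_range.1 hi
      rw [Polynomial.coe_eval₂RingHom, Polynomial.eval₂_monomial, map_mul, map_mul, map_pow,
        map_pow, div_pow, show d = i + (d - i) by omega, pow_add, Nat.add_sub_cancel_left]
      change ι _ * _ * _ = _
      have h2 : (ι N) ^ i / (ι M) ^ i * (ι M ^ i * ι M ^ (d - i)) = ι N ^ i * ι M ^ (d - i) := by
        rw [← mul_assoc, div_mul_cancel₀ _ (pow_ne_zero _ hM')]
      rw [mul_assoc, h2]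
      rfl
    rw [(hι _).2 hd] at h1
    exact (mul_eq_zero.1 h1).resolve_right (pow_ne_zero _ hM')
  rw [(IsAlgClosed.splits P).eq_prod_roots, map_mul, mul_eq_zero, map_multiset_prod,
    Multiset.prod_eq_zero_iff] at hev
  rcases hev with hev | hev
  · rw [Polynomial.coe_eval₂RingHom, Polynomial.eval₂_C, _root_.map_eq_zero,
      Polynomial.leadingCoeff_eq_zero] at hev
    exact absurd hev hP
  · simp only [Multiset.map_map, Multiset.mem_map, Function.comp_apply] at hev
    obtain ⟨r, -, hr⟩ := hev
    rw [Polynomial.coe_eval₂RingHom, Polynomial.eval₂_sub, Polynomial.eval₂_X,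
      Polynomial.eval₂_C, sub_eq_zero, div_eq_iff hM'] at hr
    refine ⟨r, (hι _).1 ?_⟩
    rw [map_sub, map_mul, hr, sub_eq_zero]
    rfl

/-- A quotient `N / M` which is constant along the branch `f = 0` is a complex number there. -/
lemma exists_eq_const_mul {m : ℕ} {c : ℂ} (hc : c ≠ 0) {f N M : Formal} (hf : Prime f)
    (hlead : IsXLeading m c f) (hfx : ¬ f ∣ dx f) (hM : ¬ f ∣ M)
    (h : f ∣ M * ham f N - N * ham f M) : ∃ r : ℂ, f ∣ N - C (C r) * M := by
  classical
  -- Take a relation of minimal degree `d`.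
  have hex := exists_relation hc hlead N M
  obtain ⟨a, ⟨i₀, hi₀, ha₀⟩, ha⟩ := Nat.find_spec hex
  have hmin : ∀ k < Nat.find hex, ∀ b, f ∣ hform N M k b → ∀ i ≤ k, b i = 0 := by
    intro k hk b hb i hi
    by_contra hbi
    exact Nat.find_min hex hk ⟨b, ⟨i, hi, hbi⟩, hb⟩
  generalize Nat.find hex = d at *
  -- A relation without top coefficient is `M` times one of lower degree, hence trivial by
  -- minimality.
  have hred : ∀ b : ℕ → ℂ⟦X⟧, b d = 0 → f ∣ hform N M d b → ∀ i ≤ d, b i = 0 := by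
    intro b hb hfb i hi
    rcases d with _ | d
    · rwa [Nat.le_zero.1 hi]
    · rw [hform_succ _ _ _ _ hb] at hfb
      rcases Nat.lt_or_ge d i with h' | h'
      · rwa [show i = d + 1 by omega]
      · exact hmin d d.lt_succ_self b ((hf.dvd_or_dvd hfb).resolve_left hM) i h'
  have had : a d ≠ 0 := fun h0 => ha₀ (hred a h0 ha i₀ hi₀)
  have hder := dvd_hform_derivative hf hfx hM h ha
  -- Eliminating the top coefficient between the relation and its derivative leaves the Wronskians
  -- with `a d` as coefficients. So all `a i` are complex multiples of `a d`.
  have hw : ∀ i ≤ d, a d * derivative ℂ (a i) - derivative ℂ (a d) * a i = 0 := by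
    refine hred (fun i => a d * derivative ℂ (a i) - derivative ℂ (a d) * a i) (by ring) ?_
    have : hform N M d (fun i => a d * derivative ℂ (a i) - derivative ℂ (a d) * a i) =
        C (a d) * hform N M d (fun i => derivative ℂ (a i)) -
          C (derivative ℂ (a d)) * hform N M d a := by
      simp only [hform, Finset.mul_sum, ← Finset.sum_sub_distrib, map_sub, map_mul]
      exact Finset.sum_congr rfl fun i _ => by ring
    rw [this]
    exact (hder.mul_left _).sub (ha.mul_left _)
  have hκ : ∀ i, ∃ κ : ℂ, i ≤ d → a i = C κ * a d := fun i => by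
    by_cases hi : i ≤ d
    · obtain ⟨κ, hκ⟩ := eq_C_mul_of_wronskian had (sub_eq_zero.1 (hw i hi))
      exact ⟨κ, fun _ => hκ⟩
    · exact ⟨0, fun h => absurd h hi⟩
  choose κ hκ using hκ
  refine exists_root_of_hform hf hM (d := d) (κ := κ) ?_ ?_
  · intro h0
    have := hκ d le_rfl
    rw [h0, map_zero, zero_mul] at this
    exact had this
  · have : hform N M d a = C (a d) * hform N M d (fun i => C (κ i)) := by
      rw [hform, hform, Finset.mul_sum]
      refine Finset.sum_congr rfl fun i hi => ?_
      rw [hκ i (by have := Finset.mem_range.1 hi; omega), map_mul]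
      ring
    rw [this] at ha
    exact (hf.dvd_or_dvd ha).resolve_left (not_dvd_C hc hf hlead had)

end Constants

end HessianPlane

namespace HessianPlane

/-! ### `H` divides `Q`, one prime factor at a time. -/

section Divisibility

open PowerSeries

/-- The formal derivation `∂/∂x + s ∂/∂y`. -/
noncomputable def del (s : ℂ) : Derivation ℂ Formal Formal := dx + (C (C s) : Formal) • dy

lemma del_apply (s : ℂ) (F : Formal) : del s F = dx F + C (C s) * dy F := rfl

lemma cf_del (s : ℂ) (i j : ℕ) (F : Formal) :
    cf i j (del s F) = (i + 1) * cf (i + 1) j F + s * ((j + 1) * cf i (j + 1) F) := by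
  rw [del_apply, map_add, cf_C_C_mul, cf_dx, cf_dy]

lemma OrdGe.del {m : ℕ} {F : Formal} (h : OrdGe (m + 1) F) (s : ℂ) : OrdGe m (del s F) := by
  intro i j hij
  rw [cf_del, h _ _ (by omega), h _ _ (by omega)]
  ring

lemma ordGe_zero (F : Formal) : OrdGe 0 F := fun _ _ h => absurd h (Nat.not_lt_zero _)

lemma OrdGe.of_dvd {m : ℕ} {F G : Formal} (h : OrdGe m F) (hd : F ∣ G) : OrdGe m G := by
  obtain ⟨r, rfl⟩ := hd
  exact h.mul (ordGe_zero r)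

lemma IsXLeading.cf_del {m : ℕ} {d : ℂ} {f : Formal} (h : IsXLeading (m + 1) d f) (s : ℂ) :
    cf m 0 (del s f) = (m + 1) * d := by
  rw [HessianPlane.cf_del, h.2.1, h.2.2 m (0 + 1) (by omega) (by omega)]
  ring

/-- Multiples of `f` have order at least `m + 1`, whereas `del s f` contains the term `(m + 1) * d *
x ^ m`. -/
lemma IsXLeading.not_dvd_del {m : ℕ} {d : ℂ} (hd : d ≠ 0) {f : Formal}
    (h : IsXLeading (m + 1) d f) (s : ℂ) : ¬ f ∣ HessianPlane.del s f := by
  intro hf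
  have h1 := h.1.of_dvd hf m 0 (by omega)
  rw [h.cf_del] at h1
  exact mul_ne_zero (Nat.cast_add_one_ne_zero m) hd h1

lemma del_zero (F : Formal) : del 0 F = dx F := by simp [del_apply]

lemma not_dvd_natCast_succ_mul {f g : Formal} (h : ¬ f ∣ g) (k : ℕ) :
    ¬ f ∣ ((k + 1 : ℕ) : Formal) * g := by
  have hu : IsUnit ((k + 1 : ℕ) : Formal) := by
    have : ((k + 1 : ℕ) : Formal) = C (C ((k + 1 : ℕ) : ℂ)) := by simp
    rw [this]
    exact (isUnit_iff_ne_zero.2 (Nat.cast_ne_zero.2 k.succ_ne_zero)).map _ |>.map _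
  rwa [hu.dvd_mul_left]

lemma eq_of_pow_mul_eq {f x y : Formal} (hf : f ≠ 0) {a b : ℕ} (hx : ¬ f ∣ x) (hy : ¬ f ∣ y)
    (h : f ^ a * x = f ^ b * y) : a = b := by
  rcases lt_trichotomy a b with hab | hab | hab
  · obtain ⟨k, rfl⟩ := Nat.exists_eq_add_of_lt hab
    refine absurd ⟨f ^ k * y, ?_⟩ hx
    apply mul_left_cancel₀ (pow_ne_zero a hf)
    rw [h]; ring
  · exact hab
  · obtain ⟨k, rfl⟩ := Nat.exists_eq_add_of_lt hab
    refine absurd ⟨f ^ k * x, ?_⟩ hy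
    apply mul_left_cancel₀ (pow_ne_zero b hf)
    rw [← h]; ring

/-- Comparing the multiplicities of `f` in the two sides of `D₁ F = D₂ G`. -/
lemma multiplicity_eq_of_derivation_eq {f r h : Formal} (hf : Prime f) (hr : ¬ f ∣ r) (hh : ¬ f ∣ h)
    (D₁ D₂ : Derivation ℂ Formal Formal) (h₁ : ¬ f ∣ D₁ f) (h₂ : ¬ f ∣ D₂ f) {l k : ℕ}
    (heq : D₁ (f ^ (l + 1) * r) = D₂ (f ^ (k + 1) * h)) :
    l = k ∧ f ∣ r * D₁ f - h * D₂ f := by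
  have expand : ∀ (D : Derivation ℂ Formal Formal) (g : Formal) (n : ℕ),
      D (f ^ (n + 1) * g) = f ^ n * (((n + 1 : ℕ) : Formal) * (g * D f) + f * D g) := by
    intro D g n
    simp only [Derivation.leibniz, Derivation.leibniz_pow, smul_eq_mul, nsmul_eq_mul,
      Nat.add_sub_cancel]
    ring
  -- In characteristic zero a derivation with `¬ f ∣ D f` lowers the multiplicity of `f` by exactly
  -- one.
  have hnd : ∀ (D : Derivation ℂ Formal Formal) (g : Formal) (n : ℕ), ¬ f ∣ g → ¬ f ∣ D f →
      ¬ f ∣ ((n + 1 : ℕ) : Formal) * (g * D f) + f * D g := by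
    intro D g n hg hD hdvd
    have := (dvd_add_left (dvd_mul_right f (D g))).1 hdvd
    refine not_dvd_natCast_succ_mul (fun h' => ?_) n this
    exact (hf.dvd_or_dvd h').elim hg hD
  rw [expand, expand] at heq
  obtain rfl := eq_of_pow_mul_eq hf.ne_zero (hnd _ _ _ hr h₁) (hnd _ _ _ hh h₂) heq
  refine ⟨rfl, ?_⟩
  have := mul_left_cancel₀ (pow_ne_zero l hf.ne_zero) heq
  by_contra hcon
  refine not_dvd_natCast_succ_mul hcon l ⟨D₂ h - D₁ r, ?_⟩
  linear_combination this

lemma exists_eq_pow_succ_mul {f F : Formal} (hf : Prime f) (hF : F ≠ 0) (hd : f ∣ F) :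
    ∃ k r, F = f ^ (k + 1) * r ∧ ¬ f ∣ r := by
  obtain ⟨r, hr, hr'⟩ := (FiniteMultiplicity.of_prime_left hf hF).exists_eq_pow_mul_and_not_dvd
  have : multiplicity f F ≠ 0 := by
    intro h0
    rw [h0, pow_zero, one_mul] at hr
    exact hr' (hr ▸ hd)
  obtain ⟨k, hk⟩ := Nat.exists_eq_succ_of_ne_zero this
  exact ⟨k, r, by rwa [← Nat.succ_eq_add_one, ← hk], hr'⟩

/-- As `f` divides `H`, the bracket condition makes `D` constant along `f = 0`, and the constant is
its value at the origin, which is zero. -/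
lemma dvd_of_bracket_eq_zero {m : ℕ} {d : ℂ} (hd : d ≠ 0) {f H D : Formal} (hf : Prime f)
    (hlead : IsXLeading (m + 1) d f) (hH : H ≠ 0) (hfH : f ∣ H) (hD : cf 0 0 D = 0)
    (hbr : ham H D = 0) : f ∣ D := by
  obtain ⟨k, h, rfl, hh⟩ := exists_eq_pow_succ_mul hf hH hfH
  have hfx : ¬ f ∣ dx f := by rw [← del_zero]; exact hlead.not_dvd_del hd 0
  have h1 : f ∣ ham f D := by
    have h2 : f ^ k * (((k + 1 : ℕ) : Formal) * (h * ham f D) + f * ham h D) = 0 := by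
      rw [← hbr]
      simp only [ham_apply, Derivation.leibniz, Derivation.leibniz_pow, smul_eq_mul, nsmul_eq_mul,
        Nat.add_sub_cancel]
      ring
    have h3 := (mul_eq_zero.1 h2).resolve_left (pow_ne_zero _ hf.ne_zero)
    by_contra hcon
    refine not_dvd_natCast_succ_mul (g := h * ham f D)
      (fun h' => (hf.dvd_or_dvd h').elim hh hcon) k ⟨-ham h D, ?_⟩
    linear_combination h3
  obtain ⟨r, hr⟩ := exists_eq_const_mul hd (N := D) (M := 1) hf hlead hfx
    (fun h => hf.not_isUnit (isUnit_of_dvd_one h)) (by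
      have : ham f 1 = 0 := Derivation.map_one_eq_zero _
      rwa [this, mul_zero, sub_zero, one_mul])
  by_cases h0 : r = 0
  · simpa [h0] using hr
  · refine absurd (isUnit_of_dvd_unit hr ((isUnit_iff_cf _).2 ?_)) hf.not_isUnit
    rw [map_sub, hD, mul_one, cf_zero_zero]
    simpa using h0

/-- If `f ∤ Q`, then `f ∣ R` with the same multiplicity as in `H`. The two equations linking the
cofactors `r` and `h` along `f = 0` then contradict the order of vanishing at the origin. -/
lemma prime_dvd_of_dvd {m : ℕ} {d : ℂ} (hd : d ≠ 0) {f H Q R : Formal} (hf : Prime f)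
    (hlead : IsXLeading (m + 1) d f) (hH : H ≠ 0) (hR : R ≠ 0) (hfH : f ∣ H) (hQ0 : cf 0 0 Q = 0)
    (hR0 : cf 0 0 R = 0) {s t : ℂ} (hRH : del t R = del s H) (hbr : ham H (Q * R) = 0) :
    f ∣ Q := by
  by_contra hQ
  have hQR : OrdGe 1 Q := by
    intro i j hij
    obtain ⟨rfl, rfl⟩ : i = 0 ∧ j = 0 := by omega
    exact hQ0
  have hfR : f ∣ R := by
    refine (hf.dvd_or_dvd (dvd_of_bracket_eq_zero hd hf hlead hH hfH ?_ hbr)).resolve_left hQ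
    rw [cf_zero_zero] at *
    simp [hQ0]
  obtain ⟨k, h, rfl, hh⟩ := exists_eq_pow_succ_mul hf hH hfH
  obtain ⟨l, r, rfl, hr⟩ := exists_eq_pow_succ_mul hf hR hfR
  obtain ⟨rfl, hrh⟩ := multiplicity_eq_of_derivation_eq hf hr hh (del t) (del s)
    (hlead.not_dvd_del hd t) (hlead.not_dvd_del hd s) hRH
  -- With `H = f ^ (l + 1) * h` and `Q * R = f ^ (l + 1) * (Q * r)`, the bracket condition says that
  -- `Q * r / h` is constant along `f = 0`.
  have hbr' : f ∣ h * ham f (Q * r) - Q * r * ham f h := by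
    have h2 : f ^ (2 * l + 1) * (((l + 1 : ℕ) : Formal) * (h * ham f (Q * r) - Q * r * ham f h)
        + f * ham h (Q * r)) = 0 := by
      rw [← hbr, mul_left_comm]
      generalize Q * r = E
      simp only [ham_apply, Derivation.leibniz, Derivation.leibniz_pow, smul_eq_mul, nsmul_eq_mul,
        Nat.add_sub_cancel]
      ring
    have h3 := (mul_eq_zero.1 h2).resolve_left (pow_ne_zero _ hf.ne_zero)
    by_contra hcon
    refine not_dvd_natCast_succ_mul hcon l ⟨-ham h (Q * r), ?_⟩
    linear_combination h3
  have hfx : ¬ f ∣ dx f := by rw [← del_zero]; exact hlead.not_dvd_del hd 0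
  obtain ⟨c, hc⟩ := exists_eq_const_mul hd hf hlead hfx hh hbr'
  -- Eliminate `r` between `Q * r ≡ c * h` and `r * del t f ≡ h * del s f` modulo `f`, then cancel
  -- `h`.
  have key : f ∣ Q * del s f - C (C c) * del t f := by
    have h4 : f ∣ h * (Q * del s f - C (C c) * del t f) := by
      have : h * (Q * del s f - C (C c) * del t f) =
        (Q * r - C (C c) * h) * del t f - Q * (r * del t f - h * del s f) := by ring
      rw [this]
      exact (hc.mul_right _).sub (hrh.mul_left _)
    exact (hf.dvd_or_dvd h4).resolve_left hh
  -- Compare coefficients of `x ^ m`: multiples of `f`, and `Q * del s f` because `Q` vanishes at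
  -- the origin, have order at least `m + 1`, whereas `del t f` contributes `(m + 1) * d ≠ 0`.
  have hc0 : c = 0 := by
    have h5 := hlead.1.of_dvd key m 0 (by omega)
    have h6 : cf m 0 (Q * del s f) = 0 := hQR.mul (hlead.1.del s) m 0 (by omega)
    rw [map_sub, h6, cf_C_C_mul, hlead.cf_del, zero_sub, neg_eq_zero] at h5
    exact (mul_eq_zero.1 h5).resolve_right (mul_ne_zero (Nat.cast_add_one_ne_zero m) hd)
  rw [hc0, map_zero, map_zero, zero_mul, sub_zero] at key
  exact (hf.dvd_or_dvd key).elim hQ (hlead.not_dvd_del hd s)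

/-- For functionally dependent `H` and `Q * R` linked by Codazzi type equations, `H` divides
`Q`. -/
theorem dvd_of_codazzi {n : ℕ} {c : ℂ} (hn : 1 ≤ n) (hc : c ≠ 0) {H Q R : Formal}
    (hH : IsXLeading n c H) (hQ0 : cf 0 0 Q = 0) (hR0 : cf 0 0 R = 0) {s t : ℂ}
    (hQH : del s Q = del t H) (hRH : del t R = del s H) (hbr : ham H (Q * R) = 0) : H ∣ Q := by
  have hH0 : H ≠ 0 := fun h => hc (by rw [← hH.2.1, h, map_zero])
  obtain ⟨n, rfl⟩ := Nat.exists_eq_add_of_le' hn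
  have hne : ∀ {F : Formal} {a b : ℂ}, del a F = del b H → F ≠ 0 := by
    rintro F a b hF rfl
    have := hH.cf_del b
    rw [← hF, map_zero, map_zero] at this
    exact mul_ne_zero (Nat.cast_add_one_ne_zero n) hc this.symm
  rw [UniqueFactorizationMonoid.dvd_iff_emultiplicity_le hH0]
  intro f hf
  by_cases hfH : f ∣ H
  · obtain ⟨g, hg⟩ := hfH
    obtain ⟨m, d, hd, hlead⟩ := IsXLeading.of_mul hc (hg ▸ hH)
    obtain ⟨m, rfl⟩ : ∃ k, m = k + 1 := by
      refine Nat.exists_eq_succ_of_ne_zero ?_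
      rintro rfl
      exact hf.not_isUnit ((isUnit_iff_cf f).2 (by rwa [hlead.2.1]))
    have hfH : f ∣ H := ⟨g, hg⟩
    have hfQ : f ∣ Q := prime_dvd_of_dvd hd hf hlead hH0 (hne hRH) hfH hQ0 hR0 hRH hbr
    obtain ⟨k, h, hk, hh⟩ := exists_eq_pow_succ_mul hf hH0 hfH
    -- Once `f ∣ Q`, the equation `del s Q = del t H` makes the multiplicities of `f` in `Q` and `H`
    -- equal.
    obtain ⟨l, q, hl, hq⟩ := exists_eq_pow_succ_mul hf (hne hQH) hfQ
    rw [hk, hl] at hQH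
    obtain ⟨rfl, -⟩ := multiplicity_eq_of_derivation_eq hf hq hh (del s) (del t)
      (hlead.not_dvd_del hd s) (hlead.not_dvd_del hd t) hQH
    refine emultiplicity_le_emultiplicity_iff.2 fun a ha => ?_
    have hal : a ≤ l + 1 := by
      by_contra hcon
      have : f ^ (l + 2) ∣ H := (pow_dvd_pow f (by omega)).trans ha
      rw [hk, pow_succ, mul_dvd_mul_iff_left (pow_ne_zero _ hf.ne_zero)] at this
      exact hh this
    rw [hl]
    exact (pow_dvd_pow f hal).mul_right _
  · rw [emultiplicity_eq_zero.2 hfH]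
    exact zero_le

end Divisibility

end HessianPlane

namespace HessianPlane

/-! ### Transport along a branch `x = a(y)`. -/

section Branch

open PowerSeries

variable {a : ℂ⟦X⟧} (ha : constantCoeff a = 0)

/-- This is the chain rule for `y ↦ F(a(y), y)`. -/
lemma derivative_evalAt (F : Formal) :
    derivative ℂ (evalAt a ha F) = evalAt a ha (dy F) + derivative ℂ a * evalAt a ha (dx F) := by
  ext k
  have h1 : coeff k (derivative ℂ (evalAt a ha F)) =
      coeff k (derivative ℂ (∑ i ∈ Finset.range (k + 2), coeff i F * a ^ i)) := by
    rw [coeff_derivative, coeff_derivative, coeff_evalAt ha F (by omega : k + 1 < k + 2), map_sum]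
  have h2 : coeff k (evalAt a ha (dy F)) =
      coeff k (∑ i ∈ Finset.range (k + 2), derivative ℂ (coeff i F) * a ^ i) := by
    rw [coeff_evalAt ha _ (by omega : k < k + 2), map_sum]
    simp_rw [coeff_dy]
  have hdx : ∀ i, coeff i (dx F) = coeff (i + 1) F * (i + 1 : ℂ⟦X⟧) := fun i =>
    coeff_derivative (R := ℂ⟦X⟧) F i
  have h3 : coeff k (derivative ℂ a * evalAt a ha (dx F)) =
      coeff k (derivative ℂ a * ∑ i ∈ Finset.range (k + 1),
        coeff (i + 1) F * (i + 1 : ℂ⟦X⟧) * a ^ i) := by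
    rw [coeff_mul, coeff_mul]
    refine Finset.sum_congr rfl fun p hp => ?_
    have := Finset.HasAntidiagonal.mem_antidiagonal.1 hp
    rw [coeff_evalAt ha _ (by omega : p.2 < k + 1), map_sum]
    simp_rw [hdx]
  rw [map_add, h1, h2, h3, ← map_add, map_sum]
  congr 1
  rw [Finset.mul_sum]
  simp only [Derivation.leibniz, Derivation.leibniz_pow, smul_eq_mul, nsmul_eq_mul,
    Finset.sum_add_distrib]
  rw [add_comm]
  congr 1
  · exact Finset.sum_congr rfl fun i _ => mul_comm _ _
  · rw [Finset.sum_range_succ']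
    simp only [Nat.add_sub_cancel, Nat.cast_zero, zero_mul, mul_zero, add_zero, Nat.cast_succ]
    exact Finset.sum_congr rfl fun i _ => by ring

lemma dx_dy (F : Formal) : dx (dy F) = dy (dx F) :=
  formal_ext fun i j => by simp only [cf_dx, cf_dy]; ring

lemma dx_iterate_dy (i : ℕ) (F : Formal) : dx^[i] (dy F) = dy (dx^[i] F) := by
  induction i generalizing F with
  | zero => rfl
  | succ i ih => rw [Function.iterate_succ_apply, dx_dy, ih, Function.iterate_succ_apply]

/-- The first `j` derivatives of `F` in `x` vanish to order `p` along the branch `x = a(y)`. -/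
def VanishesOnBranch (p j : ℕ) (F : Formal) : Prop :=
  ∀ i < j, X ^ p ∣ evalAt a ha (dx^[i] F)

variable {ha}

lemma VanishesOnBranch.add {p j : ℕ} {F G : Formal} (hF : VanishesOnBranch ha p j F)
    (hG : VanishesOnBranch ha p j G) : VanishesOnBranch ha p j (F + G) := by
  intro i hi
  rw [iterate_map_add, map_add]
  exact (hF i hi).add (hG i hi)

lemma VanishesOnBranch.mul_left {p j : ℕ} {F : Formal} (hF : VanishesOnBranch ha p j F)
    (G : Formal) : VanishesOnBranch ha p j (G * F) := by
  induction j generalizing F G with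
  | zero => exact fun i hi => absurd hi (Nat.not_lt_zero i)
  | succ j ih =>
    rintro (_ | i) hi
    · rw [Function.iterate_zero_apply, map_mul]
      exact (hF 0 hi).mul_left _
    · rw [Function.iterate_succ_apply, Derivation.leibniz, smul_eq_mul, smul_eq_mul,
        mul_comm F]
      have h1 : VanishesOnBranch ha p j F := fun i hi => hF i (by omega)
      have h2 : VanishesOnBranch ha p j (dx F) := fun i hi => by
        rw [← Function.iterate_succ_apply]; exact hF (i + 1) (by omega)
      exact ((ih h2 G).add (ih h1 (dx G))) i (by omega)

lemma X_pow_succ_dvd_of_derivative {p : ℕ} {e : ℂ⟦X⟧} (h0 : constantCoeff e = 0)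
    (h : X ^ p ∣ derivative ℂ e) : X ^ (p + 1) ∣ e := by
  rw [X_pow_dvd_iff] at h ⊢
  rintro (_ | k) hk
  · rwa [coeff_zero_eq_constantCoeff_apply]
  · have := h k (by omega)
    rw [coeff_derivative] at this
    exact (mul_eq_zero.1 this).resolve_right (Nat.cast_add_one_ne_zero k)

/-- Along the branch, the `y`-derivative of the `i`-th `x`-derivative of `H`, for `i < n`, is by
transport a combination of the `x`-derivatives of order at most `i + 1 ≤ n`. Vanishing of all of
these to order `p` thus improves to order `p + 1`, and the `n`-th one, which has no such equation,
is zero by hypothesis. -/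
lemma vanishesOnBranch_of_transport {n : ℕ} {H α β : Formal} (hdy : dy H = α * dx H + β * H)
    (h0 : ∀ j < n + 1, cf 0 0 (dx^[j] H) = 0) (hn : evalAt a ha (dx^[n] H) = 0) (p : ℕ) :
    VanishesOnBranch ha p (n + 1) H := by
  have hconst : ∀ F, constantCoeff (evalAt a ha F) = cf 0 0 F := fun F => by
    rw [← coeff_zero_eq_constantCoeff_apply, coeff_evalAt ha F Nat.zero_lt_one]
    simp [cf_apply]
  induction p with
  | zero => intro i _; rw [pow_zero]; exact one_dvd _
  | succ p ih =>
    intro i hi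
    rcases (Nat.lt_succ_iff.1 hi).eq_or_lt with rfl | hin
    · rw [hn]; exact dvd_zero _
    · refine X_pow_succ_dvd_of_derivative (by rw [hconst, h0 i hi]) ?_
      rw [derivative_evalAt, ← dx_iterate_dy, hdy, ← Function.iterate_succ_apply' dx]
      have h1 : VanishesOnBranch ha p n H := fun i hi => ih i (by omega)
      have h2 : VanishesOnBranch ha p n (dx H) := fun i hi => by
        rw [← Function.iterate_succ_apply]; exact ih (i + 1) (by omega)
      exact (((h2.mul_left α).add (h1.mul_left β)) i hin).add ((ih (i + 1) (by omega)).mul_left _)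

lemma evalAt_eq_zero_of_vanishesOnBranch {n : ℕ} {F : Formal}
    (h : ∀ p, VanishesOnBranch ha p n F) {j : ℕ} (hj : j < n) :
    evalAt a ha (dx^[j] F) = 0 := by
  ext k
  exact X_pow_dvd_iff.1 (h (k + 1) j hj) k k.lt_succ_self

lemma cf_iterate_dx (k i j : ℕ) (F : Formal) :
    cf i j (dx^[k] F) = (i + 1).ascFactorial k * cf (i + k) j F := by
  induction k generalizing i F with
  | zero => simp
  | succ k ih =>
    have h := congrArg (Nat.cast (R := ℂ)) (Nat.succ_ascFactorial (i + 1) k)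
    rw [Function.iterate_succ_apply', cf_dx, ih, Nat.ascFactorial_succ,
      show i + 1 + k = i + (k + 1) by omega] at *
    push_cast at *
    linear_combination cf (i + (k + 1)) j F * h

/-- `H` divides `Q` and `R`, so it suffices that `H` vanishes to order `n + 1` on the branch, and
the equation for `Q = H * q` is a transport equation for `H`. -/
theorem vanishes_of_codazzi {n : ℕ} {c : ℂ} (hc : c ≠ 0) {H Q R : Formal}
    (hH : IsXLeading (n + 1) c H) (hQ : IsXLeading (n + 1) c Q) (hR : IsXLeading (n + 1) c R)
    (hQH : del Complex.I Q = del (-Complex.I) H) (hRH : del (-Complex.I) R = del Complex.I H)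
    (hbr : ham H (Q * R) = 0) (hn : evalAt a ha (dx^[n] H) = 0) {j : ℕ} (hj : j < n + 1) :
    evalAt a ha (dx^[j] Q) = 0 ∧ evalAt a ha (dx^[j] R) = 0 := by
  have hQ0 : cf 0 0 Q = 0 := hQ.1 0 0 (by omega)
  have hR0 : cf 0 0 R = 0 := hR.1 0 0 (by omega)
  obtain ⟨q, rfl⟩ := dvd_of_codazzi (by omega) hc hH hQ0 hR0 hQH hRH hbr
  obtain ⟨r, rfl⟩ := dvd_of_codazzi (by omega) hc hH hR0 hQ0 hRH hQH (by rwa [mul_comm])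
  -- `H` and `H * q` have the same leading coefficient `c`.
  have hq : cf 0 0 q = 1 := by
    have h1 : cf (n + 1) 0 (H * q) = c * cf 0 0 q := by
      rw [cf_apply, coeff_mul, map_sum, Finset.sum_eq_single (n + 1, 0)]
      · rw [← hH.2.1]
        simp [cf_apply]
      · rintro ⟨i, k⟩ hik hne
        have hik' := Finset.HasAntidiagonal.mem_antidiagonal.1 hik
        have hi : cf i 0 H = 0 := hH.1 i 0 (by
          have : k ≠ 0 := by rintro rfl; exact hne (by simpa using hik')
          simp only at hik'
          omega)
        rw [cf_apply] at hi
        simp only [coeff_zero_eq_constantCoeff_apply] at hi ⊢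
        rw [map_mul, hi, zero_mul]
      · intro h; simp at h
    rw [hQ.2.1] at h1
    exact (mul_left_cancel₀ hc (by rw [mul_one]; exact h1)).symm
  -- This is the coefficient of `dy H` in the expanded equation; its constant term is `2i`, so the
  -- equation can be solved for `dy H`.
  have hu : IsUnit (C (C Complex.I) * (q + 1)) := by
    rw [isUnit_iff_cf, cf_C_C_mul, map_add, hq, show (1 : Formal) = C (C 1) by simp, cf_zero_zero]
    simp
  obtain ⟨w, hw⟩ := hu.exists_left_inv
  have hdy : dy H = w * (1 - q) * dx H + -(w * del Complex.I q) * H := by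
    rw [Derivation.leibniz, smul_eq_mul, smul_eq_mul] at hQH
    simp only [del_apply, map_neg] at hQH ⊢
    linear_combination (-dy H) * hw + w * hQH
  have hv := vanishesOnBranch_of_transport hdy (fun j hj => by
    rw [cf_iterate_dx, zero_add j, hH.1 j 0 (by omega), mul_zero]) hn
  exact ⟨evalAt_eq_zero_of_vanishesOnBranch (fun p => mul_comm H q ▸ (hv p).mul_left q) hj,
    evalAt_eq_zero_of_vanishesOnBranch (fun p => mul_comm H r ▸ (hv p).mul_left r) hj⟩

end Branch

end HessianPlane

namespace HessianPlane

/-! ### From analytic functions to formal series, in two variables. -/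

section Taylor

/-- The derivative of a function of `(y, x)` with respect to `x`. -/
noncomputable def Dx (f : ℝ × ℝ → ℝ) (q : ℝ × ℝ) : ℝ := fderiv ℝ f q (0, 1)

/-- The derivative of a function of `(y, x)` with respect to `y`. -/
noncomputable def Dy (f : ℝ × ℝ → ℝ) (q : ℝ × ℝ) : ℝ := fderiv ℝ f q (1, 0)

variable {f g : ℝ × ℝ → ℝ} {q : ℝ × ℝ}

lemma analyticAt_Dx (hf : AnalyticAt ℝ f q) : AnalyticAt ℝ (Dx f) q :=
  ((ContinuousLinearMap.apply ℝ ℝ ((0, 1) : ℝ × ℝ)).analyticAt _).comp hf.fderiv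

lemma analyticAt_Dy (hf : AnalyticAt ℝ f q) : AnalyticAt ℝ (Dy f) q :=
  ((ContinuousLinearMap.apply ℝ ℝ ((1, 0) : ℝ × ℝ)).analyticAt _).comp hf.fderiv

lemma analyticAt_Dx_iterate (hf : AnalyticAt ℝ f q) (i : ℕ) : AnalyticAt ℝ (Dx^[i] f) q := by
  induction i generalizing f with
  | zero => exact hf
  | succ i ih => exact ih (analyticAt_Dx hf)

lemma Dx_congr (h : f =ᶠ[𝓝 q] g) : Dx f =ᶠ[𝓝 q] Dx g :=
  h.fderiv.mono fun p hp => by rw [Dx, Dx, hp]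

lemma Dy_congr (h : f =ᶠ[𝓝 q] g) : Dy f =ᶠ[𝓝 q] Dy g :=
  h.fderiv.mono fun p hp => by rw [Dy, Dy, hp]

lemma Dx_iterate_congr (h : f =ᶠ[𝓝 q] g) (i : ℕ) : Dx^[i] f =ᶠ[𝓝 q] Dx^[i] g := by
  induction i generalizing f g with
  | zero => exact h
  | succ i ih => exact ih (Dx_congr h)

lemma Dy_iterate_congr (h : f =ᶠ[𝓝 q] g) (i : ℕ) : Dy^[i] f =ᶠ[𝓝 q] Dy^[i] g := by
  induction i generalizing f g with
  | zero => exact h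
  | succ i ih => exact ih (Dy_congr h)

lemma fderiv_fderiv_apply {E : Type*} [NormedAddCommGroup E] [NormedSpace ℝ E] {f : E → ℝ} {q : E}
    (hf : AnalyticAt ℝ f q) (v w : E) :
    fderiv ℝ (fun p => fderiv ℝ f p v) q w = fderiv ℝ (fderiv ℝ f) q w v := by
  have := hf.fderiv.differentiableAt.hasFDerivAt
  have h2 := ((ContinuousLinearMap.apply ℝ ℝ v).hasFDerivAt (x := fderiv ℝ f q)).comp q this
  exact congrArg (fun L => L w) h2.fderiv

lemma Dx_Dy_eq (hf : AnalyticAt ℝ f q) : Dx (Dy f) q = Dy (Dx f) q := by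
  have h : IsSymmSndFDerivAt ℝ f q :=
    ContDiffAt.isSymmSndFDerivAt (n := ⊤) hf.contDiffAt (by simp)
  change fderiv ℝ (fun p => fderiv ℝ f p (1, 0)) q (0, 1) =
    fderiv ℝ (fun p => fderiv ℝ f p (0, 1)) q (1, 0)
  rw [fderiv_fderiv_apply hf, fderiv_fderiv_apply hf]
  exact h.eq _ _

lemma Dx_Dy_eventuallyEq (hf : AnalyticAt ℝ f q) : Dx (Dy f) =ᶠ[𝓝 q] Dy (Dx f) :=
  hf.eventually_analyticAt.mono fun _ hp => Dx_Dy_eq hp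

lemma Dy_iterate_Dx_eventuallyEq (hf : AnalyticAt ℝ f q) (j : ℕ) :
    Dy^[j] (Dx f) =ᶠ[𝓝 q] Dx (Dy^[j] f) := by
  induction j generalizing f with
  | zero => exact EventuallyEq.rfl
  | succ j ih =>
    rw [Function.iterate_succ_apply, Function.iterate_succ_apply]
    exact (Dy_iterate_congr (Dx_Dy_eventuallyEq hf).symm j).trans (ih (analyticAt_Dy hf))

lemma Dx_add (hf : AnalyticAt ℝ f q) (hg : AnalyticAt ℝ g q) :
    Dx (f + g) =ᶠ[𝓝 q] Dx f + Dx g := by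
  filter_upwards [hf.eventually_analyticAt, hg.eventually_analyticAt] with p hp hp'
  simp only [Dx, Pi.add_apply]
  rw [fderiv_add hp.differentiableAt hp'.differentiableAt]
  rfl

lemma Dy_add (hf : AnalyticAt ℝ f q) (hg : AnalyticAt ℝ g q) :
    Dy (f + g) =ᶠ[𝓝 q] Dy f + Dy g := by
  filter_upwards [hf.eventually_analyticAt, hg.eventually_analyticAt] with p hp hp'
  simp only [Dy, Pi.add_apply]
  rw [fderiv_add hp.differentiableAt hp'.differentiableAt]
  rfl

lemma Dx_mul (hf : AnalyticAt ℝ f q) (hg : AnalyticAt ℝ g q) :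
    Dx (f * g) =ᶠ[𝓝 q] Dx f * g + f * Dx g := by
  filter_upwards [hf.eventually_analyticAt, hg.eventually_analyticAt] with p hp hp'
  simp only [Dx, Pi.add_apply, Pi.mul_apply]
  rw [fderiv_mul hp.differentiableAt hp'.differentiableAt]
  simp; ring

lemma Dy_mul (hf : AnalyticAt ℝ f q) (hg : AnalyticAt ℝ g q) :
    Dy (f * g) =ᶠ[𝓝 q] Dy f * g + f * Dy g := by
  filter_upwards [hf.eventually_analyticAt, hg.eventually_analyticAt] with p hp hp'
  simp only [Dy, Pi.add_apply, Pi.mul_apply]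
  rw [fderiv_mul hp.differentiableAt hp'.differentiableAt]
  simp; ring

/-- The Taylor series at the origin. -/
noncomputable def taylor (f : ℝ × ℝ → ℝ) : Formal :=
  PowerSeries.mk fun i => PowerSeries.mk fun j =>
    ((Dx^[i] (Dy^[j] f) 0 / (i.factorial * j.factorial) : ℝ) : ℂ)

lemma cf_taylor (i j : ℕ) (f : ℝ × ℝ → ℝ) :
    cf i j (taylor f) = ((Dx^[i] (Dy^[j] f) 0 / (i.factorial * j.factorial) : ℝ) : ℂ) := by
  simp [cf_apply, taylor]

lemma taylor_congr (h : f =ᶠ[𝓝 0] g) : taylor f = taylor g :=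
  formal_ext fun i j => by
    rw [cf_taylor, cf_taylor, (Dx_iterate_congr (Dy_iterate_congr h j) i).eq_of_nhds]

lemma taylor_zero_zero (f : ℝ × ℝ → ℝ) : cf 0 0 (taylor f) = f 0 := by
  simp [cf_taylor]

lemma taylor_Dy (f : ℝ × ℝ → ℝ) : taylor (Dy f) = dy (taylor f) :=
  formal_ext fun i j => by
    rw [cf_dy, cf_taylor, cf_taylor, Function.iterate_succ_apply]
    push_cast [Nat.factorial_succ]
    have : (j : ℂ) + 1 ≠ 0 := Nat.cast_add_one_ne_zero j
    field_simp

lemma taylor_Dx (hf : AnalyticAt ℝ f 0) : taylor (Dx f) = dx (taylor f) :=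
  formal_ext fun i j => by
    rw [cf_dx, cf_taylor, cf_taylor, Function.iterate_succ_apply,
      (Dx_iterate_congr (Dy_iterate_Dx_eventuallyEq hf j) i).eq_of_nhds]
    push_cast [Nat.factorial_succ]
    have : (i : ℂ) + 1 ≠ 0 := Nat.cast_add_one_ne_zero i
    field_simp

lemma taylor_Dx_iterate (hf : AnalyticAt ℝ f 0) (i : ℕ) :
    taylor (Dx^[i] f) = dx^[i] (taylor f) := by
  induction i generalizing f with
  | zero => rfl
  | succ i ih =>
    rw [Function.iterate_succ_apply, Function.iterate_succ_apply, ih (analyticAt_Dx hf),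
      taylor_Dx hf]

/-- In characteristic zero the first derivatives control all terms of positive degree. Compatibility
of `taylor` with sums and products follows by induction on the degree, from the Leibniz rule on both
sides. -/
lemma cf_eq_zero_of_derivatives {S : Formal} {k : ℕ} (hx : ∀ i j, i + j = k → cf i j (dx S) = 0)
    (hy : ∀ i j, i + j = k → cf i j (dy S) = 0) : ∀ i j, i + j = k + 1 → cf i j S = 0 := by
  rintro (_ | i) j hij
  · obtain ⟨j, rfl⟩ : ∃ l, j = l + 1 := ⟨k, by omega⟩
    have := hy 0 j (by omega)
    rw [cf_dy] at this
    exact (mul_eq_zero.1 this).resolve_left (Nat.cast_add_one_ne_zero j)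
  · have := hx i j (by omega)
    rw [cf_dx] at this
    exact (mul_eq_zero.1 this).resolve_left (Nat.cast_add_one_ne_zero i)

lemma taylor_add (hf : AnalyticAt ℝ f 0) (hg : AnalyticAt ℝ g 0) :
    taylor (f + g) = taylor f + taylor g := by
  suffices ∀ k, ∀ f g : ℝ × ℝ → ℝ, AnalyticAt ℝ f 0 → AnalyticAt ℝ g 0 → ∀ i j, i + j = k →
      cf i j (taylor (f + g) - (taylor f + taylor g)) = 0 from
    formal_ext fun i j => by
      have := this _ f g hf hg i j rfl
      rwa [map_sub, sub_eq_zero] at this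
  intro k
  induction k with
  | zero =>
    intro f g _ _ i j hij
    obtain ⟨rfl, rfl⟩ : i = 0 ∧ j = 0 := by omega
    simp [taylor_zero_zero]
  | succ k ih =>
    intro f g hf hg
    refine cf_eq_zero_of_derivatives ?_ ?_
    · rw [map_sub, map_add, ← taylor_Dx (hf.add hg), ← taylor_Dx hf, ← taylor_Dx hg,
        taylor_congr (Dx_add hf hg)]
      exact ih _ _ (analyticAt_Dx hf) (analyticAt_Dx hg)
    · rw [map_sub, map_add, ← taylor_Dy, ← taylor_Dy, ← taylor_Dy, taylor_congr (Dy_add hf hg)]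
      exact ih _ _ (analyticAt_Dy hf) (analyticAt_Dy hg)

lemma taylor_mul (hf : AnalyticAt ℝ f 0) (hg : AnalyticAt ℝ g 0) :
    taylor (f * g) = taylor f * taylor g := by
  suffices ∀ k, ∀ f g : ℝ × ℝ → ℝ, AnalyticAt ℝ f 0 → AnalyticAt ℝ g 0 → ∀ i j, i + j = k →
      cf i j (taylor (f * g) - taylor f * taylor g) = 0 from
    formal_ext fun i j => by
      have := this _ f g hf hg i j rfl
      rwa [map_sub, sub_eq_zero] at this
  intro k
  induction k with
  | zero =>
    intro f g _ _ i j hij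
    obtain ⟨rfl, rfl⟩ : i = 0 ∧ j = 0 := by omega
    have hf := taylor_zero_zero f
    have hg := taylor_zero_zero g
    have hfg := taylor_zero_zero (f * g)
    rw [cf_zero_zero] at *
    simp [hf, hg, hfg]
  | succ k ih =>
    intro f g hf hg
    have hfx := analyticAt_Dx hf
    have hgx := analyticAt_Dx hg
    have hfy := analyticAt_Dy hf
    have hgy := analyticAt_Dy hg
    refine cf_eq_zero_of_derivatives (fun i j hij => ?_) (fun i j hij => ?_)
    · have h1 : dx (taylor (f * g) - taylor f * taylor g) =
          (taylor (Dx f * g) - taylor (Dx f) * taylor g) +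
          (taylor (f * Dx g) - taylor f * taylor (Dx g)) := by
        rw [map_sub, ← taylor_Dx (hf.mul hg), taylor_congr (Dx_mul hf hg),
          taylor_add (hfx.mul hg) (hf.mul hgx), taylor_Dx hf, taylor_Dx hg, Derivation.leibniz,
          smul_eq_mul, smul_eq_mul]
        ring
      rw [h1, map_add, ih _ _ hfx hg i j hij, ih _ _ hf hgx i j hij, add_zero]
    · have h1 : dy (taylor (f * g) - taylor f * taylor g) =
          (taylor (Dy f * g) - taylor (Dy f) * taylor g) +
          (taylor (f * Dy g) - taylor f * taylor (Dy g)) := by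
        rw [map_sub, ← taylor_Dy, taylor_congr (Dy_mul hf hg),
          taylor_add (hfy.mul hg) (hf.mul hgy), taylor_Dy, taylor_Dy, Derivation.leibniz,
          smul_eq_mul, smul_eq_mul]
        ring
      rw [h1, map_add, ih _ _ hfy hg i j hij, ih _ _ hf hgy i j hij, add_zero]

end Taylor

/-! ### Taylor series in one variable and along an analytic curve. -/

section OneVariable

open PowerSeries

/-- The Taylor series at the origin of a function of one variable. -/
noncomputable def taylorOne (e : ℝ → ℝ) : ℂ⟦X⟧ :=
  PowerSeries.mk fun j => ((deriv^[j] e 0 / j.factorial : ℝ) : ℂ)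

variable {e g : ℝ → ℝ}

lemma coeff_taylorOne (j : ℕ) (e : ℝ → ℝ) :
    coeff j (taylorOne e) = ((deriv^[j] e 0 / j.factorial : ℝ) : ℂ) := by simp [taylorOne]

lemma constantCoeff_taylorOne (e : ℝ → ℝ) : constantCoeff (taylorOne e) = e 0 := by
  rw [← coeff_zero_eq_constantCoeff_apply, coeff_taylorOne]; simp

lemma taylorOne_deriv (e : ℝ → ℝ) : taylorOne (deriv e) = derivative ℂ (taylorOne e) := by
  ext j
  rw [coeff_derivative, coeff_taylorOne, coeff_taylorOne, Function.iterate_succ_apply]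
  push_cast [Nat.factorial_succ]
  have : (j : ℂ) + 1 ≠ 0 := Nat.cast_add_one_ne_zero j
  field_simp

lemma taylorOne_congr (h : e =ᶠ[𝓝 0] g) : taylorOne e = taylorOne g := by
  ext j
  rw [coeff_taylorOne, coeff_taylorOne]
  have : ∀ j, ∀ e g : ℝ → ℝ, e =ᶠ[𝓝 0] g → deriv^[j] e =ᶠ[𝓝 0] deriv^[j] g := by
    intro j
    induction j with
    | zero => exact fun _ _ h => h
    | succ j ih => exact fun e g h => ih _ _ h.deriv
  rw [(this j e g h).eq_of_nhds]

lemma coeff_eq_zero_of_derivative {S : ℂ⟦X⟧} {k : ℕ} (h : coeff k (derivative ℂ S) = 0) :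
    coeff (k + 1) S = 0 := by
  rw [coeff_derivative] at h
  exact (mul_eq_zero.1 h).resolve_right (Nat.cast_add_one_ne_zero k)

lemma taylorOne_add (he : AnalyticAt ℝ e 0) (hg : AnalyticAt ℝ g 0) :
    taylorOne (e + g) = taylorOne e + taylorOne g := by
  suffices ∀ k, ∀ e g : ℝ → ℝ, AnalyticAt ℝ e 0 → AnalyticAt ℝ g 0 →
      coeff k (taylorOne (e + g) - (taylorOne e + taylorOne g)) = 0 by
    ext k
    have := this k e g he hg
    rwa [map_sub, sub_eq_zero] at this
  intro k
  induction k with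
  | zero => intro e g _ _; simp [constantCoeff_taylorOne]
  | succ k ih =>
    intro e g he hg
    apply coeff_eq_zero_of_derivative
    have h1 : deriv (e + g) =ᶠ[𝓝 0] deriv e + deriv g := by
      filter_upwards [he.eventually_analyticAt, hg.eventually_analyticAt] with p hp hp'
      exact deriv_add hp.differentiableAt hp'.differentiableAt
    rw [map_sub, map_add, ← taylorOne_deriv, ← taylorOne_deriv, ← taylorOne_deriv,
      taylorOne_congr h1]
    exact ih _ _ he.deriv hg.deriv

lemma taylorOne_mul (he : AnalyticAt ℝ e 0) (hg : AnalyticAt ℝ g 0) :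
    taylorOne (e * g) = taylorOne e * taylorOne g := by
  suffices ∀ k, ∀ e g : ℝ → ℝ, AnalyticAt ℝ e 0 → AnalyticAt ℝ g 0 →
      coeff k (taylorOne (e * g) - taylorOne e * taylorOne g) = 0 by
    ext k
    have := this k e g he hg
    rwa [map_sub, sub_eq_zero] at this
  intro k
  induction k with
  | zero => intro e g _ _; simp [constantCoeff_taylorOne]
  | succ k ih =>
    intro e g he hg
    apply coeff_eq_zero_of_derivative
    have h1 : deriv (e * g) =ᶠ[𝓝 0] deriv e * g + e * deriv g := by
      filter_upwards [he.eventually_analyticAt, hg.eventually_analyticAt] with p hp hp'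
      exact deriv_mul hp.differentiableAt hp'.differentiableAt
    have h2 : derivative ℂ (taylorOne (e * g) - taylorOne e * taylorOne g) =
        (taylorOne (deriv e * g) - taylorOne (deriv e) * taylorOne g) +
        (taylorOne (e * deriv g) - taylorOne e * taylorOne (deriv g)) := by
      rw [map_sub, ← taylorOne_deriv, taylorOne_congr h1,
        taylorOne_add (he.deriv.mul hg) (he.mul hg.deriv), taylorOne_deriv, taylorOne_deriv,
        Derivation.leibniz, smul_eq_mul, smul_eq_mul]
      ring
    rw [h2, map_add, ih _ _ he.deriv hg, ih _ _ he hg.deriv, add_zero]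

lemma eventuallyEq_zero_of_taylorOne (he : AnalyticAt ℝ e 0) (h : taylorOne e = 0) :
    ∀ᶠ y in 𝓝 0, e y = 0 := by
  have h1 := he.hasFPowerSeriesAt
  have h2 : (FormalMultilinearSeries.ofScalars ℝ
      (fun n => iteratedDeriv n e 0 / (n.factorial : ℝ))) = 0 := by
    have h3 : (fun n => iteratedDeriv n e 0 / (n.factorial : ℝ)) = 0 := by
      ext n
      have := congrArg (coeff n) h
      rw [coeff_taylorOne, map_zero, Complex.ofReal_eq_zero] at this
      rwa [iteratedDeriv_eq_iterate]
    rw [h3]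
    exact (FormalMultilinearSeries.ofScalars_series_eq_zero ℝ).2 rfl
  rw [h2] at h1
  exact h1.eventually_eq_zero

variable {σ : ℝ → ℝ}

lemma analyticAt_branch {f : ℝ × ℝ → ℝ} (hf : AnalyticAt ℝ f 0) (hσ : AnalyticAt ℝ σ 0)
    (h0 : σ 0 = 0) : AnalyticAt ℝ (fun y => f (y, σ y)) 0 :=
  AnalyticAt.comp (g := f) (f := fun y => (y, σ y)) (by rw [h0]; exact hf)
    (analyticAt_id.prod hσ)

lemma deriv_branch {f : ℝ × ℝ → ℝ} {y : ℝ} (hf : AnalyticAt ℝ f (y, σ y))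
    (hσ : AnalyticAt ℝ σ y) :
    deriv (fun y => f (y, σ y)) y = Dy f (y, σ y) + deriv σ y * Dx f (y, σ y) := by
  have h1 : HasDerivAt (fun y => (y, σ y)) (1, deriv σ y) y :=
    (hasDerivAt_id y).prodMk hσ.differentiableAt.hasDerivAt
  have h2 := hf.differentiableAt.hasFDerivAt.comp_hasDerivAt y h1
  rw [HasDerivAt.deriv (f := fun y => f (y, σ y)) h2,
    show ((1, deriv σ y) : ℝ × ℝ) = (1, 0) + deriv σ y • (0, 1) by simp, map_add, map_smul]
  rfl

/-- The Taylor series of a function along the branch `x = σ(y)`. -/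
lemma taylorOne_branch {f : ℝ × ℝ → ℝ} (hf : AnalyticAt ℝ f 0) (hσ : AnalyticAt ℝ σ 0)
    (h0 : σ 0 = 0) (hc : constantCoeff (taylorOne σ) = 0) :
    taylorOne (fun y => f (y, σ y)) = evalAt (taylorOne σ) hc (taylor f) := by
  -- All degrees up to `k` are carried along: the factor `deriv σ` in the chain rule mixes
  -- coefficients of lower degree.
  suffices ∀ k, ∀ j ≤ k, ∀ f : ℝ × ℝ → ℝ, AnalyticAt ℝ f 0 →
      coeff j (taylorOne (fun y => f (y, σ y)) - evalAt (taylorOne σ) hc (taylor f)) = 0 by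
    ext k
    have := this k k le_rfl f hf
    rwa [map_sub, sub_eq_zero] at this
  have hzero : ∀ f : ℝ × ℝ → ℝ,
      coeff 0 (taylorOne (fun y => f (y, σ y)) - evalAt (taylorOne σ) hc (taylor f)) = 0 := by
    intro f
    rw [map_sub, coeff_evalAt hc _ Nat.zero_lt_one, coeff_zero_eq_constantCoeff_apply,
      constantCoeff_taylorOne, Finset.sum_range_one, pow_zero, mul_one, ← cf_apply,
      taylor_zero_zero, h0]
    exact sub_self _
  intro k
  induction k with
  | zero => intro j hj f _; rw [Nat.le_zero.1 hj]; exact hzero f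
  | succ k ih =>
    rintro (_ | j) hj f hf
    · exact hzero f
    apply coeff_eq_zero_of_derivative
    have hfx := analyticAt_Dx hf
    have hfy := analyticAt_Dy hf
    have hcont : Tendsto (fun y => (y, σ y)) (𝓝 0) (𝓝 ((0 : ℝ), (0 : ℝ))) := by
      have := (analyticAt_id.prod hσ).continuousAt.tendsto
      simpa [h0] using this
    have h1 : deriv (fun y => f (y, σ y)) =ᶠ[𝓝 0]
        (fun y => Dy f (y, σ y)) + deriv σ * fun y => Dx f (y, σ y) := by
      filter_upwards [hcont.eventually hf.eventually_analyticAt, hσ.eventually_analyticAt]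
        with y hy hy'
      exact deriv_branch hy hy'
    have h2 : derivative ℂ
        (taylorOne (fun y => f (y, σ y)) - evalAt (taylorOne σ) hc (taylor f)) =
        (taylorOne (fun y => Dy f (y, σ y)) - evalAt (taylorOne σ) hc (taylor (Dy f))) +
        taylorOne (deriv σ) *
          (taylorOne (fun y => Dx f (y, σ y)) - evalAt (taylorOne σ) hc (taylor (Dx f))) := by
      have hbx := analyticAt_branch hfx hσ h0
      rw [map_sub, ← taylorOne_deriv, taylorOne_congr h1,
        taylorOne_add (analyticAt_branch hfy hσ h0) (hσ.deriv.mul hbx),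
        taylorOne_mul hσ.deriv hbx, derivative_evalAt, taylor_Dx hf, taylor_Dy, taylorOne_deriv]
      ring
    rw [h2, map_add, ih j (by omega) _ hfy, zero_add, coeff_mul]
    refine Finset.sum_eq_zero fun p hp => ?_
    have := Finset.HasAntidiagonal.mem_antidiagonal.1 hp
    rw [ih p.2 (by omega) _ hfx, mul_zero]

end OneVariable

end HessianPlane

namespace HessianPlane

/-! ### Division of analytic functions by the equation of a curve. -/

section Division

/-- The contraction `(y, x) ↦ (y, τ x)`. -/
noncomputable def shrink (τ : ℝ) : ℝ × ℝ →L[ℝ] ℝ × ℝ :=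
  (ContinuousLinearMap.fst ℝ ℝ ℝ).prod (τ • ContinuousLinearMap.snd ℝ ℝ ℝ)

lemma shrink_apply (τ : ℝ) (q : ℝ × ℝ) : shrink τ q = (q.1, τ * q.2) := rfl

lemma continuous_shrink : Continuous shrink := by
  have h : shrink = fun τ : ℝ => (ContinuousLinearMap.inl ℝ ℝ ℝ).comp (.fst ℝ ℝ ℝ) +
      τ • (ContinuousLinearMap.inr ℝ ℝ ℝ).comp (.snd ℝ ℝ ℝ) := by
    ext τ <;> simp [shrink]
  rw [h]
  fun_prop

lemma norm_shrink_apply_le {τ : ℝ} (hτ : τ ∈ Icc (0 : ℝ) 1) (q : ℝ × ℝ) :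
    ‖shrink τ q‖ ≤ ‖q‖ := by
  rw [shrink_apply, Prod.norm_def, Prod.norm_def]
  refine max_le_max le_rfl ?_
  simp only [norm_mul, Real.norm_eq_abs, abs_of_nonneg hτ.1]
  exact mul_le_of_le_one_left (abs_nonneg _) hτ.2

lemma norm_shrink_le {τ : ℝ} (hτ : τ ∈ Icc (0 : ℝ) 1) : ‖shrink τ‖ ≤ 1 :=
  ContinuousLinearMap.opNorm_le_bound _ zero_le_one fun q => by
    rw [one_mul]; exact norm_shrink_apply_le hτ q

/-- Averages of an analytic function along the segments from `(y, 0)` to `(y, x)` are analytic. -/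
lemma analyticAt_average {g : ℝ × ℝ → ℝ} (hg : AnalyticAt ℝ g 0) :
    AnalyticAt ℝ (fun q => ∫ τ in (0 : ℝ)..1, g (shrink τ q)) 0 := by
  obtain ⟨p, r, hp⟩ := hg
  -- The power series is integrated term by term; `shrink τ` has norm at most one, so the bounds of
  -- `p` and its ball of convergence persist.
  let P : ∀ n, ℝ → ContinuousMultilinearMap ℝ (fun _ : Fin n => ℝ × ℝ) ℝ :=
    fun n τ => (p n).compContinuousLinearMap fun _ => shrink τ
  have hPc : ∀ n, Continuous (P n) := fun n => by
    have h1 : Continuous fun τ : ℝ => (fun _ : Fin n => shrink τ) :=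
      continuous_pi fun _ => continuous_shrink
    exact ((ContinuousMultilinearMap.compContinuousLinearMapContinuousMultilinear ℝ
      (fun _ : Fin n => ℝ × ℝ) (fun _ => ℝ × ℝ) ℝ).cont.comp h1).clm_apply continuous_const
  have hPn : ∀ n, ∀ τ ∈ Icc (0 : ℝ) 1, ‖P n τ‖ ≤ ‖p n‖ := fun n τ hτ => by
    refine ((p n).norm_compContinuousLinearMap_le _).trans ?_
    refine mul_le_of_le_one_right (norm_nonneg _) ?_
    exact Finset.prod_le_one (fun _ _ => norm_nonneg _) fun _ _ => norm_shrink_le hτ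
  have hsub : uIoc (0 : ℝ) 1 ⊆ Icc 0 1 := by
    rw [uIoc_of_le zero_le_one]; exact Ioc_subset_Icc_self
  refine ⟨fun n => ∫ τ in (0 : ℝ)..1, P n τ, r, ?_, hp.r_pos, ?_⟩
  · refine hp.r_le.trans (FormalMultilinearSeries.radius_le_of_le fun n => ?_)
    have := intervalIntegral.norm_integral_le_of_norm_le_const (f := P n) (C := ‖p n‖)
      (a := 0) (b := 1) fun τ hτ => hPn n τ (hsub hτ)
    simpa using this
  · intro q hq
    rw [zero_add]
    have happ : ∀ n, (∫ τ in (0 : ℝ)..1, P n τ) (fun _ => q) =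
        ∫ τ in (0 : ℝ)..1, p n (fun _ => shrink τ q) := fun n =>
      ((ContinuousMultilinearMap.apply ℝ (fun _ : Fin n => ℝ × ℝ) ℝ
        (fun _ => q)).intervalIntegral_comp_comm
        ((hPc n).intervalIntegrable 0 1)).symm
    simp only [happ]
    have hmem : ∀ τ ∈ Icc (0 : ℝ) 1, shrink τ q ∈ Metric.eball (0 : ℝ × ℝ) r := fun τ hτ => by
      rw [mem_eball_zero_iff] at hq ⊢
      refine lt_of_le_of_lt ?_ hq
      exact enorm_le_iff_norm_le.2 (norm_shrink_apply_le hτ q)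
    refine intervalIntegral.hasSum_integral_of_dominated_convergence
      (fun n _ => ‖p n‖ * ‖q‖ ^ n) (fun n => ?_) (fun n => ?_) ?_ ?_ ?_
    · refine Continuous.aestronglyMeasurable ?_
      exact (p n).cont.comp (continuous_pi fun _ => continuous_shrink.clm_apply continuous_const)
    · refine Eventually.of_forall fun τ hτ => ?_
      refine ((p n).le_opNorm _).trans (mul_le_mul_of_nonneg_left ?_ (norm_nonneg _))
      rw [Finset.prod_const, Finset.card_fin]
      exact pow_le_pow_left₀ (norm_nonneg _) (norm_shrink_apply_le (hsub hτ) q) n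
    · refine Eventually.of_forall fun τ _ => ?_
      have := p.summable_norm_mul_pow (r := ‖q‖₊) (lt_of_lt_of_le (by
        rw [mem_eball_zero_iff] at hq; exact hq) hp.r_le)
      simpa using this
    · exact intervalIntegrable_const
    · refine Eventually.of_forall fun τ hτ => ?_
      have := hp.hasSum (hmem τ (hsub hτ))
      rwa [zero_add] at this

/-- An analytic function vanishing on the axis `x = 0` is divisible by `x`. -/
lemma exists_eq_snd_mul {f : ℝ × ℝ → ℝ} (hf : AnalyticAt ℝ f 0)
    (h0 : ∀ᶠ y in 𝓝 (0 : ℝ), f (y, 0) = 0) :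
    ∃ K : ℝ × ℝ → ℝ, AnalyticAt ℝ K 0 ∧ f =ᶠ[𝓝 0] (fun q => q.2) * K := by
  -- Hadamard's formula: the quotient is the integral of `Dx f (y, τ x)` over `τ` in `[0, 1]`.
  refine ⟨_, analyticAt_average (analyticAt_Dx hf), ?_⟩
  obtain ⟨ε, hε, hball⟩ := Metric.eventually_nhds_iff_ball.1 hf.eventually_analyticAt
  have h1 : ∀ᶠ q : ℝ × ℝ in 𝓝 0, f (q.1, 0) = 0 :=
    (continuous_fst.tendsto (0 : ℝ × ℝ)).eventually h0
  filter_upwards [h1, Metric.ball_mem_nhds (0 : ℝ × ℝ) hε] with q hq hqε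
  have hmem : ∀ τ ∈ Icc (0 : ℝ) 1, AnalyticAt ℝ f (shrink τ q) := fun τ hτ => hball _ (by
    rw [mem_ball_zero_iff] at hqε ⊢
    exact (norm_shrink_apply_le hτ q).trans_lt hqε)
  have hd : ∀ τ ∈ uIcc (0 : ℝ) 1, HasDerivAt (fun τ => f (shrink τ q))
      (q.2 * Dx f (shrink τ q)) τ := fun τ hτ => by
    rw [uIcc_of_le zero_le_one] at hτ
    have h2 : HasDerivAt (fun τ => shrink τ q) (q.2 • ((0, 1) : ℝ × ℝ)) τ := by
      simp only [shrink_apply]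
      have := (hasDerivAt_const τ q.1).prodMk ((hasDerivAt_id τ).mul_const q.2)
      simpa using this
    have h3 := (hmem τ hτ).differentiableAt.hasFDerivAt.comp_hasDerivAt τ h2
    rw [map_smul] at h3
    exact h3
  have hc : ContinuousOn (fun τ => q.2 * Dx f (shrink τ q)) (uIcc (0 : ℝ) 1) := fun τ hτ => by
    rw [uIcc_of_le zero_le_one] at hτ
    refine ContinuousAt.continuousWithinAt ?_
    refine continuousAt_const.mul ?_
    exact ContinuousAt.comp (g := Dx f) (f := fun τ => shrink τ q)
      (analyticAt_Dx (hmem τ hτ)).continuousAt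
      (continuous_shrink.clm_apply continuous_const).continuousAt
  have := intervalIntegral.integral_eq_sub_of_hasDerivAt hd hc.intervalIntegrable
  rw [intervalIntegral.integral_const_mul] at this
  simp only [Pi.mul_apply]
  rw [this, shrink_apply, shrink_apply, one_mul, zero_mul, hq, sub_zero]

lemma Dx_snd_mul {K : ℝ × ℝ → ℝ} (hK : AnalyticAt ℝ K 0) :
    Dx ((fun q => q.2) * K) =ᶠ[𝓝 0] K + (fun q => q.2) * Dx K := by
  have h2 : ∀ p : ℝ × ℝ, Dx (fun q => q.2) p = 1 := fun p => by
    rw [Dx, fderiv_snd]; rfl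
  filter_upwards [Dx_mul (f := fun q : ℝ × ℝ => q.2) analyticAt_snd hK] with p hp
  rw [hp, Pi.add_apply, Pi.add_apply, Pi.mul_apply, h2, one_mul]

lemma Dx_iterate_snd_mul {K : ℝ × ℝ → ℝ} (hK : AnalyticAt ℝ K 0) (j : ℕ) :
    Dx^[j + 1] ((fun q => q.2) * K) =ᶠ[𝓝 0]
      fun q => (j + 1) * Dx^[j] K q + q.2 * Dx^[j + 1] K q := by
  induction j with
  | zero => filter_upwards [Dx_snd_mul hK] with p hp; simp [hp]
  | succ j ih =>
    have hKj := analyticAt_Dx_iterate hK j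
    have hKj1 := analyticAt_Dx_iterate hK (j + 1)
    rw [Function.iterate_succ_apply']
    refine (Dx_congr ih).trans ?_
    have hc : AnalyticAt ℝ (fun _ : ℝ × ℝ => (j + 1 : ℝ)) 0 := analyticAt_const
    have h1 := Dx_add (hc.mul hKj) ((analyticAt_snd (𝕜 := ℝ) (p := (0 : ℝ × ℝ))).mul hKj1)
    have h2 := Dx_mul hc hKj
    have h3 := Dx_snd_mul hKj1
    refine (h1.trans (h2.add h3)).trans (Eventually.of_forall fun p => ?_)
    have h4 : Dx (fun _ : ℝ × ℝ => (j + 1 : ℝ)) p = 0 := by simp [Dx]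
    simp only [Pi.add_apply, Pi.mul_apply, h4, Function.iterate_succ_apply']
    push_cast
    ring

/-- If `f = x * K`, then on the axis `Dx^[j + 1] f = (j + 1) * Dx^[j] K`, so one order of vanishing
is used up at each division. The last clause keeps track of the cofactor at the origin. -/
lemma exists_eq_snd_pow_mul {n : ℕ} {f : ℝ × ℝ → ℝ} (hf : AnalyticAt ℝ f 0)
    (h0 : ∀ j < n, ∀ᶠ y in 𝓝 (0 : ℝ), Dx^[j] f (y, 0) = 0) :
    ∃ K : ℝ × ℝ → ℝ, AnalyticAt ℝ K 0 ∧ f =ᶠ[𝓝 0] (fun q => q.2 ^ n * K q) ∧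
      Dx^[n] f 0 = n.factorial * K 0 := by
  induction n generalizing f with
  | zero => exact ⟨f, hf, by simp, by simp⟩
  | succ n ih =>
    obtain ⟨K, hK, hfK⟩ := exists_eq_snd_mul hf (h0 0 (by omega))
    have hder : ∀ j, Dx^[j + 1] f =ᶠ[𝓝 0]
        fun q => (j + 1) * Dx^[j] K q + q.2 * Dx^[j + 1] K q := fun j =>
      (Dx_iterate_congr hfK (j + 1)).trans (Dx_iterate_snd_mul hK j)
    have hline : Tendsto (fun y : ℝ => (y, (0 : ℝ))) (𝓝 0) (𝓝 0) :=
      (Continuous.prodMk_left (0 : ℝ)).tendsto 0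
    obtain ⟨K', hK', hKK', hn⟩ := ih hK fun j hj => by
      filter_upwards [h0 (j + 1) (by omega), hline.eventually (hder j)] with y hy hy'
      rw [hy'] at hy
      simp only [zero_mul, add_zero] at hy
      exact (mul_eq_zero.1 hy).resolve_left (Nat.cast_add_one_ne_zero j)
    refine ⟨K', hK', ?_, ?_⟩
    · filter_upwards [hfK, hKK'] with q hq hq'
      rw [hq, Pi.mul_apply, hq', pow_succ]
      ring
    · rw [(hder n).eq_of_nhds, hn, Nat.factorial_succ]
      push_cast
      simp only [Prod.snd_zero]
      ring

/-- An analytic function vanishing to order `n` along the graph `x = σ(y)` is divisible by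
`(x - σ(y)) ^ n`. -/
lemma exists_eq_sub_pow_mul {n : ℕ} {f : ℝ × ℝ → ℝ} (hf : AnalyticAt ℝ f 0) {σ : ℝ → ℝ}
    (hσ : AnalyticAt ℝ σ 0) (hσ0 : σ 0 = 0)
    (h0 : ∀ j < n, ∀ᶠ y in 𝓝 (0 : ℝ), Dx^[j] f (y, σ y) = 0) :
    ∃ K : ℝ × ℝ → ℝ, AnalyticAt ℝ K 0 ∧ f =ᶠ[𝓝 0] (fun q => (q.2 - σ q.1) ^ n * K q) ∧
      Dx^[n] f 0 = n.factorial * K 0 := by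
  -- `Φ` carries the axis to the graph. It shifts `x` by an amount depending on `y` only, so it
  -- commutes with `Dx`.
  let Φ : ℝ × ℝ → ℝ × ℝ := fun q => (q.1, q.2 + σ q.1)
  let Ψ : ℝ × ℝ → ℝ × ℝ := fun q => (q.1, q.2 - σ q.1)
  have hσ1 : AnalyticAt ℝ (fun q : ℝ × ℝ => σ q.1) 0 :=
    AnalyticAt.comp (g := σ) (f := Prod.fst) hσ analyticAt_fst
  have hΦ : AnalyticAt ℝ Φ 0 := analyticAt_fst.prod (analyticAt_snd.add hσ1)
  have hΨ : AnalyticAt ℝ Ψ 0 := analyticAt_fst.prod (analyticAt_snd.sub hσ1)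
  have hΦ0 : Φ 0 = 0 := by simp [Φ, hσ0]
  have hΨ0 : Ψ 0 = 0 := by simp [Ψ, hσ0]
  have hΦt : Tendsto Φ (𝓝 0) (𝓝 0) := by
    have := hΦ.continuousAt.tendsto; rwa [hΦ0] at this
  have hΨt : Tendsto Ψ (𝓝 0) (𝓝 0) := by
    have := hΨ.continuousAt.tendsto; rwa [hΨ0] at this
  have hder : ∀ j (f : ℝ × ℝ → ℝ), AnalyticAt ℝ f 0 →
      Dx^[j] (f ∘ Φ) =ᶠ[𝓝 0] Dx^[j] f ∘ Φ := by
    intro j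
    induction j with
    | zero => exact fun _ _ => EventuallyEq.rfl
    | succ j ih =>
      intro f hf
      rw [Function.iterate_succ_apply, Function.iterate_succ_apply]
      refine (Dx_iterate_congr ?_ j).trans (ih _ (analyticAt_Dx hf))
      filter_upwards [hΦt.eventually hf.eventually_analyticAt, hσ1.eventually_analyticAt]
        with q hq hq'
      have h1 : HasDerivAt (fun s : ℝ => Φ (q + s • ((0, 1) : ℝ × ℝ))) (0, 1) 0 := by
        have : (fun s : ℝ => Φ (q + s • ((0, 1) : ℝ × ℝ))) =
            fun s => Φ q + s • ((0, 1) : ℝ × ℝ) := by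
          ext s <;> simp [Φ]; ring
        rw [this]
        simpa using ((hasDerivAt_id (0 : ℝ)).smul_const ((0, 1) : ℝ × ℝ)).const_add (Φ q)
      have hΦq : AnalyticAt ℝ Φ q := analyticAt_fst.prod (analyticAt_snd.add hq')
      have h2 : HasDerivAt (fun s : ℝ => q + s • ((0, 1) : ℝ × ℝ)) (0, 1) 0 := by
        simpa using ((hasDerivAt_id (0 : ℝ)).smul_const ((0, 1) : ℝ × ℝ)).const_add q
      have h3 : HasFDerivAt Φ (fderiv ℝ Φ q) (q + (0 : ℝ) • ((0, 1) : ℝ × ℝ)) := by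
        simpa using hΦq.differentiableAt.hasFDerivAt
      have h4 := (h3.comp_hasDerivAt 0 h2).unique h1
      rw [Dx, fderiv_comp q hq.differentiableAt hΦq.differentiableAt,
        ContinuousLinearMap.comp_apply, h4]
      rfl
  have hline : Tendsto (fun y : ℝ => (y, (0 : ℝ))) (𝓝 0) (𝓝 0) :=
    (Continuous.prodMk_left (0 : ℝ)).tendsto 0
  obtain ⟨K, hK, hfK, hn⟩ := exists_eq_snd_pow_mul (n := n) (f := f ∘ Φ)
    (AnalyticAt.comp (by rwa [hΦ0]) hΦ) fun j hj => by
      filter_upwards [h0 j hj, hline.eventually (hder j f hf)] with y hy hy'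
      rw [hy', Function.comp_apply]
      simpa [Φ] using hy
  refine ⟨K ∘ Ψ, AnalyticAt.comp (by rwa [hΨ0]) hΨ, ?_, ?_⟩
  · filter_upwards [hΨt.eventually hfK] with q hq
    have : Φ (Ψ q) = q := by ext <;> simp [Φ, Ψ]
    rw [Function.comp_apply, this] at hq
    rw [hq]
    rfl
  · rw [(hder n f hf).eq_of_nhds, Function.comp_apply, hΦ0] at hn
    rw [hn, Function.comp_apply, hΨ0]

end Division

end HessianPlane

namespace HessianPlane

/-! ### The common factor of `A` and `B`. -/

section Branch

open PowerSeries

lemma IsXLeading.add_const_mul {m : ℕ} {c d : ℂ} {F G : Formal} (hF : IsXLeading m c F)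
    (hG : IsXLeading m d G) (s : ℂ) : IsXLeading m (c + s * d) (F + C (C s) * G) := by
  refine ⟨fun i j hij => ?_, ?_, fun i j hij hj => ?_⟩
  · rw [map_add, cf_C_C_mul, hF.1 i j hij, hG.1 i j hij, mul_zero, add_zero]
  · rw [map_add, cf_C_C_mul, hF.2.1, hG.2.1]
  · rw [map_add, cf_C_C_mul, hF.2.2 i j hij hj, hG.2.2 i j hij hj, mul_zero, add_zero]

lemma Dx_iterate_zero_of_taylor {f : ℝ × ℝ → ℝ} {i : ℕ} {c : ℝ} (h : cf i 0 (taylor f) = c) :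
    Dx^[i] f 0 = i.factorial * c := by
  rw [cf_taylor, Complex.ofReal_inj, Function.iterate_zero_apply, Nat.factorial_zero, Nat.cast_one,
    mul_one, div_eq_iff (Nat.cast_ne_zero.2 i.factorial_ne_zero)] at h
  rw [h, mul_comm]

/-- The critical curve of a function with leading term `c * x ^ (n + 1)`. -/
lemma exists_critical_branch {n : ℕ} {c : ℝ} (hc : c ≠ 0) {H : ℝ × ℝ → ℝ} (hH : AnalyticAt ℝ H 0)
    (hlead : IsXLeading (n + 1) c (taylor H)) :
    ∃ σ : ℝ → ℝ, AnalyticAt ℝ σ 0 ∧ σ 0 = 0 ∧ deriv σ 0 = 0 ∧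
      ∀ᶠ y in 𝓝 (0 : ℝ), Dx^[n] H (y, σ y) = 0 := by
  have hG := analyticAt_Dx_iterate hH n
  have hG0 : Dx^[n] H 0 = 0 := by
    have := Dx_iterate_zero_of_taylor (c := 0) (hlead.1 n 0 (by omega))
    rwa [mul_zero] at this
  have hGx : Dx (Dx^[n] H) 0 = (n + 1).factorial * c := by
    rw [← Function.iterate_succ_apply' Dx]
    exact Dx_iterate_zero_of_taylor hlead.2.1
  have hGx0 : Dx (Dx^[n] H) 0 ≠ 0 := by
    rw [hGx]; exact mul_ne_zero (Nat.cast_ne_zero.2 (Nat.factorial_ne_zero _)) hc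
  -- `x ^ n * y` has coefficient zero in the leading form; this makes the branch tangent to the
  -- `y`-axis.
  have hGy : Dy (Dx^[n] H) 0 = 0 := by
    rw [← Complex.ofReal_eq_zero, ← taylor_zero_zero, taylor_Dy, taylor_Dx_iterate hH, cf_dy,
      cf_iterate_dx, hlead.2.2 _ _ (by omega) (by omega)]
    ring
  have hinv : (fderiv ℝ (Dx^[n] H) 0 ∘L .inr ℝ ℝ ℝ).IsInvertible := by
    refine ⟨ContinuousLinearEquiv.unitsEquivAut ℝ (Units.mk0 _ hGx0), ?_⟩
    ext
    simp [Dx]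
  have hcd : ContDiffAt ℝ ⊤ (Dx^[n] H) 0 := hG.contDiffAt
  have hσ : AnalyticAt ℝ (hcd.implicitFunction (by simp) hinv) 0 :=
    (hcd.contDiffAt_implicitFunction (by simp) hinv).analyticAt
  have hσ0 : hcd.implicitFunction (by simp) hinv 0 = 0 :=
    hcd.implicitFunction_apply_self (by simp) hinv
  have hev := hcd.eventually_apply_implicitFunction (by simp) hinv
  rw [hG0] at hev
  generalize hcd.implicitFunction (by simp) hinv = σ at *
  refine ⟨σ, hσ, hσ0, ?_, hev⟩
  have h1 : deriv (fun y => Dx^[n] H (y, σ y)) 0 = 0 := by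
    have : (fun y => Dx^[n] H (y, σ y)) =ᶠ[𝓝 0] fun _ => 0 := hev
    rw [this.deriv_eq, deriv_const]
  rw [deriv_branch (by rw [hσ0]; exact hG) hσ, hσ0] at h1
  change Dy (Dx^[n] H) 0 + _ * Dx (Dx^[n] H) 0 = 0 at h1
  rw [hGy, zero_add] at h1
  exact (mul_eq_zero.1 h1).resolve_right hGx0

lemma eventually_branch_eq_zero {f : ℝ × ℝ → ℝ} (hf : AnalyticAt ℝ f 0) {σ : ℝ → ℝ}
    (hσ : AnalyticAt ℝ σ 0) (h0 : σ 0 = 0) (hc : constantCoeff (taylorOne σ) = 0)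
    (h : evalAt (taylorOne σ) hc (taylor f) = 0) : ∀ᶠ y in 𝓝 (0 : ℝ), f (y, σ y) = 0 :=
  eventuallyEq_zero_of_taylorOne (analyticAt_branch hf hσ h0)
    (by rw [taylorOne_branch hf hσ h0 hc, h])

/-- Two functions `A`, `B` satisfying Codazzi type equations together with a function `H` which
is functionally dependent of `A ^ 2 + B ^ 2`, and with a suitable leading term, have a common factor
`(x - σ(y)) ^ (n + 1)`. -/
theorem exists_common_factor {n : ℕ} {c : ℝ} (hc : c ≠ 0) {H A B : ℝ × ℝ → ℝ}
    (hH : AnalyticAt ℝ H 0) (hA : AnalyticAt ℝ A 0) (hB : AnalyticAt ℝ B 0)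
    (h₁ : Dx A + Dy B =ᶠ[𝓝 0] Dx H) (h₂ : Dx B =ᶠ[𝓝 0] Dy A + Dy H)
    (hbr : Dx H * Dy (A * A + B * B) =ᶠ[𝓝 0] Dy H * Dx (A * A + B * B))
    (hlH : IsXLeading (n + 1) c (taylor H)) (hlA : IsXLeading (n + 1) c (taylor A))
    (hlB : IsXLeading (n + 1) 0 (taylor B)) :
    ∃ σ : ℝ → ℝ, AnalyticAt ℝ σ 0 ∧ σ 0 = 0 ∧ deriv σ 0 = 0 ∧ ∃ a b : ℝ × ℝ → ℝ,
      AnalyticAt ℝ a 0 ∧ AnalyticAt ℝ b 0 ∧ a 0 ≠ 0 ∧ b 0 = 0 ∧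
      A =ᶠ[𝓝 0] (fun q => (q.2 - σ q.1) ^ (n + 1) * a q) ∧
      B =ᶠ[𝓝 0] (fun q => (q.2 - σ q.1) ^ (n + 1) * b q) := by
  obtain ⟨σ, hσ, hσ0, hσ', hcrit⟩ := exists_critical_branch hc hH hlH
  have hI : (C (C Complex.I) : Formal) * C (C Complex.I) = -1 := by
    rw [← map_mul, ← map_mul, Complex.I_mul_I]; simp
  have hconst : constantCoeff (taylorOne σ) = 0 := by
    rw [constantCoeff_taylorOne, hσ0, Complex.ofReal_zero]
  have hev : evalAt (taylorOne σ) hconst (dx^[n] (taylor H)) = 0 := by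
    rw [← taylor_Dx_iterate hH, ← taylorOne_branch (analyticAt_Dx_iterate hH n) hσ hσ0]
    rw [taylorOne_congr (g := fun _ => 0) hcrit]
    ext j
    have : deriv^[j] (fun _ : ℝ => (0 : ℝ)) = fun _ => 0 := by
      induction j with
      | zero => rfl
      | succ j ih => rw [Function.iterate_succ_apply, deriv_const', ih]
    simp [coeff_taylorOne, this]
  have e₁ : dx (taylor A) + dy (taylor B) = dx (taylor H) := by
    rw [← taylor_Dx hA, ← taylor_Dy, ← taylor_Dx hH, ← taylor_congr h₁,
      taylor_add (analyticAt_Dx hA) (analyticAt_Dy hB)]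
  have e₂ : dx (taylor B) = dy (taylor A) + dy (taylor H) := by
    rw [← taylor_Dx hB, ← taylor_Dy, ← taylor_Dy, taylor_congr h₂,
      taylor_add (analyticAt_Dy hA) (analyticAt_Dy hH)]
  have hD := (hA.mul hA).add (hB.mul hB)
  have e₃ : ham (taylor H) (taylor A * taylor A + taylor B * taylor B) = 0 := by
    rw [← taylor_mul hA hA, ← taylor_mul hB hB, ← taylor_add (hA.mul hA) (hB.mul hB), ham_apply,
      ← taylor_Dx hH, ← taylor_Dy, ← taylor_Dx hD, ← taylor_Dy,
      ← taylor_mul (analyticAt_Dx hH) (analyticAt_Dy hD),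
      ← taylor_mul (analyticAt_Dy hH) (analyticAt_Dx hD), taylor_congr hbr, sub_self]
  have hconj : ∀ s : ℂ, IsXLeading (n + 1) c (taylor A + C (C s) * taylor B) := fun s => by
    have := hlA.add_const_mul hlB s
    rwa [mul_zero, add_zero] at this
  have hC : ∀ (s : ℂ) (D : Derivation ℂ Formal Formal) (F : Formal),
      D (C (C s) * F) = C (C s) * D F := fun s D F => by
    have h (F : Formal) : C (C s) * F = s • F := by
      ext i j; simp
    rw [h, h, D.map_smul]
  have hdel : ∀ s t : ℂ, del s (taylor A + C (C t) * taylor B) =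
      dx (taylor A) + C (C t) * dx (taylor B) + C (C s) * dy (taylor A) +
        C (C s) * C (C t) * dy (taylor B) := fun s t => by
    rw [map_add, hC, del_apply, del_apply]; ring
  have key : ∀ j < n + 1,
      evalAt (taylorOne σ) hconst (dx^[j] (taylor A)) = 0 ∧
      evalAt (taylorOne σ) hconst (dx^[j] (taylor B)) = 0 := by
    intro j hj
    -- Applied to `Q = A - iB` and `R = A + iB`, for which `Q * R = A ^ 2 + B ^ 2`.
    obtain ⟨hq, hr⟩ := vanishes_of_codazzi (ha := hconst) (Complex.ofReal_ne_zero.2 hc) hlH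
      (hconj (-Complex.I)) (hconj Complex.I)
      (by
        rw [hdel, del_apply]
        simp only [map_neg]
        linear_combination e₁ - C (C Complex.I) * e₂ - dy (taylor B) * hI)
      (by
        rw [hdel, del_apply]
        simp only [map_neg]
        linear_combination e₁ + C (C Complex.I) * e₂ - dy (taylor B) * hI)
      (by
        rw [← e₃]
        congr 1
        simp only [map_neg]
        linear_combination - taylor B * taylor B * hI)
      hev hj
    have hit : ∀ s : ℂ, dx^[j] (taylor A + C (C s) * taylor B) =
        dx^[j] (taylor A) + C (C s) * dx^[j] (taylor B) := fun s => by
      rw [iterate_map_add]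
      congr 1
      exact (Function.Commute.iterate_left (f := dx) (g := fun F => C (C s) * F)
        (fun F => hC s dx F) j) _
    rw [hit, map_add, map_mul, evalAt_C] at hq hr
    have hI0 : (C Complex.I : ℂ⟦X⟧) ≠ 0 := by
      rw [Ne, map_eq_zero_iff _ C_injective]; exact Complex.I_ne_zero
    have h2 : (2 : ℂ⟦X⟧) ≠ 0 := by
      rw [← map_ofNat (C (R := ℂ)) 2, Ne, map_eq_zero_iff _ C_injective]; exact two_ne_zero
    constructor
    · refine (mul_eq_zero.1 (?_ : (2 : ℂ⟦X⟧) * _ = 0)).resolve_left h2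
      rw [map_neg] at hq
      linear_combination hq + hr
    · refine (mul_eq_zero.1 (?_ : (2 * C Complex.I : ℂ⟦X⟧) * _ = 0)).resolve_left
        (mul_ne_zero h2 hI0)
      rw [map_neg] at hq
      linear_combination hr - hq
  obtain ⟨a, ha, hAa, ha0⟩ := exists_eq_sub_pow_mul (n := n + 1) hA hσ hσ0 fun j hj =>
    eventually_branch_eq_zero (analyticAt_Dx_iterate hA j) hσ hσ0 hconst
      (by rw [taylor_Dx_iterate hA]; exact (key j hj).1)
  obtain ⟨b, hb, hBb, hb0⟩ := exists_eq_sub_pow_mul (n := n + 1) hB hσ hσ0 fun j hj =>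
    eventually_branch_eq_zero (analyticAt_Dx_iterate hB j) hσ hσ0 hconst
      (by rw [taylor_Dx_iterate hB]; exact (key j hj).2)
  have hfac : ((n + 1).factorial : ℝ) ≠ 0 := Nat.cast_ne_zero.2 (Nat.factorial_ne_zero _)
  rw [Dx_iterate_zero_of_taylor hlA.2.1] at ha0
  rw [Dx_iterate_zero_of_taylor (c := 0) (by rw [hlB.2.1, Complex.ofReal_zero])] at hb0
  refine ⟨σ, hσ, hσ0, hσ', a, b, ha, hb, ?_, ?_, hAa, hBb⟩
  · rw [← mul_left_cancel₀ hfac ha0]; exact hc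
  · exact (mul_left_cancel₀ hfac hb0).symm

end Branch

end HessianPlane

namespace HessianPlane

/-! ### Functional dependence of trace and discriminant. -/

section Jacobian

/-- The quantity whose square root is half the difference of the eigenvalues, up to scaling. -/
def disc (M : Matrix (Fin 2) (Fin 2) ℝ) : ℝ := (M 0 0 - M 1 1) ^ 2 + (2 * M 0 1) ^ 2

lemma exists_cos_sin_eq {C S : ℝ} (h : C ^ 2 + S ^ 2 = 1) :
    ∃ c s : ℝ, c ^ 2 + s ^ 2 = 1 ∧ c ^ 2 - s ^ 2 = C ∧ 2 * c * s = S := by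
  have hn : ‖(⟨C, S⟩ : ℂ)‖ = 1 := by
    rw [Complex.norm_def, Complex.normSq_mk, ← sq, ← sq, h, Real.sqrt_one]
  have hz : (⟨C, S⟩ : ℂ) ≠ 0 := by rw [← norm_pos_iff, hn]; exact one_pos
  have hcos := Complex.cos_arg hz
  have hsin := Complex.sin_arg (⟨C, S⟩ : ℂ)
  rw [hn, div_one] at hcos hsin
  set t := Complex.arg ⟨C, S⟩
  have ht : t = 2 * (t / 2) := by ring
  rw [ht, Real.cos_two_mul] at hcos
  rw [ht, Real.sin_two_mul] at hsin
  have h1 := Real.cos_sq_add_sin_sq (t / 2)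
  exact ⟨Real.cos (t / 2), Real.sin (t / 2), h1, by
    simp only at hcos; linarith, by simp only at hsin; linarith⟩

lemma rotation_mem_orthogonalGroup {c s : ℝ} (h : c ^ 2 + s ^ 2 = 1) :
    !![c, -s; s, c] ∈ Matrix.orthogonalGroup (Fin 2) ℝ := by
  rw [Matrix.mem_orthogonalGroup_iff']
  ext i j
  fin_cases i <;> fin_cases j <;>
    simp [Matrix.mul_apply, Fin.sum_univ_two] <;> linarith

/-- Symmetric matrices with the same eigenvalues are orthogonally conjugate. -/
lemma exists_orthogonal_conj {M N : Matrix (Fin 2) (Fin 2) ℝ} (hM : M.IsSymm) (hN : N.IsSymm)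
    (ht : M 0 0 + M 1 1 = N 0 0 + N 1 1) (hd : disc M = disc N) :
    ∃ Q ∈ Matrix.orthogonalGroup (Fin 2) ℝ, Qᵀ * N * Q = M := by
  have hM' : M 1 0 = M 0 1 := hM.apply 0 1
  have hN' : N 1 0 = N 0 1 := hN.apply 0 1
  unfold disc at hd
  -- Conjugation by a rotation turns the vector `(N 0 0 - N 1 1, 2 * N 0 1)` by twice the angle. The
  -- vectors of `M` and `N` have equal length, so half the angle between them works; if they vanish,
  -- any rotation does.
  obtain ⟨c, s, h1, hA, hB⟩ : ∃ c s : ℝ, c ^ 2 + s ^ 2 = 1 ∧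
      M 0 0 - M 1 1 = (N 0 0 - N 1 1) * (c ^ 2 - s ^ 2) + 2 * N 0 1 * (2 * c * s) ∧
      2 * M 0 1 = -(N 0 0 - N 1 1) * (2 * c * s) + 2 * N 0 1 * (c ^ 2 - s ^ 2) := by
    generalize M 0 0 - M 1 1 = A' at *
    generalize 2 * M 0 1 = B' at *
    generalize N 0 0 - N 1 1 = A at *
    generalize 2 * N 0 1 = B at *
    by_cases h0 : A ^ 2 + B ^ 2 = 0
    · have hA : A = 0 := by nlinarith
      have hB : B = 0 := by nlinarith
      have hA' : A' = 0 := by nlinarith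
      have hB' : B' = 0 := by nlinarith
      exact ⟨1, 0, by norm_num, by rw [hA, hB, hA']; ring, by rw [hA, hB, hB']; ring⟩
    · obtain ⟨c, s, h1, h2, h3⟩ := exists_cos_sin_eq
        (C := (A * A' + B * B') / (A ^ 2 + B ^ 2)) (S := (B * A' - A * B') / (A ^ 2 + B ^ 2)) (by
          rw [div_pow, div_pow, ← add_div, div_eq_one_iff_eq (pow_ne_zero 2 h0)]
          linear_combination (A ^ 2 + B ^ 2) * hd)
      refine ⟨c, s, h1, ?_, ?_⟩
      · rw [h2, h3]; field_simp; ring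
      · rw [h2, h3]; field_simp; ring
  refine ⟨_, rotation_mem_orthogonalGroup h1, ?_⟩
  ext i j
  fin_cases i <;> fin_cases j <;>
    simp [Matrix.mul_apply, Fin.sum_univ_two, hM', hN']
  · linear_combination (N 0 0 + N 1 1) / 2 * h1 - hA / 2 - ht / 2
  · linear_combination - hB / 2
  · linear_combination - hB / 2
  · linear_combination (N 0 0 + N 1 1) / 2 * h1 + hA / 2 - ht / 2

/-- If `F` vanishes on the values of an analytic field of symmetric matrices, then the trace and the
discriminant of the field are functionally dependent. -/
lemma bracket_eq_zero_of_invariant {F : Matrix (Fin 2) (Fin 2) ℝ → ℝ}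
    (hFrot : RotationallyInvariant F) (hFzero : NeverLocallyZero F)
    {N : ℝ × ℝ → Matrix (Fin 2) (Fin 2) ℝ} {W : Set (ℝ × ℝ)} (hW : IsOpen W)
    (hN : ∀ q ∈ W, (N q).IsSymm) (hF : ∀ q ∈ W, F (N q) = 0) {H D : ℝ × ℝ → ℝ}
    (hHN : ∀ q ∈ W, H q = N q 0 0 + N q 1 1) (hDN : ∀ q ∈ W, D q = disc (N q))
    (hH : AnalyticOnNhd ℝ H W) (hD : AnalyticOnNhd ℝ D W) {q : ℝ × ℝ} (hq : q ∈ W) :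
    Dx H q * Dy D q = Dy H q * Dx D q := by
  by_contra hcon
  have hΔ : Dy H q * Dx D q - Dx H q * Dy D q ≠ 0 := fun h => hcon (sub_eq_zero.1 h).symm
  have hstrict : HasStrictFDerivAt (fun p => (H p, D p))
      ((fderiv ℝ H q).prod (fderiv ℝ D q)) q :=
    (hH q hq).hasStrictFDerivAt.prodMk (hD q hq).hasStrictFDerivAt
  have hsurj : ((fderiv ℝ H q).prod (fderiv ℝ D q)).range = ⊤ := by
    rw [LinearMap.range_eq_top]
    rintro ⟨a, b⟩
    have happ : ∀ (G : ℝ × ℝ → ℝ) (y x : ℝ), fderiv ℝ G q (y, x) = y * Dy G q + x * Dx G q := by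
      intro G y x
      have : ((y, x) : ℝ × ℝ) = y • (1, 0) + x • (0, 1) := by simp
      rw [this, map_add, map_smul, map_smul]
      rfl
    refine ⟨((a * Dx D q - b * Dx H q) / (Dy H q * Dx D q - Dx H q * Dy D q),
      (b * Dy H q - a * Dy D q) / (Dy H q * Dx D q - Dx H q * Dy D q)), ?_⟩
    change (fderiv ℝ H q _, fderiv ℝ D q _) = _
    rw [happ, happ]
    rw [Prod.mk.injEq]
    constructor <;>
      rw [div_mul_eq_mul_div, div_mul_eq_mul_div, ← add_div, div_eq_iff hΔ] <;> ring
  have hnhds := hstrict.map_nhds_eq_of_surj hsurj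
  -- With non-zero Jacobian the map is open at `q`. Then every symmetric matrix with invariants
  -- close to those of `N q` is conjugate to a value of `N`, and `F` vanishes on an open set.
  have himg : (fun p => (H p, D p)) '' W ∈ 𝓝 (H q, D q) := by
    rw [← hnhds]; exact image_mem_map (hW.mem_nhds hq)
  let Ψ : Matrix (Fin 2) (Fin 2) ℝ → ℝ × ℝ := fun M => (M 0 0 + M 1 1, disc M)
  have hΨ : Continuous Ψ := by unfold Ψ disc; fun_prop
  obtain ⟨M, hMV, hMs, hM⟩ := hFzero (Ψ ⁻¹' interior ((fun p => (H p, D p)) '' W))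
    (isOpen_interior.preimage hΨ) ⟨N q, by
      rw [mem_preimage, mem_interior_iff_mem_nhds]
      change _ ∈ 𝓝 (N q 0 0 + N q 1 1, disc (N q))
      rwa [← hHN q hq, ← hDN q hq], hN q hq⟩
  obtain ⟨q', hq', he⟩ := interior_subset hMV
  obtain ⟨h1, h2⟩ := Prod.mk.inj he
  obtain ⟨Q, hQ, hQM⟩ := exists_orthogonal_conj hMs (hN q' hq') (by rw [← hHN q' hq', h1])
    (by rw [← hDN q' hq', h2])
  exact hM (by rw [← hQM, hFrot _ (hN q' hq') Q hQ, hF q' hq'])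

end Jacobian

end HessianPlane

namespace HessianPlane

/-! ### Leading terms of the second derivatives. -/

section LeadingTerm

open PowerSeries

lemma iterate_zero_fun {D : (ℝ × ℝ → ℝ) → ℝ × ℝ → ℝ} (h : D (fun _ => 0) = fun _ => 0) (i : ℕ) :
    D^[i] (fun _ => 0) = fun _ => 0 :=
  Function.iterate_fixed h i

lemma taylor_const (k : ℝ) : taylor (fun _ => k) = C (C (k : ℂ)) := by
  have hx : ∀ k : ℝ, Dx (fun _ => k) = fun _ => 0 := fun k => by ext; simp [Dx]
  have hy : ∀ k : ℝ, Dy (fun _ => k) = fun _ => 0 := fun k => by ext; simp [Dy]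
  refine formal_ext fun i j => ?_
  rw [cf_taylor, cf_apply, coeff_C]
  rcases j with _ | j
  · rcases i with _ | i
    · simp
    · rw [Function.iterate_zero_apply, Function.iterate_succ_apply, hx, iterate_zero_fun (hx 0)]
      simp
  · rw [Function.iterate_succ_apply, hy, iterate_zero_fun (hy 0), iterate_zero_fun (hx 0)]
    split_ifs <;> simp

lemma taylor_const_mul {f : ℝ × ℝ → ℝ} (hf : AnalyticAt ℝ f 0) (k : ℝ) :
    taylor (fun q => k * f q) = C (C (k : ℂ)) * taylor f := by
  rw [← taylor_const, ← taylor_mul analyticAt_const hf]; rfl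

/-- The directional derivative of `f` along `w`. -/
noncomputable def dirDeriv {E : Type*} [NormedAddCommGroup E] [NormedSpace ℝ E] (w : E) (f : E → ℝ)
    (p : E) : ℝ := fderiv ℝ f p w

lemma iteratedFDeriv_diag {E : Type*} [NormedAddCommGroup E] [NormedSpace ℝ E] {f : E → ℝ}
    {p : E} (hf : AnalyticAt ℝ f p) (w : E) (k : ℕ) :
    iteratedFDeriv ℝ k f p (fun _ => w) = (dirDeriv w)^[k] f p := by
  induction k generalizing p with
  | zero => rfl
  | succ k ih =>
    rw [iteratedFDeriv_succ_apply_left, Function.iterate_succ_apply', dirDeriv]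
    have h1 : (fun p' => iteratedFDeriv ℝ k f p' (fun _ => w)) =ᶠ[𝓝 p] (dirDeriv w)^[k] f :=
      hf.eventually_analyticAt.mono fun p' hp' => ih hp'
    rw [← h1.fderiv_eq]
    have h2 : DifferentiableAt ℝ (iteratedFDeriv ℝ k f) p :=
      (hf.contDiffAt (n := ⊤)).differentiableAt_iteratedFDeriv (by simp)
    have h3 := ((ContinuousMultilinearMap.apply ℝ (fun _ : Fin k => E) ℝ
      (fun _ => w)).hasFDerivAt (x := iteratedFDeriv ℝ k f p)).comp p h2.hasFDerivAt
    exact (congrArg (fun L => L w) h3.fderiv).symm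

lemma dirDeriv_comp_equiv {E G : Type*} [NormedAddCommGroup E] [NormedSpace ℝ E]
    [NormedAddCommGroup G] [NormedSpace ℝ G] (L : G ≃L[ℝ] E) (f : E → ℝ) (w : G) :
    dirDeriv w (f ∘ L) = dirDeriv (L w) f ∘ L := by
  ext p
  rw [dirDeriv, L.comp_right_fderiv]
  rfl

lemma dirDeriv_iterate_comp_equiv {E G : Type*} [NormedAddCommGroup E] [NormedSpace ℝ E]
    [NormedAddCommGroup G] [NormedSpace ℝ G] (L : G ≃L[ℝ] E) (f : E → ℝ) (w : G) (k : ℕ) :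
    (dirDeriv w)^[k] (f ∘ L) = (dirDeriv (L w))^[k] f ∘ L := by
  induction k generalizing f with
  | zero => rfl
  | succ k ih => rw [Function.iterate_succ_apply, dirDeriv_comp_equiv, ih]; rfl

lemma taylor_dirDeriv {f : ℝ × ℝ → ℝ} (hf : AnalyticAt ℝ f 0) (y x : ℝ) :
    taylor (dirDeriv (y, x) f) = C (C (x : ℂ)) * dx (taylor f) + C (C (y : ℂ)) * dy (taylor f) := by
  have h : dirDeriv (y, x) f = (fun q => x * Dx f q) + fun q => y * Dy f q := by
    ext q
    have : ((y, x) : ℝ × ℝ) = x • (0, 1) + y • (1, 0) := by simp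
    rw [dirDeriv, this, map_add, map_smul, map_smul]
    rfl
  have hx := analyticAt_Dx hf
  have hy := analyticAt_Dy hf
  have hx' : AnalyticAt ℝ (fun q => x * Dx f q) 0 := analyticAt_const.mul hx
  have hy' : AnalyticAt ℝ (fun q => y * Dy f q) 0 := analyticAt_const.mul hy
  rw [h, taylor_add hx' hy', taylor_const_mul hx,
    taylor_const_mul hy, taylor_Dx hf, taylor_Dy]

lemma analyticAt_dirDeriv {f : ℝ × ℝ → ℝ} {q : ℝ × ℝ} (hf : AnalyticAt ℝ f q) (w : ℝ × ℝ) :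
    AnalyticAt ℝ (dirDeriv w f) q :=
  ((ContinuousLinearMap.apply ℝ ℝ w).analyticAt _).comp hf.fderiv

/-- The value at `(x, y)` of the homogeneous term of degree `k`. -/
noncomputable def homTerm (x y : ℂ) (k : ℕ) (S : Formal) : ℂ :=
  ∑ p ∈ Finset.HasAntidiagonal.antidiagonal k, x ^ p.1 * y ^ p.2 * cf p.1 p.2 S

/-- This is Euler's identity for the part of degree `k + 1`. Iterated, it turns derivatives in the
direction `(x, y)` into values of homogeneous terms. -/
lemma homTerm_euler (x y : ℂ) (k : ℕ) (S : Formal) :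
    homTerm x y k (C (C x) * dx S + C (C y) * dy S) = (k + 1) * homTerm x y (k + 1) S := by
  have h1 : homTerm x y k (C (C x) * dx S + C (C y) * dy S) =
      ∑ p ∈ Finset.HasAntidiagonal.antidiagonal k, (p.1 + 1) * (x ^ (p.1 + 1) * y ^ p.2 * cf (p.1 + 1) p.2 S) +
      ∑ p ∈ Finset.HasAntidiagonal.antidiagonal k, (p.2 + 1) * (x ^ p.1 * y ^ (p.2 + 1) * cf p.1 (p.2 + 1) S) := by
    rw [homTerm, ← Finset.sum_add_distrib]
    refine Finset.sum_congr rfl fun p _ => ?_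
    rw [map_add, cf_C_C_mul, cf_C_C_mul, cf_dx, cf_dy]
    ring
  have h2 : (∑ p ∈ Finset.HasAntidiagonal.antidiagonal (k + 1), (p.1 : ℂ) * (x ^ p.1 * y ^ p.2 * cf p.1 p.2 S)) =
      ∑ p ∈ Finset.HasAntidiagonal.antidiagonal k, (p.1 + 1) * (x ^ (p.1 + 1) * y ^ p.2 * cf (p.1 + 1) p.2 S) := by
    rw [Finset.Nat.sum_antidiagonal_succ]; simp
  have h3 : (∑ p ∈ Finset.HasAntidiagonal.antidiagonal (k + 1), (p.2 : ℂ) * (x ^ p.1 * y ^ p.2 * cf p.1 p.2 S)) =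
      ∑ p ∈ Finset.HasAntidiagonal.antidiagonal k, (p.2 + 1) * (x ^ p.1 * y ^ (p.2 + 1) * cf p.1 (p.2 + 1) S) := by
    rw [Finset.Nat.sum_antidiagonal_succ']; simp
  rw [h1, ← h2, ← h3, ← Finset.sum_add_distrib, homTerm, Finset.mul_sum]
  refine Finset.sum_congr rfl fun p hp => ?_
  have : (k : ℂ) + 1 = p.1 + p.2 := by
    exact_mod_cast (Finset.HasAntidiagonal.mem_antidiagonal.1 hp).symm
  rw [this]
  ring

lemma dirDeriv_iterate_zero {f : ℝ × ℝ → ℝ} (hf : AnalyticAt ℝ f 0) (y x : ℝ) (k : ℕ) :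
    (((dirDeriv (y, x))^[k] f 0 : ℝ) : ℂ) = k.factorial * homTerm x y k (taylor f) := by
  induction k generalizing f with
  | zero => simp [homTerm, taylor_zero_zero]
  | succ k ih =>
    rw [Function.iterate_succ_apply, ih (analyticAt_dirDeriv hf _), taylor_dirDeriv hf,
      homTerm_euler, Nat.factorial_succ]
    push_cast
    ring

/-- If the homogeneous term of degree `k` only depends on `x`, then it is `a * x ^ k`. -/
lemma cf_eq_of_homTerm {S : Formal} {k : ℕ} {a : ℂ} (h : ∀ y : ℝ, homTerm 1 y k S = a) :
    cf k 0 S = a ∧ ∀ i j, i + j = k → j ≠ 0 → cf i j S = 0 := by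
  -- Both sides are polynomials in `y` that agree at all real values.
  have hpoly : coeff k (blowUp S) = Polynomial.C a := by
    refine Polynomial.eq_of_infinite_eval_eq _ _ (Infinite.mono ?_
      (infinite_range_of_injective Complex.ofReal_injective))
    rintro _ ⟨y, rfl⟩
    rw [mem_ofPred_eq, Polynomial.eval_C, ← h y, homTerm, coeff_blowUp, Polynomial.eval_finsetSum,
      Finset.Nat.sum_antidiagonal_eq_sum_range_succ_mk]
    refine Finset.sum_congr rfl fun i _ => ?_
    rw [Polynomial.eval_monomial, one_pow, one_mul, mul_comm]
  refine ⟨?_, fun i j hij hj => ?_⟩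
  · have := congrArg (fun p => p.coeff 0) hpoly
    simpa [coeff_coeff_blowUp] using this
  · have := congrArg (fun p => p.coeff j) hpoly
    subst hij
    simpa [coeff_coeff_blowUp (Nat.le_add_left j i), Polynomial.coeff_C, hj] using this

/-- Terms of degree between `3` and `n + 2` of `S` vanish, except for `a * x ^ (n + 2)`. -/
def IsCubicLeading (n : ℕ) (a : ℂ) (S : Formal) : Prop :=
  ∀ i j, 3 ≤ i + j → i + j ≤ n + 2 → cf i j S = if j = 0 ∧ i = n + 2 then a else 0

lemma IsCubicLeading.of_eq {n : ℕ} {a : ℂ} {S : Formal} (h : IsCubicLeading n a S) {i j : ℕ}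
    (h3 : 3 ≤ i + j) (hn : i + j ≤ n + 2) (hne : ¬ (j = 0 ∧ i = n + 2)) : cf i j S = 0 := by
  rw [h i j h3 hn, if_neg hne]

/-- The quadratic part of `S` contributes only the constant `k`, and the term `a * x ^ (n + 2)` is
killed by `dy`. The cases `s = 1` and `s = -1` give `H` and `A`. -/
lemma isXLeading_second_derivatives {n : ℕ} {a : ℂ} {S : Formal} (hn : 1 ≤ n)
    (h : IsCubicLeading n a S) (s : ℂ) (T : Formal) (hT : T = dx (dx S) + C (C s) * dy (dy S))
    (k : ℂ) (hk : cf 0 0 T = k) :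
    IsXLeading n ((n + 1) * (n + 2) * a) (T - C (C k)) := by
  have hcoef : ∀ i j, cf i j T = (i + 1) * (i + 2) * cf (i + 2) j S +
      s * ((j + 1) * (j + 2) * cf i (j + 2) S) := fun i j => by
    rw [hT, map_add, cf_C_C_mul, cf_dx, cf_dx, cf_dy, cf_dy]; push_cast; ring
  have hconst : ∀ i j, i + j ≠ 0 → cf i j (T - C (C k)) = cf i j T := fun i j hij => by
    rw [map_sub, sub_eq_self, cf_apply, coeff_C]
    split_ifs with hi
    · rw [coeff_C, if_neg (by omega)]
    · exact map_zero _
  have hsec : ∀ i j, i + j ≠ 0 → i + j ≤ n → cf i (j + 2) S = 0 := fun i j h0 hij =>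
    h.of_eq (by omega) (by omega) (by omega)
  refine ⟨fun i j hij => ?_, ?_, fun i j hij hj => ?_⟩
  · by_cases h0 : i + j = 0
    · obtain ⟨rfl, rfl⟩ : i = 0 ∧ j = 0 := by omega
      rw [map_sub, hk, cf_zero_zero]; simp
    · rw [hconst i j h0, hcoef, hsec i j h0 (by omega),
        h.of_eq (i := i + 2) (by omega) (by omega) (by omega)]
      ring
  · rw [hconst n 0 (by omega), hcoef, hsec n 0 (by omega) (by omega),
      h (n + 2) 0 (by omega) (by omega), if_pos ⟨rfl, rfl⟩]
    ring
  · rw [hconst i j (by omega), hcoef, hsec i j (by omega) (by omega),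
      h.of_eq (i := i + 2) (by omega) (by omega) (by omega)]
    ring

lemma isXLeading_mixed_derivative {n : ℕ} {a : ℂ} {S : Formal} (h : IsCubicLeading n a S)
    (s : ℂ) (h0 : cf 1 1 S = 0) : IsXLeading n 0 (C (C s) * dx (dy S)) := by
  have hcoef : ∀ i j, i + j ≤ n → cf i j (C (C s) * dx (dy S)) = 0 := fun i j hij => by
    rw [cf_C_C_mul, cf_dx, cf_dy]
    by_cases hz : i + j = 0
    · obtain ⟨rfl, rfl⟩ : i = 0 ∧ j = 0 := by omega
      rw [h0]; ring
    · rw [h.of_eq (i := i + 1) (by omega) (by omega) (by omega)]; ring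
  exact ⟨fun i j hij => hcoef i j (by omega), hcoef n 0 (by omega),
    fun i j hij _ => hcoef i j (by omega)⟩

end LeadingTerm

end HessianPlane

namespace HessianPlane

/-! ### Rotated coordinates and the Hessian in them. -/

section Frame

/-- The rotated coordinates `q = (y, x)` of the plane, with axes `(c, s)` for `x` and `(-s, c)`
for `y`. -/
noncomputable def frame (c s : ℝ) (h : c ^ 2 + s ^ 2 = 1) : (ℝ × ℝ) ≃L[ℝ] Plane :=
  LinearEquiv.toContinuousLinearEquiv
    { toFun := fun q => !₂[c * q.2 - s * q.1, s * q.2 + c * q.1]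
      invFun := fun p => (-s * p 0 + c * p 1, c * p 0 + s * p 1)
      map_add' := fun q q' => by
        ext i; fin_cases i <;> simp <;> ring
      map_smul' := fun k q => by
        ext i; fin_cases i <;> simp <;> ring
      left_inv := fun q => by
        ext
        · simp; linear_combination q.1 * h
        · simp; linear_combination q.2 * h
      right_inv := fun p => by
        ext i
        fin_cases i
        · simp; linear_combination p 0 * h
        · simp; linear_combination p 1 * h }

variable {c s : ℝ} (h : c ^ 2 + s ^ 2 = 1)

@[simp] lemma frame_apply_zero (q : ℝ × ℝ) : frame c s h q 0 = c * q.2 - s * q.1 := rfl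

@[simp] lemma frame_apply_one (q : ℝ × ℝ) : frame c s h q 1 = s * q.2 + c * q.1 := rfl

lemma norm_frame_sq (q : ℝ × ℝ) : ‖frame c s h q‖ ^ 2 = q.1 ^ 2 + q.2 ^ 2 := by
  rw [EuclideanSpace.real_norm_sq_eq, Fin.sum_univ_two, frame_apply_zero, frame_apply_one]
  linear_combination (q.1 ^ 2 + q.2 ^ 2) * h

lemma dirDeriv_eq_partialDeriv (f : Plane → ℝ) (p w : Plane) :
    dirDeriv w f p = w 0 * partialDeriv 0 f p + w 1 * partialDeriv 1 f p := by
  have : w = w 0 • EuclideanSpace.single 0 1 + w 1 • EuclideanSpace.single 1 1 := by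
    ext i; fin_cases i <;> simp
  rw [dirDeriv, this, map_add, map_smul, map_smul]
  simp [partialDeriv]

lemma analyticAt_partialDeriv {f : Plane → ℝ} {p : Plane} (hf : AnalyticAt ℝ f p) (i : Fin 2) :
    AnalyticAt ℝ (partialDeriv i f) p :=
  ((ContinuousLinearMap.apply ℝ ℝ (EuclideanSpace.single i (1 : ℝ))).analyticAt _).comp hf.fderiv

lemma hess_isSymm {f : Plane → ℝ} {p : Plane} (hf : AnalyticAt ℝ f p) : (hess f p).IsSymm := by
  have hsymm : IsSymmSndFDerivAt ℝ f p :=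
    ContDiffAt.isSymmSndFDerivAt (n := ⊤) hf.contDiffAt (by simp)
  ext i j
  change fderiv ℝ (fun p => fderiv ℝ f p (EuclideanSpace.single i 1)) p
      (EuclideanSpace.single j 1) =
    fderiv ℝ (fun p => fderiv ℝ f p (EuclideanSpace.single j 1)) p (EuclideanSpace.single i 1)
  rw [fderiv_fderiv_apply hf, fderiv_fderiv_apply hf]
  exact hsymm _ _

lemma dirDeriv_dirDeriv {f : Plane → ℝ} {p : Plane} (hf : AnalyticAt ℝ f p) (w w' : Plane) :
    dirDeriv w (dirDeriv w' f) p = w 0 * w' 0 * hess f p 0 0 + w 0 * w' 1 * hess f p 0 1 +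
      (w 1 * w' 0 * hess f p 1 0 + w 1 * w' 1 * hess f p 1 1) := by
  have h0 := (analyticAt_partialDeriv hf 0).differentiableAt
  have h1 := (analyticAt_partialDeriv hf 1).differentiableAt
  have he : dirDeriv w' f = fun p => w' 0 * partialDeriv 0 f p + w' 1 * partialDeriv 1 f p :=
    funext fun p => dirDeriv_eq_partialDeriv f p w'
  have hd : fderiv ℝ (dirDeriv w' f) p =
      w' 0 • fderiv ℝ (partialDeriv 0 f) p + w' 1 • fderiv ℝ (partialDeriv 1 f) p := by
    rw [he]
    exact ((h0.hasFDerivAt.const_mul (w' 0)).add (h1.hasFDerivAt.const_mul (w' 1))).fderiv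
  have e0 := dirDeriv_eq_partialDeriv (partialDeriv 0 f) p w
  have e1 := dirDeriv_eq_partialDeriv (partialDeriv 1 f) p w
  have : dirDeriv w (dirDeriv w' f) p =
      w' 0 * dirDeriv w (partialDeriv 0 f) p + w' 1 * dirDeriv w (partialDeriv 1 f) p := by
    rw [dirDeriv, hd]; rfl
  rw [this, e0, e1]
  simp only [hess, Matrix.of_apply]
  ring

/-- The Hessian in rotated coordinates. -/
noncomputable def rotHess (c s : ℝ) (M : Matrix (Fin 2) (Fin 2) ℝ) : Matrix (Fin 2) (Fin 2) ℝ :=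
  !![c, -s; s, c]ᵀ * M * !![c, -s; s, c]

lemma rotHess_isSymm {M : Matrix (Fin 2) (Fin 2) ℝ} (hM : M.IsSymm) : (rotHess c s M).IsSymm := by
  rw [Matrix.IsSymm, rotHess, Matrix.transpose_mul, Matrix.transpose_mul, Matrix.transpose_transpose,
    hM.eq, Matrix.mul_assoc]

variable {u : Plane → ℝ} {q : ℝ × ℝ} (hu : AnalyticAt ℝ u (frame c s h q))

include hu in
lemma Dx_Dx_comp_frame : Dx (Dx (u ∘ frame c s h)) q = rotHess c s (hess u (frame c s h q)) 0 0 := by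
  change dirDeriv (0, 1) (dirDeriv (0, 1) (u ∘ frame c s h)) q = _
  rw [dirDeriv_comp_equiv, dirDeriv_comp_equiv, Function.comp_apply, dirDeriv_dirDeriv hu]
  simp [rotHess, Matrix.mul_apply, Fin.sum_univ_two]
  ring

include hu in
lemma Dx_Dy_comp_frame : Dx (Dy (u ∘ frame c s h)) q = rotHess c s (hess u (frame c s h q)) 0 1 := by
  change dirDeriv (0, 1) (dirDeriv (1, 0) (u ∘ frame c s h)) q = _
  rw [dirDeriv_comp_equiv, dirDeriv_comp_equiv, Function.comp_apply, dirDeriv_dirDeriv hu]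
  simp [rotHess, Matrix.mul_apply, Fin.sum_univ_two]
  ring

include hu in
lemma Dy_Dy_comp_frame : Dy (Dy (u ∘ frame c s h)) q = rotHess c s (hess u (frame c s h q)) 1 1 := by
  change dirDeriv (1, 0) (dirDeriv (1, 0) (u ∘ frame c s h)) q = _
  rw [dirDeriv_comp_equiv, dirDeriv_comp_equiv, Function.comp_apply, dirDeriv_dirDeriv hu]
  simp [rotHess, Matrix.mul_apply, Fin.sum_univ_two]
  ring

end Frame

/-! ### The Codazzi equations. -/

section Codazzi

variable {f g v : ℝ × ℝ → ℝ} {q : ℝ × ℝ}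

lemma fderiv_affine_apply (hf : AnalyticAt ℝ f q) (hg : AnalyticAt ℝ g q) (k e : ℝ) (w : ℝ × ℝ) :
    fderiv ℝ (fun q => f q + k * g q + e) q w = fderiv ℝ f q w + k * fderiv ℝ g q w := by
  have := ((hf.differentiableAt.hasFDerivAt.add
    (hg.differentiableAt.hasFDerivAt.const_mul k)).add_const e).fderiv
  exact congrArg (fun L => L w) this

lemma Dx_affine (hf : AnalyticAt ℝ f q) (hg : AnalyticAt ℝ g q) (k e : ℝ) :
    Dx (fun q => f q + k * g q + e) q = Dx f q + k * Dx g q :=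
  fderiv_affine_apply hf hg k e _

lemma Dy_affine (hf : AnalyticAt ℝ f q) (hg : AnalyticAt ℝ g q) (k e : ℝ) :
    Dy (fun q => f q + k * g q + e) q = Dy f q + k * Dy g q :=
  fderiv_affine_apply hf hg k e _

lemma Dx_const_mul (hf : AnalyticAt ℝ f q) (k : ℝ) : Dx (fun q => k * f q) q = k * Dx f q :=
  congrArg (fun L => L (0, 1)) (hf.differentiableAt.hasFDerivAt.const_mul k).fderiv

lemma Dy_const_mul (hf : AnalyticAt ℝ f q) (k : ℝ) : Dy (fun q => k * f q) q = k * Dy f q :=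
  congrArg (fun L => L (1, 0)) (hf.differentiableAt.hasFDerivAt.const_mul k).fderiv

lemma codazzi_x (hv : AnalyticAt ℝ v q) (k : ℝ) :
    Dx (fun q => Dx (Dx v) q + (-1) * Dy (Dy v) q + 0) q + Dy (fun q => 2 * Dx (Dy v) q) q =
      Dx (fun q => Dx (Dx v) q + 1 * Dy (Dy v) q + k) q := by
  have hx := analyticAt_Dx hv
  have hy := analyticAt_Dy hv
  rw [Dx_affine (analyticAt_Dx hx) (analyticAt_Dy hy),
    Dx_affine (analyticAt_Dx hx) (analyticAt_Dy hy), Dy_const_mul (analyticAt_Dx hy), Dx_Dy_eq hy]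
  ring

lemma codazzi_y (hv : AnalyticAt ℝ v q) (k : ℝ) :
    Dx (fun q => 2 * Dx (Dy v) q) q = Dy (fun q => Dx (Dx v) q + (-1) * Dy (Dy v) q + 0) q +
      Dy (fun q => Dx (Dx v) q + 1 * Dy (Dy v) q + k) q := by
  have hx := analyticAt_Dx hv
  have hy := analyticAt_Dy hv
  have h : Dy (Dx (Dx v)) q = Dx (Dx (Dy v)) q :=
    (Dx_Dy_eq hx).symm.trans (Dx_congr (Dx_Dy_eventuallyEq hv)).eq_of_nhds.symm
  rw [Dy_affine (analyticAt_Dx hx) (analyticAt_Dy hy),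
    Dy_affine (analyticAt_Dx hx) (analyticAt_Dy hy), Dx_const_mul (analyticAt_Dx hy), h]
  ring

lemma taylor_affine (hf : AnalyticAt ℝ f 0) (hg : AnalyticAt ℝ g 0) (k e : ℝ) :
    taylor (fun q => f q + k * g q + e) = taylor f + PowerSeries.C (PowerSeries.C (k : ℂ)) * taylor g -
      PowerSeries.C (PowerSeries.C ((-e : ℝ) : ℂ)) := by
  have hg' : AnalyticAt ℝ (fun q => k * g q) 0 := analyticAt_const.mul hg
  have h1 := taylor_add hf hg'
  have h2 := taylor_add (hf.add hg') (analyticAt_const (v := e))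
  rw [h1, taylor_const, taylor_const_mul hg] at h2
  rw [Complex.ofReal_neg, map_neg, map_neg, sub_neg_eq_add]
  exact h2

end Codazzi

/-! ### Factorization of the traceless Hessian of `u`. -/

section Reduction

variable {u : Plane → ℝ}

lemma IsParabolicAtOrigin.isCubicLeading (hu : AnalyticAt ℝ u 0) (hpar : IsParabolicAtOrigin u) :
    ∃ (n : ℕ) (a c s : ℝ) (h : c ^ 2 + s ^ 2 = 1), 1 ≤ n ∧ a ≠ 0 ∧
      IsCubicLeading n a (taylor (u ∘ frame c s h)) := by
  obtain ⟨n, a, θ, hn, ha, -, hlow, htop, -⟩ := hpar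
  have h : Real.cos θ ^ 2 + Real.sin θ ^ 2 = 1 := Real.cos_sq_add_sin_sq θ
  refine ⟨n, a, Real.cos θ, Real.sin θ, h, hn, ha, ?_⟩
  set L := frame (Real.cos θ) (Real.sin θ) h with hL
  have hv : AnalyticAt ℝ (u ∘ L) 0 := by
    refine AnalyticAt.comp ?_ (L.analyticAt 0)
    rwa [map_zero]
  -- Homogeneous terms are compared on the line `x = 1`, where the leading term is the constant `a`.
  have key : ∀ (k : ℕ) (y : ℝ), homTerm 1 y k (taylor (u ∘ L)) = (taylorTerm u k (L (y, 1)) : ℝ) := by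
    intro k y
    have h1 := dirDeriv_iterate_zero hv y 1 k
    rw [dirDeriv_iterate_comp_equiv, Function.comp_apply, map_zero, ← iteratedFDeriv_diag hu,
      Complex.ofReal_one] at h1
    rw [taylorTerm, Complex.ofReal_mul, h1, Complex.ofReal_inv, Complex.ofReal_natCast,
      inv_mul_cancel_left₀ (Nat.cast_ne_zero.2 k.factorial_ne_zero)]
  intro i j h3 hij
  rcases hij.lt_or_eq with hlt | heq
  · have := cf_eq_of_homTerm (S := taylor (u ∘ L)) (k := i + j) (a := 0) fun y => by
      rw [key, hlow _ h3 hlt, Complex.ofReal_zero]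
    rw [if_neg (by omega)]
    by_cases hj : j = 0
    · subst hj; exact this.1
    · exact this.2 i j rfl hj
  · have := cf_eq_of_homTerm (S := taylor (u ∘ L)) (k := n + 2) (a := a) fun y => by
      rw [key, htop, hL]
      beta_reduce
      rw [frame_apply_zero, frame_apply_one]
      have : Real.cos θ * (Real.cos θ * 1 - Real.sin θ * y) +
          Real.sin θ * (Real.sin θ * 1 + Real.cos θ * y) = 1 := by linear_combination h
      rw [this, one_pow, mul_one]
    by_cases hj : j = 0
    · subst hj
      obtain rfl : i = n + 2 := by omega
      rw [if_pos ⟨rfl, rfl⟩]; exact this.1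
    · rw [if_neg (by omega)]
      exact this.2 i j heq hj

lemma rotHess_smul_one {c s : ℝ} (h : c ^ 2 + s ^ 2 = 1) (k : ℝ) :
    rotHess c s (k • (1 : Matrix (Fin 2) (Fin 2) ℝ)) = k • 1 := by
  have hR := rotation_mem_orthogonalGroup h
  rw [Matrix.mem_orthogonalGroup_iff'] at hR
  rw [rotHess, Matrix.mul_smul, Matrix.smul_mul, Matrix.mul_one]
  exact congrArg (k • ·) hR

/-- Near the origin, the umbilic part of the Hessian is divisible by a power of the equation of a
curve that is tangent to the `y`-axis. -/
lemma exists_umbilic_factorization {F : Matrix (Fin 2) (Fin 2) ℝ → ℝ}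
    (hFrot : RotationallyInvariant F) (hFzero : NeverLocallyZero F)
    {Ω Ω₀ : Set Plane} (hΩ : IsOpen Ω) (hΩ₀ : IsOpen Ω₀) (hsub : closure Ω ⊆ Ω₀)
    (hu : AnalyticOnNhd ℝ u Ω₀) (hsol : ∀ p ∈ Ω, F (hess u p) = 0)
    (h0 : (0 : Plane) ∈ umbilicSet u (closure Ω)) (hpar : IsParabolicAtOrigin u) :
    ∃ (c s : ℝ) (h : c ^ 2 + s ^ 2 = 1) (n : ℕ) (σ : ℝ → ℝ) (a b : ℝ × ℝ → ℝ),
      AnalyticAt ℝ σ 0 ∧ σ 0 = 0 ∧ deriv σ 0 = 0 ∧ AnalyticAt ℝ a 0 ∧ AnalyticAt ℝ b 0 ∧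
      a 0 ≠ 0 ∧ b 0 = 0 ∧ ∀ᶠ q in 𝓝 (0 : ℝ × ℝ),
        rotHess c s (hess u (frame c s h q)) 0 0 - rotHess c s (hess u (frame c s h q)) 1 1 =
          (q.2 - σ q.1) ^ (n + 1) * a q ∧
        2 * rotHess c s (hess u (frame c s h q)) 0 1 = (q.2 - σ q.1) ^ (n + 1) * b q := by
  obtain ⟨hmem, k, hk⟩ := h0
  have h0Ω : (0 : Plane) ∈ Ω₀ := hsub hmem
  obtain ⟨n', e, c, s, h, hn, he, hlead⟩ := hpar.isCubicLeading (hu 0 h0Ω)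
  obtain ⟨n, rfl⟩ : ∃ n, n' = n + 1 := ⟨n' - 1, by omega⟩
  set L := frame c s h
  set v := u ∘ L
  set W₀ := L ⁻¹' Ω₀
  have hW₀ : IsOpen W₀ := hΩ₀.preimage L.continuous
  have h0W : (0 : ℝ × ℝ) ∈ W₀ := by rwa [mem_preimage, map_zero]
  have hv : AnalyticOnNhd ℝ v W₀ := fun q hq => (hu _ hq).comp (L.analyticAt q)
  have hxx : AnalyticOnNhd ℝ (Dx (Dx v)) W₀ := fun q hq => analyticAt_Dx (analyticAt_Dx (hv q hq))
  have hxy : AnalyticOnNhd ℝ (Dx (Dy v)) W₀ := fun q hq => analyticAt_Dx (analyticAt_Dy (hv q hq))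
  have hyy : AnalyticOnNhd ℝ (Dy (Dy v)) W₀ := fun q hq => analyticAt_Dy (analyticAt_Dy (hv q hq))
  have exx : ∀ q ∈ W₀, Dx (Dx v) q = rotHess c s (hess u (L q)) 0 0 :=
    fun q hq => Dx_Dx_comp_frame h (hu _ hq)
  have exy : ∀ q ∈ W₀, Dx (Dy v) q = rotHess c s (hess u (L q)) 0 1 :=
    fun q hq => Dx_Dy_comp_frame h (hu _ hq)
  have eyy : ∀ q ∈ W₀, Dy (Dy v) q = rotHess c s (hess u (L q)) 1 1 :=
    fun q hq => Dy_Dy_comp_frame h (hu _ hq)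
  let T : ℝ × ℝ → ℝ := fun q => Dx (Dx v) q + 1 * Dy (Dy v) q
  -- The trace at the origin is `2 * k`, so `H` vanishes there. `H` and `A` are both written as `f +
  -- k * g + e` to share the lemmas on affine combinations.
  let H : ℝ × ℝ → ℝ := fun q => Dx (Dx v) q + 1 * Dy (Dy v) q + -(2 * k)
  let A : ℝ × ℝ → ℝ := fun q => Dx (Dx v) q + (-1) * Dy (Dy v) q + 0
  let B : ℝ × ℝ → ℝ := fun q => 2 * Dx (Dy v) q
  have hT : AnalyticOnNhd ℝ T W₀ := fun q hq => (hxx q hq).add (analyticAt_const.mul (hyy q hq))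
  have hH : AnalyticOnNhd ℝ H W₀ := fun q hq => (hT q hq).add analyticAt_const
  have hA : AnalyticOnNhd ℝ A W₀ := fun q hq =>
    ((hxx q hq).add (analyticAt_const.mul (hyy q hq))).add analyticAt_const
  have hB : AnalyticOnNhd ℝ B W₀ := fun q hq => analyticAt_const.mul (hxy q hq)
  have hHx : Dx H = Dx T := by ext q; change fderiv ℝ (fun q => T q + _) q _ = _; rw [fderiv_add_const]; rfl
  have hHy : Dy H = Dy T := by ext q; change fderiv ℝ (fun q => T q + _) q _ = _; rw [fderiv_add_const]; rfl
  -- The equation for `F` holds on `Ω` only, but the origin is in its closure: the bracket vanishes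
  -- on an open part of a ball, hence on the ball by the identity theorem.
  have hbr : ∀ᶠ q in 𝓝 (0 : ℝ × ℝ), Dx H q * Dy (A * A + B * B) q - Dy H q * Dx (A * A + B * B) q = 0 := by
    have hD : AnalyticOnNhd ℝ (A * A + B * B) W₀ := (hA.mul hA).add (hB.mul hB)
    obtain ⟨r, hr, hball⟩ := Metric.isOpen_iff.1 hW₀ 0 h0W
    have hΦ : AnalyticOnNhd ℝ (fun q => Dx H q * Dy (A * A + B * B) q - Dy H q * Dx (A * A + B * B) q)
        (Metric.ball 0 r) := fun q hq =>
      ((analyticAt_Dx (hH q (hball hq))).mul (analyticAt_Dy (hD q (hball hq)))).sub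
        ((analyticAt_Dy (hH q (hball hq))).mul (analyticAt_Dx (hD q (hball hq))))
    have hWo : IsOpen (L ⁻¹' Ω) := hΩ.preimage L.continuous
    have hWsub : L ⁻¹' Ω ⊆ W₀ := preimage_mono (subset_closure.trans hsub)
    have hcl : (0 : ℝ × ℝ) ∈ closure (L ⁻¹' Ω) := by
      have : L ⁻¹' closure Ω = closure (L ⁻¹' Ω) := L.toHomeomorph.preimage_closure Ω
      rwa [← this, mem_preimage, map_zero]
    obtain ⟨z, hzb, hzW⟩ := mem_closure_iff.1 hcl _ Metric.isOpen_ball (Metric.mem_ball_self hr)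
    have hz : (fun q => Dx H q * Dy (A * A + B * B) q - Dy H q * Dx (A * A + B * B) q) =ᶠ[𝓝 z] 0 := by
      filter_upwards [hWo.mem_nhds hzW] with q hq
      rw [hHx, hHy]
      refine sub_eq_zero.2 (bracket_eq_zero_of_invariant hFrot hFzero hWo
        (N := fun q => rotHess c s (hess u (L q))) (fun q hq => ?_) (fun q hq => ?_)
        (fun q hq => ?_) (fun q hq => ?_) (hT.mono hWsub) (hD.mono hWsub) hq)
      · exact rotHess_isSymm (hess_isSymm (hu _ (hWsub hq)))
      · exact (hFrot _ (hess_isSymm (hu _ (hWsub hq))) _ (rotation_mem_orthogonalGroup h)).trans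
          (hsol _ hq)
      · rw [← exx q (hWsub hq), ← eyy q (hWsub hq), ← one_mul (Dy (Dy v) q)]
      · rw [disc, ← exx q (hWsub hq), ← eyy q (hWsub hq), ← exy q (hWsub hq)]
        change (Dx (Dx v) q + (-1) * Dy (Dy v) q + 0) * (Dx (Dx v) q + (-1) * Dy (Dy v) q + 0) +
          (2 * Dx (Dy v) q) * (2 * Dx (Dy v) q) = _
        ring
    have := hΦ.eqOn_zero_of_preconnected_of_eventuallyEq_zero
      (convex_ball _ _).isPreconnected hzb hz
    filter_upwards [Metric.ball_mem_nhds _ hr] with q hq using this hq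
  have hv0 := hv 0 h0W
  have hval : ∀ i j, rotHess c s (hess u (L 0)) i j = (k • (1 : Matrix (Fin 2) (Fin 2) ℝ)) i j := by
    intro i j; rw [map_zero, hk, rotHess_smul_one h]
  have tyy : taylor (Dy (Dy v)) = dy (dy (taylor v)) := by rw [taylor_Dy, taylor_Dy]
  have txx : taylor (Dx (Dx v)) = dx (dx (taylor v)) := by
    rw [taylor_Dx (analyticAt_Dx hv0), taylor_Dx hv0]
  have txy : taylor (Dx (Dy v)) = dx (dy (taylor v)) := by
    rw [taylor_Dx (analyticAt_Dy hv0), taylor_Dy]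
  have cxx : cf 0 0 (dx (dx (taylor v))) = k := by
    rw [← txx, taylor_zero_zero, exx 0 h0W, hval]; simp
  have cyy : cf 0 0 (dy (dy (taylor v))) = k := by
    rw [← tyy, taylor_zero_zero, eyy 0 h0W, hval]; simp
  have cxy : cf 1 1 (taylor v) = 0 := by
    have : cf 0 0 (dx (dy (taylor v))) = 0 := by
      rw [← txy, taylor_zero_zero, exy 0 h0W, hval]; simp
    rw [cf_dx, cf_dy] at this
    simpa using this
  have tA : taylor A = _ := taylor_affine (hxx 0 h0W) (hyy 0 h0W) (-1) 0
  have tH : taylor H = _ := taylor_affine (hxx 0 h0W) (hyy 0 h0W) 1 (-(2 * k))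
  have tB : taylor B = _ := taylor_const_mul (hxy 0 h0W) 2
  have hlH := isXLeading_second_derivatives hn hlead (1 : ℝ) _ rfl ((- -(2 * k) : ℝ) : ℂ)
    (by rw [map_add, cf_C_C_mul, cxx, cyy]; push_cast; ring)
  have hlA := isXLeading_second_derivatives hn hlead (-1 : ℝ) _ rfl ((-0 : ℝ) : ℂ)
    (by rw [map_add, cf_C_C_mul, cxx, cyy]; push_cast; ring)
  have hlB := isXLeading_mixed_derivative hlead (2 : ℝ) cxy
  rw [← txx, ← tyy, ← tA] at hlA
  rw [← txx, ← tyy, ← tH] at hlH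
  rw [← txy, ← tB] at hlB
  have hc : (((n + 1 : ℕ) : ℂ) + 1) * (((n + 1 : ℕ) : ℂ) + 2) * e =
      (((((n + 1 : ℕ) : ℝ) + 1) * (((n + 1 : ℕ) : ℝ) + 2) * e : ℝ) : ℂ) := by push_cast; ring
  rw [hc] at hlA hlH
  obtain ⟨σ, hσ, hσ0, hσ1, a, b, ha, hb, ha0, hb0, hAa, hBb⟩ := exists_common_factor
    (by positivity) (hH 0 h0W) (hA 0 h0W) (hB 0 h0W)
    (by filter_upwards [hv0.eventually_analyticAt] with q hq using codazzi_x hq _)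
    (by filter_upwards [hv0.eventually_analyticAt] with q hq using codazzi_y hq _)
    (by filter_upwards [hbr] with q hq using sub_eq_zero.1 hq) hlH hlA hlB
  refine ⟨c, s, h, n, σ, a, b, hσ, hσ0, hσ1, ha, hb, ha0, hb0, ?_⟩
  filter_upwards [hAa, hBb, hW₀.mem_nhds h0W] with q h1 h2 hq
  rw [← exx q hq, ← eyy q hq, ← exy q hq, ← h1, ← h2]
  refine ⟨?_, rfl⟩
  change _ = Dx (Dx v) q + (-1) * Dy (Dy v) q + 0
  ring

end Reduction

end HessianPlane

namespace HessianPlane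

/-! ### Eigenlines of symmetric matrices. -/

section Eigenlines

lemma mulVec_ofLp_eq_iff {M : Matrix (Fin 2) (Fin 2) ℝ} {v : Plane} {k : ℝ} :
    M *ᵥ v.ofLp = k • v.ofLp ↔ M 0 0 * v 0 + M 0 1 * v 1 = k * v 0 ∧
      M 1 0 * v 0 + M 1 1 * v 1 = k * v 1 := by
  rw [funext_iff, Fin.forall_fin_two]
  simp [Matrix.mulVec, dotProduct, Fin.sum_univ_two]

lemma span_singleton_eq_of_smul {v z : Plane} {k : ℝ} (hz : z ≠ 0) (h : z = k • v) :
    Submodule.span ℝ {z} = Submodule.span ℝ {v} := by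
  have hk : k ≠ 0 := fun hk => hz (by rw [h, hk, zero_smul])
  rw [h, Submodule.span_singleton_smul_eq (IsUnit.mk0 k hk)]

/-- The eigenlines of a symmetric matrix that is not a multiple of the identity are spanned by an
eigenvector `v` and by a vector orthogonal to `v`. -/
lemma eigenlines_eq {M : Matrix (Fin 2) (Fin 2) ℝ} (hM : M.IsSymm)
    (hM' : ¬ ∃ k : ℝ, M = k • (1 : Matrix (Fin 2) (Fin 2) ℝ)) {v w : Plane} (hv : v ≠ 0)
    (hw0 : w 0 = - v 1) (hw1 : w 1 = v 0)
    (hcross : v 0 * (M 0 1 * v 0 + M 1 1 * v 1) = v 1 * (M 0 0 * v 0 + M 0 1 * v 1)) :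
    {ℓ | IsEigenline M ℓ} = {Submodule.span ℝ {v}, Submodule.span ℝ {w}} := by
  have h10 : M 1 0 = M 0 1 := hM.apply 0 1
  have hd : v 0 ^ 2 + v 1 ^ 2 ≠ 0 := by
    intro h
    refine hv ?_
    ext i
    fin_cases i
    · have : v 0 ^ 2 = 0 := by linarith [sq_nonneg (v 0), sq_nonneg (v 1)]
      exact pow_eq_zero_iff two_ne_zero |>.1 this
    · have : v 1 ^ 2 = 0 := by linarith [sq_nonneg (v 0), sq_nonneg (v 1)]
      exact pow_eq_zero_iff two_ne_zero |>.1 this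
  have hw : w ≠ 0 := by
    rintro rfl
    refine hd ?_
    simp only [PiLp.zero_apply] at hw0 hw1
    rw [← hw1, ← neg_eq_iff_eq_neg.2 hw0]; simp
  set d := v 0 ^ 2 + v 1 ^ 2
  -- `l` and `m` are the Rayleigh quotients of `v` and of the orthogonal vector `w`, and `hcross`
  -- says that `M v` is parallel to `v`.
  set l := (v 0 * (M 0 0 * v 0 + M 0 1 * v 1) + v 1 * (M 0 1 * v 0 + M 1 1 * v 1)) / d with hl
  set m := (v 1 * (M 0 0 * v 1 - M 0 1 * v 0) - v 0 * (M 0 1 * v 1 - M 1 1 * v 0)) / d with hm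
  have hld : l * d = _ := div_mul_cancel₀ _ hd
  have hmd : m * d = _ := div_mul_cancel₀ _ hd
  have e1 : M 0 0 * v 0 + M 0 1 * v 1 = l * v 0 := mul_right_cancel₀ hd (by
    linear_combination (-v 0) * hld - v 1 * hcross)
  have e2 : M 0 1 * v 0 + M 1 1 * v 1 = l * v 1 := mul_right_cancel₀ hd (by
    linear_combination (-v 1) * hld + v 0 * hcross)
  have f1 : -(M 0 0 * v 1) + M 0 1 * v 0 = - (m * v 1) := mul_right_cancel₀ hd (by
    linear_combination (v 1) * hmd + v 0 * hcross)
  have f2 : -(M 0 1 * v 1) + M 1 1 * v 0 = m * v 0 := mul_right_cancel₀ hd (by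
    linear_combination (-v 0) * hmd + v 1 * hcross)
  have hlm : l ≠ m := by
    intro hlm
    refine hM' ⟨l, ?_⟩
    rw [← hlm] at f1 f2
    ext i j
    fin_cases i <;> fin_cases j
    · simp
      exact mul_right_cancel₀ hd (by linear_combination v 0 * e1 - v 1 * f1)
    · simp
      exact mul_right_cancel₀ hd (by linear_combination v 1 * e1 + v 0 * f1)
    · simp
      rw [h10]
      exact mul_right_cancel₀ hd (by linear_combination v 1 * e1 + v 0 * f1)
    · simp
      exact mul_right_cancel₀ hd (by linear_combination v 1 * e2 + v 0 * f2)
  ext ℓ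
  simp only [mem_ofPred_eq, mem_insert_iff, mem_singleton_iff]
  constructor
  · rintro ⟨z, k, hz, hMz, rfl⟩
    obtain ⟨z1, z2⟩ := mulVec_ofLp_eq_iff.1 hMz
    rw [h10] at z2
    -- Pair the eigenvector equation of `z` with `v` and with `w`. As `l ≠ m`, one of the two
    -- components of `z` vanishes.
    have p1 : (z 0 * v 0 + z 1 * v 1) * (l - k) = 0 := by
      linear_combination v 0 * z1 + v 1 * z2 - z 0 * e1 - z 1 * e2
    have p2 : (-z 0 * v 1 + z 1 * v 0) * (m - k) = 0 := by
      linear_combination - v 1 * z1 + v 0 * z2 - z 0 * f1 - z 1 * f2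
    rcases mul_eq_zero.1 p1 with hα | hlk
    · right
      refine span_singleton_eq_of_smul (k := (-z 0 * v 1 + z 1 * v 0) / d) hz ?_
      ext i
      fin_cases i
      · simp [hw0]; field_simp; linear_combination v 0 * hα
      · simp [hw1]; field_simp; linear_combination v 1 * hα
    · left
      have hβ : -z 0 * v 1 + z 1 * v 0 = 0 := (mul_eq_zero.1 p2).resolve_right fun hmk =>
        hlm (by linarith)
      refine span_singleton_eq_of_smul (k := (z 0 * v 0 + z 1 * v 1) / d) hz ?_
      ext i
      fin_cases i
      · simp; field_simp; linear_combination - v 1 * hβ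
      · simp; field_simp; linear_combination v 0 * hβ
  · rintro (rfl | rfl)
    · exact ⟨v, l, hv, mulVec_ofLp_eq_iff.2 ⟨e1, by rw [h10]; exact e2⟩, rfl⟩
    · refine ⟨w, m, hw, mulVec_ofLp_eq_iff.2 ⟨?_, ?_⟩, rfl⟩
      · rw [hw0, hw1]; linear_combination f1
      · rw [hw0, hw1, h10]; linear_combination f2

variable {c s : ℝ} (h : c ^ 2 + s ^ 2 = 1) {M : Matrix (Fin 2) (Fin 2) ℝ} (hM : M.IsSymm)

include h hM in
lemma exists_eq_smul_one_iff : (∃ k : ℝ, M = k • (1 : Matrix (Fin 2) (Fin 2) ℝ)) ↔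
    rotHess c s M 0 0 - rotHess c s M 1 1 = 0 ∧ 2 * rotHess c s M 0 1 = 0 := by
  constructor
  · rintro ⟨k, rfl⟩
    rw [rotHess_smul_one h]
    simp
  · have h10 : M 1 0 = M 0 1 := hM.apply 0 1
    have h2 : (c ^ 2 + s ^ 2) ^ 2 = 1 := by rw [h, one_pow]
    rintro ⟨e1, e2⟩
    simp [rotHess, Matrix.mul_apply, Fin.sum_univ_two] at e1 e2
    rw [h10] at e1 e2
    have d1 : M 0 0 = M 1 1 := by
      have e2' : c * (-(M 0 0 * s) + M 0 1 * c) + s * (-(M 0 1 * s) + M 1 1 * c) = 0 := by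
        linear_combination e2
      linear_combination (c ^ 2 - s ^ 2) * e1 - 4 * c * s * e2' - (M 0 0 - M 1 1) * h2
    have d2 : M 0 1 = 0 := by
      have e2' : c * (-(M 0 0 * s) + M 0 1 * c) + s * (-(M 0 1 * s) + M 1 1 * c) = 0 := by
        linear_combination e2
      linear_combination (c * s) * e1 + (c ^ 2 - s ^ 2) * e2' - M 0 1 * h2
    refine ⟨M 0 0, ?_⟩
    ext i j
    fin_cases i <;> fin_cases j <;> simp [h10, d1, d2]

include hM in
-- The left side is the determinant of `(V, M V)` for `V = frame c s h (t, r)`; it is invariant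
-- under rotation and vanishes exactly when `M V` is parallel to `V`.
lemma cross_frame (r t : ℝ) :
    frame c s h (t, r) 0 * (M 0 1 * frame c s h (t, r) 0 + M 1 1 * frame c s h (t, r) 1) -
      frame c s h (t, r) 1 * (M 0 0 * frame c s h (t, r) 0 + M 0 1 * frame c s h (t, r) 1) =
    rotHess c s M 0 1 * (r ^ 2 - t ^ 2) - (rotHess c s M 0 0 - rotHess c s M 1 1) * (r * t) := by
  have h10 : M 1 0 = M 0 1 := hM.apply 0 1
  simp [rotHess, Matrix.mul_apply, Fin.sum_univ_two, h10]
  ring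

end Eigenlines

/-! ### The part of the graph inside a disk. -/

section Curve

/-- Slope at most `1 / 2` bounds the variation of `σ ^ 2` by a quarter of that of `t ^ 2`, so the
distance to the origin increases strictly along the graph, which leaves the disk once. -/
lemma exists_radius_iff {ε : ℝ} (hε : 0 < ε) {σ : ℝ → ℝ} (h0 : σ 0 = 0)
    (hσ : ∀ x ∈ Icc 0 ε, ∀ y ∈ Icc 0 ε, |σ x - σ y| ≤ 1 / 2 * |x - y|) :
    ∃ β, 0 < β ∧ β ≤ ε ∧ ∀ t ∈ Icc 0 ε, t ^ 2 + σ t ^ 2 < ε ^ 2 ↔ t < β := by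
  have hmono : StrictMonoOn (fun t => t ^ 2 + σ t ^ 2) (Icc 0 ε) := by
    intro x hx y hy hxy
    have h1 := hσ y hy x hx
    have h2 := hσ y hy 0 (left_mem_Icc.2 hε.le)
    have h3 := hσ x hx 0 (left_mem_Icc.2 hε.le)
    rw [h0, sub_zero, sub_zero, abs_of_nonneg hy.1] at h2
    rw [h0, sub_zero, sub_zero, abs_of_nonneg hx.1] at h3
    rw [abs_of_pos (sub_pos.2 hxy)] at h1
    have h4 : |σ y + σ x| ≤ 1 / 2 * (y + x) := (abs_add_le _ _).trans (by linarith)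
    have h5 : |(σ y - σ x) * (σ y + σ x)| ≤ (1 / 2 * (y - x)) * (1 / 2 * (y + x)) := by
      rw [abs_mul]
      exact mul_le_mul h1 h4 (abs_nonneg _) (by linarith)
    have h6 := (abs_le.1 h5).1
    have h7 : 0 < (y - x) * (y + x) := mul_pos (by linarith) (by linarith [hx.1])
    change x ^ 2 + σ x ^ 2 < y ^ 2 + σ y ^ 2
    nlinarith
  have hcont : ContinuousOn σ (Icc 0 ε) := by
    have : LipschitzOnWith (1 / 2) σ (Icc 0 ε) := LipschitzOnWith.of_dist_le_mul fun x hx y hy => by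
      simpa [Real.dist_eq] using hσ x hx y hy
    exact this.continuousOn
  have hg : ContinuousOn (fun t => t ^ 2 + σ t ^ 2) (Icc 0 ε) :=
    (continuousOn_id.pow 2).add (hcont.pow 2)
  have hmem : ε ^ 2 ∈ Icc ((0 : ℝ) ^ 2 + σ 0 ^ 2) (ε ^ 2 + σ ε ^ 2) := by
    constructor
    · rw [h0]; nlinarith
    · nlinarith
  obtain ⟨β, hβ, hβε⟩ := intermediate_value_Icc hε.le hg hmem
  have hβ0 : 0 < β := by
    refine hβ.1.lt_of_ne ?_
    rintro rfl
    have : ε ^ 2 = 0 := by simpa [h0] using hβε.symm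
    exact hε.ne' (pow_eq_zero_iff two_ne_zero |>.1 this)
  refine ⟨β, hβ0, hβ.2, fun t ht => ?_⟩
  rw [← hmono.lt_iff_lt ht hβ]
  simp only at hβε
  rw [hβε]

/-- Graphs of functions with small slope meet disks in intervals. -/
lemma exists_Ioo_iff {ε : ℝ} (hε : 0 < ε) {σ : ℝ → ℝ} (h0 : σ 0 = 0)
    (hσ : ∀ x ∈ Icc (-ε) ε, ∀ y ∈ Icc (-ε) ε, |σ x - σ y| ≤ 1 / 2 * |x - y|) :
    ∃ α β, α < 0 ∧ 0 < β ∧ ∀ t, t ^ 2 + σ t ^ 2 < ε ^ 2 ↔ t ∈ Ioo α β := by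
  obtain ⟨β, hβ, hβε, hβiff⟩ := exists_radius_iff hε h0 fun x hx y hy =>
    hσ x ⟨by linarith [hx.1], hx.2⟩ y ⟨by linarith [hy.1], hy.2⟩
  obtain ⟨α, hα, hαε, hαiff⟩ := exists_radius_iff (σ := fun t => σ (-t)) hε (by simpa using h0)
    fun x hx y hy => by
      have := hσ (-x) ⟨by linarith [hx.2], by linarith [hx.1]⟩ (-y)
        ⟨by linarith [hy.2], by linarith [hy.1]⟩
      rwa [neg_sub_neg, abs_sub_comm y x] at this
  refine ⟨-α, β, by linarith, hβ, fun t => ?_⟩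
  by_cases ht : |t| ≤ ε
  · obtain ⟨ht1, ht2⟩ := abs_le.1 ht
    rcases le_total 0 t with hp | hp
    · rw [hβiff t ⟨hp, ht2⟩]
      exact ⟨fun h => ⟨by linarith, h⟩, fun h => h.2⟩
    · have := hαiff (-t) ⟨by linarith, by linarith⟩
      rw [neg_neg, neg_sq] at this
      rw [this]
      exact ⟨fun h => ⟨by linarith, by linarith⟩, fun h => by linarith [h.1]⟩
  · push Not at ht
    refine ⟨fun h => absurd h (not_lt.2 ?_), fun h => absurd ht (not_lt.2 (abs_le.2 ?_))⟩
    · have := pow_le_pow_left₀ hε.le ht.le 2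
      rw [sq_abs] at this
      nlinarith [sq_nonneg (σ t)]
    · exact ⟨by linarith [h.1], by linarith [h.2]⟩

lemma exists_slope_bound {σ : ℝ → ℝ} (hσ : AnalyticAt ℝ σ 0) (hσ' : deriv σ 0 = 0) :
    ∃ r > 0, ∀ x ∈ Metric.ball (0 : ℝ) r, ∀ y ∈ Metric.ball (0 : ℝ) r,
      |σ x - σ y| ≤ 1 / 2 * |x - y| := by
  have h1 : HasStrictDerivAt σ 0 0 := by
    simpa only [hσ'] using hσ.hasStrictDerivAt
  have h2 : HasStrictFDerivAt σ (0 : ℝ →L[ℝ] ℝ) 0 := by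
    simpa using h1.hasStrictFDerivAt
  obtain ⟨U, hU, hL⟩ := h2.exists_lipschitzOnWith_of_nnnorm_lt (1 / 2) (by simp)
  obtain ⟨r, hr, hrU⟩ := Metric.mem_nhds_iff.1 hU
  refine ⟨r, hr, fun x hx y hy => ?_⟩
  simpa [Real.dist_eq] using hL.dist_le_mul x (hrU hx) y (hrU hy)

end Curve

/-! ### An analytic eigenvector field. -/

section EigenField

/-- An analytic eigenvector field `(r, t)` of the traceless symmetric matrices with first row
`(a, b)`. -/
lemma exists_eigenfield {a b : ℝ × ℝ → ℝ} (ha : AnalyticAt ℝ a 0) (hb : AnalyticAt ℝ b 0)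
    (ha0 : a 0 ≠ 0) (hb0 : b 0 = 0) : ∃ r t : ℝ × ℝ → ℝ, AnalyticAt ℝ r 0 ∧ AnalyticAt ℝ t 0 ∧
      r 0 ≠ 0 ∧ t 0 = 0 ∧ ∀ᶠ q in 𝓝 0, b q * (r q ^ 2 - t q ^ 2) = 2 * a q * (r q * t q) := by
  -- The relation is invariant under changing the sign of `(a, b)`, and `0 < a 0` keeps `a + ρ` away
  -- from zero.
  wlog hpos : 0 < a 0 generalizing a b
  · obtain ⟨r, t, hr, ht, hr0, ht0, h⟩ := this ha.neg hb.neg (neg_ne_zero.2 ha0)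
      (neg_eq_zero.2 hb0) (neg_pos.2 (lt_of_le_of_ne (not_lt.1 hpos) ha0))
    refine ⟨r, t, hr, ht, hr0, ht0, h.mono fun q hq => ?_⟩
    simp only [Pi.neg_apply] at hq
    linear_combination -hq
  have hD : AnalyticAt ℝ (fun q => a q ^ 2 + b q ^ 2) 0 := (ha.pow 2).add (hb.pow 2)
  have hD0 : 0 < a 0 ^ 2 + b 0 ^ 2 := by positivity
  -- `ρ` is the square root of `a ^ 2 + b ^ 2`, in a form that is visibly analytic. The vector `(a +
  -- ρ, b)` has half the polar angle of `(a, b)`.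
  let ρ : ℝ × ℝ → ℝ := fun q => Real.exp (Real.log (a q ^ 2 + b q ^ 2) * (1 / 2))
  have hlog : AnalyticAt ℝ (fun q => Real.log (a q ^ 2 + b q ^ 2)) 0 :=
    AnalyticAt.comp (g := Real.log) (analyticAt_log hD0) hD
  have hρ : AnalyticAt ℝ ρ 0 := (hlog.mul analyticAt_const).rexp
  refine ⟨fun q => a q + ρ q, b, ha.add hρ, hb, (add_pos hpos (Real.exp_pos _)).ne', hb0, ?_⟩
  filter_upwards [hD.continuousAt.eventually (lt_mem_nhds hD0)] with q hq
  have hsq : ρ q * ρ q = a q ^ 2 + b q ^ 2 := by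
    rw [← Real.exp_add, ← mul_add]
    norm_num
    exact Real.exp_log hq
  linear_combination b q * hsq

end EigenField

end HessianPlane

/-! ### Assembly of the theorem. -/

open HessianPlane

theorem proposition4p1
    (F : Matrix (Fin 2) (Fin 2) ℝ → ℝ)
    (hFrot : HessianPlane.RotationallyInvariant F)
    (hFzero : HessianPlane.NeverLocallyZero F)
    (Ω Ω₀ : Set HessianPlane.Plane) (hΩ : IsOpen Ω) (hΩ₀ : IsOpen Ω₀) (hsub : closure Ω ⊆ Ω₀)
    (u : HessianPlane.Plane → ℝ) (hu : AnalyticOnNhd ℝ u Ω₀)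
    (hsol : ∀ p ∈ Ω, F (HessianPlane.hess u p) = 0)
    (h0 : (0 : HessianPlane.Plane) ∈ HessianPlane.umbilicSet u (closure Ω))
    (hpar : HessianPlane.IsParabolicAtOrigin u) :
    ∃ ε : ℝ, 0 < ε ∧ Metric.ball (0 : HessianPlane.Plane) ε ⊆ Ω₀ ∧
      ∃ (γ : ℝ → HessianPlane.Plane) (α β : ℝ), α < 0 ∧ 0 < β ∧ γ 0 = 0 ∧
        HessianPlane.ParametrizesRegularAnalyticCurve γ α β
          (Metric.ball 0 ε ∩ HessianPlane.umbilicSet u Ω₀) ∧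
        ∃ L₁ L₂ : HessianPlane.Plane → Submodule ℝ HessianPlane.Plane,
          HessianPlane.IsAnalyticLineField L₁ (Metric.ball 0 ε) ∧
          HessianPlane.IsAnalyticLineField L₂ (Metric.ball 0 ε) ∧
          (∀ p ∈ Metric.ball (0 : HessianPlane.Plane) ε \ HessianPlane.umbilicSet u Ω₀,
            {ℓ | HessianPlane.IsEigenline (HessianPlane.hess u p) ℓ} = {L₁ p, L₂ p}) ∧
          (deriv γ 0 ∈ L₁ 0 ∨ deriv γ 0 ∈ L₂ 0) := by
  obtain ⟨c, s, h, n, σ, a, b, hσ, hσ0, hσ1, ha, hb, ha0, hb0, hfac⟩ :=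
    exists_umbilic_factorization hFrot hFzero hΩ hΩ₀ hsub hu hsol h0 hpar
  obtain ⟨r, t, hr, ht, hr0, ht0, hrt⟩ := exists_eigenfield ha hb ha0 hb0
  obtain ⟨δ, hδ, hslope⟩ := exists_slope_bound hσ hσ1
  set L := frame c s h with hL
  have hgood : ∀ᶠ q in 𝓝 (0 : ℝ × ℝ), L q ∈ Ω₀ ∧ AnalyticAt ℝ σ q.1 ∧ a q ≠ 0 ∧ r q ≠ 0 ∧
      AnalyticAt ℝ r q ∧ AnalyticAt ℝ t q ∧ b q * (r q ^ 2 - t q ^ 2) = 2 * a q * (r q * t q) ∧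
      rotHess c s (hess u (L q)) 0 0 - rotHess c s (hess u (L q)) 1 1 =
          (q.2 - σ q.1) ^ (n + 1) * a q ∧
        2 * rotHess c s (hess u (L q)) 0 1 = (q.2 - σ q.1) ^ (n + 1) * b q := by
    have hΩ0 : ∀ᶠ q in 𝓝 (0 : ℝ × ℝ), L q ∈ Ω₀ := by
      refine L.continuous.continuousAt.eventually (hΩ₀.mem_nhds ?_)
      rw [map_zero]
      exact hsub h0.1
    have hσ' : ∀ᶠ q in 𝓝 (0 : ℝ × ℝ), AnalyticAt ℝ σ q.1 :=
      (continuous_fst.tendsto (0 : ℝ × ℝ)).eventually hσ.eventually_analyticAt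
    filter_upwards [hΩ0, hσ', ha.continuousAt.eventually_ne ha0, hr.continuousAt.eventually_ne hr0,
      hr.eventually_analyticAt, ht.eventually_analyticAt, hrt, hfac] with q h1 h2 h3 h4 h5 h6 h7 h8
    exact ⟨h1, h2, h3, h4, h5, h6, h7, h8⟩
  have hgood' := (L.symm.continuous.tendsto' 0 0 (map_zero _)).eventually hgood
  obtain ⟨η, hη, hball⟩ := Metric.eventually_nhds_iff_ball.1 hgood'
  -- Halving gives `ε < δ`, so that the slope bound holds on the closed interval `[-ε, ε]`.
  set ε := min η δ / 2 with hεdef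
  have hε : 0 < ε := by positivity
  have hεη : ε < η := (half_lt_self (lt_min hη hδ)).trans_le (min_le_left _ _)
  have hεδ : ε < δ := (half_lt_self (lt_min hη hδ)).trans_le (min_le_right _ _)
  have hball_iff : ∀ q, L q ∈ Metric.ball (0 : Plane) ε ↔ q.1 ^ 2 + q.2 ^ 2 < ε ^ 2 := fun q => by
    rw [mem_ball_zero_iff, ← norm_frame_sq h q, sq_lt_sq₀ (norm_nonneg _) hε.le]
  have hgood : ∀ q, L q ∈ Metric.ball (0 : Plane) ε → _ := fun q hq =>
    L.symm_apply_apply q ▸ hball (L q) (Metric.ball_subset_ball hεη.le hq)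
  -- As `a ≠ 0`, the traceless part vanishes only where the common factor does.
  have humb : ∀ q, L q ∈ Metric.ball (0 : Plane) ε → (L q ∈ umbilicSet u Ω₀ ↔ q.2 = σ q.1) := by
    intro q hq
    obtain ⟨h1, -, h3, -, -, -, -, h8, h9⟩ := hgood q hq
    have : L q ∈ umbilicSet u Ω₀ ↔ ∃ k : ℝ, hess u (L q) = k • (1 : Matrix (Fin 2) (Fin 2) ℝ) :=
      and_iff_right h1
    rw [this, exists_eq_smul_one_iff h (hess_isSymm (hu _ h1)), h8, h9]
    constructor
    · rintro ⟨h, -⟩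
      exact sub_eq_zero.1 (pow_eq_zero_iff n.succ_ne_zero |>.1 ((mul_eq_zero.1 h).resolve_right h3))
    · intro h
      simp [h]
  obtain ⟨α, β, hα, hβ, hαβ⟩ := exists_Ioo_iff hε hσ0 fun x hx y hy =>
    hslope x (by rw [mem_ball_zero_iff]; exact (abs_le.2 hx).trans_lt hεδ)
      y (by rw [mem_ball_zero_iff]; exact (abs_le.2 hy).trans_lt hεδ)
  set γ : ℝ → Plane := fun x => L (x, σ x) with hγ
  have hγball : ∀ x, γ x ∈ Metric.ball (0 : Plane) ε ↔ x ∈ Ioo α β := fun x =>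
    (hball_iff _).trans (hαβ x)
  have hσan : ∀ x ∈ Ioo α β, AnalyticAt ℝ σ x := fun x hx =>
    (hgood (x, σ x) ((hγball x).2 hx)).2.1
  have hγan : AnalyticOnNhd ℝ γ (Ioo α β) := fun x hx =>
    (L.analyticAt _).comp (analyticAt_id.prod (hσan x hx))
  have hγd : ∀ x ∈ Ioo α β, deriv γ x = L (1, deriv σ x) := fun x hx =>
    (L.toContinuousLinearMap.hasFDerivAt.comp_hasDerivAt x
      ((hasDerivAt_id x).prodMk (hσan x hx).differentiableAt.hasDerivAt)).deriv
  have h00 : (0 : ℝ) ∈ Ioo α β := ⟨hα, hβ⟩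
  refine ⟨ε, hε, fun p hp => ?_, γ, α, β, hα, hβ, by simp [hγ, hσ0], ⟨hγan, fun x hx => ?_, ?_, ?_⟩,
    fun p => Submodule.span ℝ {L (t (L.symm p), r (L.symm p))},
    fun p => Submodule.span ℝ {L (r (L.symm p), - t (L.symm p))}, ?_, ?_, ?_, Or.inr ?_⟩
  · rw [← L.apply_symm_apply p] at hp ⊢
    exact (hgood _ hp).1
  · rw [hγd x hx]
    intro h
    simpa using congrArg Prod.fst ((map_eq_zero_iff L L.injective).1 h)
  · have hc : ContinuousOn γ (Ioo α β) := hγan.continuousOn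
    -- The coordinate `y` is a continuous left inverse of `γ`.
    refine IsEmbedding.of_comp (g := fun p => (L.symm p).1) hc.domRestrict
      (continuous_fst.comp L.symm.continuous) ?_
    have : (fun p => (L.symm p).1) ∘ (Ioo α β).domRestrict γ = Subtype.val := by
      ext x
      change (L.symm (L _)).1 = _
      rw [L.symm_apply_apply]
    rw [this]
    exact IsEmbedding.subtypeVal
  · ext p
    obtain ⟨q, rfl⟩ := L.surjective p
    constructor
    · rintro ⟨x, hx, hxq⟩
      have hb := (hγball x).2 hx
      rw [← hxq]
      exact ⟨hb, (humb (x, σ x) hb).2 rfl⟩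
    · rintro ⟨hb, hq⟩
      have hq' : q = (q.1, σ q.1) := Prod.ext rfl ((humb q hb).1 hq)
      refine ⟨q.1, (hγball _).1 ?_, ?_⟩
      · rw [hγ]; beta_reduce; rwa [← hq']
      · rw [hγ]; beta_reduce; rw [← hq']
  · intro p hp
    obtain ⟨-, -, -, h4, h5, h6, -⟩ := hball p (Metric.ball_subset_ball hεη.le hp)
    refine ⟨fun p => L (t (L.symm p), r (L.symm p)), (L.analyticAt _).comp
      ((h6.comp (L.symm.analyticAt p)).prod (h5.comp (L.symm.analyticAt p))), fun h => ?_,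
      Eventually.of_forall fun _ => rfl⟩
    exact h4 (congrArg Prod.snd ((map_eq_zero_iff L L.injective).1 h))
  · intro p hp
    obtain ⟨-, -, -, h4, h5, h6, -⟩ := hball p (Metric.ball_subset_ball hεη.le hp)
    refine ⟨fun p => L (r (L.symm p), - t (L.symm p)), (L.analyticAt _).comp
      ((h5.comp (L.symm.analyticAt p)).prod (h6.comp (L.symm.analyticAt p)).neg), fun h => ?_,
      Eventually.of_forall fun _ => rfl⟩
    exact h4 (congrArg Prod.fst ((map_eq_zero_iff L L.injective).1 h))
  · rintro p ⟨hp, hpu⟩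
    obtain ⟨q, rfl⟩ := L.surjective p
    obtain ⟨h1, -, -, h4, -, -, h7, h8, h9⟩ := hgood q hp
    have hM := hess_isSymm (hu _ h1)
    beta_reduce
    rw [L.symm_apply_apply]
    refine eigenlines_eq hM (fun hk => hpu ⟨h1, hk⟩) (fun h => ?_) ?_ ?_ (sub_eq_zero.1 ?_)
    · exact h4 (congrArg Prod.snd ((map_eq_zero_iff L L.injective).1 h))
    · rw [hL, frame_apply_zero, frame_apply_one]; ring
    · rw [hL, frame_apply_zero, frame_apply_one]; ring
    · rw [hL, cross_frame h hM, h8]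
      -- The power of `x - σ(y)` factors out of the determinant, leaving the eigenfield equation for
      -- `(a, b)`.
      linear_combination (r q ^ 2 - t q ^ 2) / 2 * h9 + (q.2 - σ q.1) ^ (n + 1) / 2 * h7
  -- At the origin `t = 0` and `deriv σ = 0`, so the second line and the tangent of `γ` are both the
  -- `y`-axis.
  · rw [hγd 0 h00, hσ1, Submodule.mem_span_singleton]
    refine ⟨(r 0)⁻¹, ?_⟩
    rw [map_zero, ht0, neg_zero, ← map_smul, Prod.smul_mk, smul_eq_mul, inv_mul_cancel₀ hr0, smul_zero]
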